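/- Let $M$ be a closed oriented connected 3-manifold with an oriented triangulation $\mathcal T_H$ (finitely many tetrahedra, faces glued in pairs by orientation-reversing affine isomorphisms) that has exactly one vertex, and let $K$ be an edge of $\mathcal T_H$, contained in a single face $F^K$, such that $F^K$ comes from two faces of one tetrahedron $T^K$ that share the edge $K$ and are glued to each other like a closed book with spine $K$ (a particular H-triangulation of the pair $(M,K)$). Assume that the two edges of $F^K$ other than $K$ are different edges of $\mathcal T_H$. Then collapsing $K$ to a point, $F^K$ to an edge and the two other faces of $T^K$ onto each other gives an ideal triangulation $\mathcal T_I$ of $M\setminus K$, whose tetrahedra are those of $\mathcal T_H$ other than $T^K$. Let $k$ be a commutative ring (for instance $k=\mathbb Z$ or $k=\mathbb C$). Let $R_I$ be the coordinate ring over $k$ of the deformation variety of $\mathcal T_I$: the commutative $k$-algebra with one generator $z$ for each edge of each tetrahedron of $\mathcal T_I$, and the relations $z_1z_2z_3=-1$ and $z_2-z_1z_2=1$ whenever $z_1,z_2,z_3$ belong to the edges at a vertex of a tetrahedron, in counterclockwise order, and $\prod_i z_i=1$ for each edge $E$ of $\mathcal T_I$, the product being over all edges of tetrahedra that are identified to $E$.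 Truncate the tetrahedra of $\mathcal T_H$ at their vertices, so that they are bounded by triangles (with short edges) and hexagons (with alternating short and long edges). Let $\tilde R_H$ be the (noncommutative) $k$-algebra with a pair of generators $u_e,v_e$ for each oriented short edge $e$ of the truncated triangulation (after gluing) that is disjoint from $K$, and the following relations, in which only short edges disjoint from $K$ occur: (1) $u_{\bar e}=u_e^{-1}$ and $v_{\bar e}=-u_e^{-1}v_e$, where $\bar e$ is $e$ with the opposite orientation; (2) $u_{\check e}=v_e$ and $v_{\check e}=u_e$, where $\check e$ is the oriented short edge in the same hexagon as $e$ such that the terminal points of $e$ and $\check e$ are the two ends of a long edge; (3) $u_{e_1}u_{e_2}u_{e_3}=1$ and $u_{e_1}u_{e_2}v_{e_3}+u_{e_1}v_{e_2}+v_{e_1}=0$ if $e_1,e_2,e_3$ are cyclically oriented short edges forming the boundary of a triangle. Let $R_H$ be the abelianization of $\tilde R_H$. Then there is a (necessarily unique) homomorphism of $k$-algebras $f:R_I\to R_H$ with the following property: if $z$ is the parameter of an edge $E$ of a tetrahedron of $\mathcal T_I$, and $e_i,e_j$ are the two short edges of that tetrahedron that start at an end of the long edge corresponding to $E$, where $E,e_i,e_j$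 are in clockwise order, then $v_{e_j}$ is invertible in $R_H$ and $f(z)=v_{e_i}v_{e_j}^{-1}$. If $H_1(M,\mathbb Z)=0$, then $f$ is an isomorphism of rings. -/

import Mathlib

open Equiv (Perm)

noncomputable section

/-! ### Oriented triangulations -/

/-- An oriented (possibly ideal) triangulation, given by face pairings.  `T` is the set of
tetrahedra; the vertices of each tetrahedron are labelled by `Fin 4`, in an order that induces its
orientation.  Face `i` of `t` is the face opposite to vertex `i`; it is glued to face `perm t i i` of
`adj t i` by the affine map that sends vertex `j ≠ i` to vertex `perm t i j`.  The gluing reverses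
the orientations of the faces exactly when the permutation `perm t i` is odd. -/
structure OrientedTriangulation (T : Type*) where
  adj : T → Fin 4 → T
  perm : T → Fin 4 → Perm (Fin 4)
  adj_adj : ∀ t i, adj (adj t i) (perm t i i) = t
  perm_perm : ∀ t i, perm (adj t i) (perm t i i) = (perm t i)⁻¹
  face_ne : ∀ t i, (adj t i, perm t i i) ≠ (t, i)
  sign_perm : ∀ t i, Perm.sign (perm t i) = -1

/-- A flag `(t, σ)` is a tetrahedron `t` with an ordering `σ 0, σ 1, σ 2, σ 3` of its vertices.
It is used to denote the vertex `σ 0`, the directed edge `σ 0 → σ 1`, the ordered triangle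
`σ 0, σ 1, σ 2` (the face opposite to `σ 3`), and also, in the truncated tetrahedron, the oriented
short edge which lies in the triangle cut off at `σ 0` and in the hexagon `σ 0 σ 1 σ 2`, and which
leads from the long edge `σ 0 σ 1` to the long edge `σ 0 σ 2`. -/
abbrev TetFlag (T : Type*) := T × Perm (Fin 4)

/-- Exchange the vertices at places `i` and `j` of a flag. -/
def TetFlag.swapAt {T : Type*} (i j : Fin 4) (F : TetFlag T) : TetFlag T := (F.1, F.2 * Equiv.swap i j)

/-- The (undirected) edges of a single tetrahedron. -/
abbrev TetEdge := {e : Sym2 (Fin 4) // ¬ e.IsDiag}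

/-- The edge `σ 0 σ 1` of the tetrahedron `t`, for a flag `(t, σ)`. -/
def TetFlag.edge {T : Type*} (F : TetFlag T) : T × TetEdge :=
  (F.1, ⟨s(F.2 0, F.2 1), by simp⟩)

namespace OrientedTriangulation

variable {T : Type*} (X : OrientedTriangulation T)

/-- Cross the face `σ 0 σ 1 σ 2` of a flag `(t, σ)`, to the flag that is glued to it. -/
def glue (F : TetFlag T) : TetFlag T := (X.adj F.1 (F.2 3), X.perm F.1 (F.2 3) * F.2)

/-- The vertices of the glued space. -/
def Vertex : Type _ :=
  Quot fun F G : TetFlag T => G = X.glue F ∨ G = F.swapAt 1 2 ∨ G = F.swapAt 2 3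

/-- The vertex `σ 0` of a flag. -/
def vertex (F : TetFlag T) : X.Vertex := Quot.mk _ F

/-- The (undirected) edges of the glued space. -/
def Edge : Type _ :=
  Quot fun i j : T × TetEdge => ∃ F : TetFlag T, i = F.edge ∧ j = (X.glue F).edge

/-- The edge of the glued space that comes from an edge of a tetrahedron. -/
def edgeClass (i : T × TetEdge) : X.Edge := Quot.mk _ i

/-- The directed edges of the glued space.  A directed edge is the same thing as an end of an edge
(its starting end), that is, a vertex of the triangulated vertex links. -/
def EdgeEnd : Type _ := Quot fun F G : TetFlag T => G = X.glue F ∨ G = F.swapAt 2 3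

/-- The undirected short edges of the glued truncated tetrahedra, that is, the edges of the
triangulated vertex links. -/
def LinkEdge : Type _ := Quot fun F G : TetFlag T => G = X.glue F ∨ G = F.swapAt 1 2

/-- The Euler characteristic (vertices - edges + triangles) of the union of the vertex links; the
triangles of the links are the corners `(t, i)` of the tetrahedra. -/
def linkEulerChar : ℤ :=
  (Nat.card X.EdgeEnd : ℤ) - (Nat.card X.LinkEdge : ℤ) + (Nat.card (T × Fin 4) : ℤ)

/-- The glued space is a closed 3-manifold and has exactly one vertex.  By the orientation condition
the glued space is always a 3-manifold away from its vertices, so that it is a closed 3-manifold if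
and only if the vertex link, which is a connected closed oriented surface if there is
only one vertex, is a 2-sphere, that is, has Euler characteristic 2. -/
structure IsOneVertexManifold : Prop where
  card_vertex : Nat.card X.Vertex = 1
  link_sphere : X.linkEulerChar = 2

/-! ### The first homology group, from the cellular chain complex -/

/-- Relations between oriented edges: glued ones are equal, an oriented edge depends only on
`σ 0` and `σ 1`, and reversing the direction changes the sign. -/
def edgeRel : Submodule ℤ (TetFlag T →₀ ℤ) := Submodule.span ℤ
  {c | ∃ F : TetFlag T, c = .single (X.glue F) 1 - .single F 1 ∨
    c = .single (F.swapAt 2 3) 1 - .single F 1 ∨ c = .single (F.swapAt 0 1) 1 + .single F 1}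

/-- Relations between oriented triangles: glued ones are equal, and odd permutations of the
vertices change the sign. -/
def triangleRel : Submodule ℤ (TetFlag T →₀ ℤ) := Submodule.span ℤ
  {c | ∃ F : TetFlag T, c = .single (X.glue F) 1 - .single F 1 ∨
    c = .single (F.swapAt 0 1) 1 + .single F 1 ∨ c = .single (F.swapAt 1 2) 1 + .single F 1}

/-- The group of 0-chains. -/
abbrev C₀ := X.Vertex →₀ ℤ

/-- The group of oriented 1-chains. -/
abbrev C₁ := (TetFlag T →₀ ℤ) ⧸ X.edgeRel

/-- The group of oriented 2-chains. -/
abbrev C₂ := (TetFlag T →₀ ℤ) ⧸ X.triangleRel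

/-- The oriented edge `[σ 0, σ 1]`. -/
def edgeChain (F : TetFlag T) : X.C₁ := X.edgeRel.mkQ (.single F 1)

lemma glue_swap (F : TetFlag T) {i j : Fin 4} (hi : i ≠ 3) (hj : j ≠ 3) :
    X.glue (F.swapAt i j) = (X.glue F).swapAt i j := by
  simp [glue, TetFlag.swapAt, Equiv.swap_apply_of_ne_of_ne hi.symm hj.symm, mul_assoc]

lemma edgeChain_glue (F : TetFlag T) : X.edgeChain (X.glue F) = X.edgeChain F := by
  rw [← sub_eq_zero, edgeChain, edgeChain, ← map_sub]
  exact (Submodule.Quotient.mk_eq_zero _).2 (Submodule.subset_span ⟨F, Or.inl rfl⟩)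

lemma edgeChain_swap (F : TetFlag T) : X.edgeChain (F.swapAt 0 1) = - X.edgeChain F := by
  rw [eq_neg_iff_add_eq_zero, edgeChain, edgeChain, ← map_add]
  exact (Submodule.Quotient.mk_eq_zero _).2 (Submodule.subset_span ⟨F, Or.inr (Or.inr rfl)⟩)

lemma vertex_glue (F : TetFlag T) : X.vertex (X.glue F) = X.vertex F :=
  (Quot.sound (r := fun F G : TetFlag T =>
    G = X.glue F ∨ G = F.swapAt 1 2 ∨ G = F.swapAt 2 3) (Or.inl rfl)).symm

lemma vertex_swap (F : TetFlag T) : X.vertex (F.swapAt 2 3) = X.vertex F :=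
  (Quot.sound (r := fun F G : TetFlag T =>
    G = X.glue F ∨ G = F.swapAt 1 2 ∨ G = F.swapAt 2 3) (Or.inr (Or.inr rfl))).symm

/-- The boundary map `[σ 0, σ 1] ↦ σ 1 - σ 0`. -/
def d₁ : X.C₁ →ₗ[ℤ] X.C₀ :=
  X.edgeRel.liftQ
    (Finsupp.linearCombination ℤ fun F : TetFlag T =>
      (.single (X.vertex (F.swapAt 0 1)) 1 - .single (X.vertex F) 1 : X.C₀)) <| by
    rw [edgeRel, Submodule.span_le]
    rintro c ⟨F, rfl | rfl | rfl⟩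
    · have h := X.glue_swap F (i := 0) (j := 1) (by decide) (by decide)
      simp [← h, vertex_glue]
    · have h : (F.swapAt 2 3).swapAt 0 1 = (F.swapAt 0 1).swapAt 2 3 := by
        simp only [TetFlag.swapAt, mul_assoc]
        congr 2
        decide
      simp [h, vertex_swap]
    · have h : (F.swapAt 0 1).swapAt 0 1 = F := by simp [TetFlag.swapAt, mul_assoc]
      simp [h]

/-- The boundary map `[σ 0, σ 1, σ 2] ↦ [σ 1, σ 2] - [σ 0, σ 2] + [σ 0, σ 1]`. -/
def d₂ : X.C₂ →ₗ[ℤ] X.C₁ :=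
  X.triangleRel.liftQ
    (Finsupp.linearCombination ℤ fun F : TetFlag T =>
      X.edgeChain ((F.swapAt 0 1).swapAt 1 2) - X.edgeChain (F.swapAt 1 2) + X.edgeChain F) <| by
    rw [triangleRel, Submodule.span_le]
    rintro c ⟨F, rfl | rfl | rfl⟩
    · have h1 := X.glue_swap F (i := 0) (j := 1) (by decide) (by decide)
      have h2 := X.glue_swap (F.swapAt 0 1) (i := 1) (j := 2) (by decide) (by decide)
      have h3 := X.glue_swap F (i := 1) (j := 2) (by decide) (by decide)
      simp [← h1, ← h2, ← h3, edgeChain_glue]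
    · have h : (F.swapAt 0 1).swapAt 0 1 = F := by simp [TetFlag.swapAt, mul_assoc]
      simp [h, edgeChain_swap]
      abel
    · have h1 : (F.swapAt 1 2).swapAt 1 2 = F := by simp [TetFlag.swapAt, mul_assoc]
      have h2 : ((F.swapAt 1 2).swapAt 0 1).swapAt 1 2 = ((F.swapAt 0 1).swapAt 1 2).swapAt 0 1 := by
        simp only [TetFlag.swapAt, mul_assoc]
        congr 2
        decide
      simp [h1, h2, edgeChain_swap]
      abel

/-- The first homology group, with integer coefficients, of the glued space. -/
abbrev H₁ := LinearMap.ker X.d₁ ⧸ (LinearMap.range X.d₂).submoduleOf (LinearMap.ker X.d₁)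

/-! ### The deformation variety -/

/-- The equations of the deformation variety, with one shape parameter for each edge of each
tetrahedron.  First, `z₁ z₂ z₃ = -1` and `z₂ - z₁ z₂ = 1` if `z₁, z₂, z₃` are the
parameters of the edges at a vertex `σ 0`, in counterclockwise order `σ 1, σ 2, σ 3`; second, for each
edge `E` of the glued space, the product of the parameters of all edges that are identified to `E`
is 1. -/
def shapeEquations (k : Type*) [CommRing k] [Fintype T] : Set (MvPolynomial (T × TetEdge) k) :=
  let z : TetFlag T → MvPolynomial (T × TetEdge) k := fun F => MvPolynomial.X F.edge
  {p | ∃ F : TetFlag T, Perm.sign F.2 = 1 ∧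
      (p = z F * z (F.swapAt 1 2) * z (F.swapAt 1 3) + 1 ∨
        p = z (F.swapAt 1 2) - z F * z (F.swapAt 1 2) - 1)} ∪
    {p | ∃ E : X.Edge, p =
      (open Classical in ∏ i : T × TetEdge with X.edgeClass i = E, MvPolynomial.X i) - 1}

/-- The coordinate ring of the deformation variety, over the coefficient ring `k`.  The equations
make each `z` and each `1 - z` invertible. -/
abbrev DeformationRing (k : Type*) [CommRing k] [Fintype T] :=
  MvPolynomial (T × TetEdge) k ⧸ Ideal.span (X.shapeEquations k)

/-- The shape parameter of the edge `σ 0 σ 1` of the tetrahedron `t`. -/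
def shape (k : Type*) [CommRing k] [Fintype T] (F : TetFlag T) : X.DeformationRing k :=
  Ideal.Quotient.mk _ (MvPolynomial.X F.edge)

end OrientedTriangulation

/-! ### Particular H-triangulations -/

/-- A particular H-triangulation of a pair `(M, K)`: an oriented one-vertex triangulation of a closed
3-manifold `M`, with a tetrahedron `tK` whose two faces at the edge `K` are glued to each other, like
a closed book with spine `K`.  The vertices of `tK` are labelled so that `K` is the edge `01`; then
the face `012` is glued to the face `013`, by the map that fixes the vertices `0` and `1` and
sends `2` to `3`.  (Hence `K` is on no other face.)  The other two edges `02` and `12` of the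
distinguished face are different edges of `M`, so that this face can be collapsed to an edge. -/
structure ParticularHTriangulation (T : Type*) extends OrientedTriangulation T where
  isOneVertexManifold : toOrientedTriangulation.IsOneVertexManifold
  tK : T
  adj_tK : adj tK 3 = tK
  perm_tK : perm tK 3 = Equiv.swap 2 3
  edge_ne : toOrientedTriangulation.edgeClass (tK, ⟨s(0, 2), by decide⟩) ≠
    toOrientedTriangulation.edgeClass (tK, ⟨s(1, 2), by decide⟩)

namespace ParticularHTriangulation

variable {T : Type*} (X : ParticularHTriangulation T)

lemma adj_tK_two : X.adj X.tK 2 = X.tK := by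
  have h := X.adj_adj X.tK 3
  rwa [X.adj_tK, X.perm_tK, Equiv.swap_apply_right] at h

lemma perm_tK_two : X.perm X.tK 2 = Equiv.swap 2 3 := by
  have h := X.perm_perm X.tK 3
  rwa [X.adj_tK, X.perm_tK, Equiv.swap_apply_right, Equiv.swap_inv] at h

lemma perm_tK_adj {i : Fin 4} (hi : i = 0 ∨ i = 1) (h : X.adj X.tK i = X.tK) :
    X.perm X.tK i i = 0 ∨ X.perm X.tK i i = 1 := by
  have h1 := X.perm_perm X.tK i
  rw [h] at h1
  by_contra hne
  have h2 : X.perm X.tK i i = 2 ∨ X.perm X.tK i i = 3 := by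
    generalize X.perm X.tK i i = j at hne ⊢
    revert j
    decide
  have h3 : (X.perm X.tK i)⁻¹ = Equiv.swap 2 3 := by
    rcases h2 with h2 | h2
    · rw [← h1, h2, perm_tK_two]
    · rw [← h1, h2, perm_tK]
  rw [inv_eq_iff_eq_inv, Equiv.swap_inv] at h3
  rw [h3] at h2
  revert h2
  rcases hi with rfl | rfl <;> decide

lemma edgeClass_glue (X : OrientedTriangulation T) (F : TetFlag T) :
    X.edgeClass (X.glue F).edge = X.edgeClass F.edge :=
  (Quot.sound ⟨F, rfl, rfl⟩).symm

lemma exists_edge_of_perm : ∀ g : Perm (Fin 4), Perm.sign g = -1 → g 0 = 1 →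
    ∃ i j : Fin 4, (i = 2 ∨ i = 3) ∧ (j = 2 ∨ j = 3) ∧ s(g 1, g i) = s(0, j) := by
  decide

/-- The faces `023` and `123` of `tK` are not glued to each other. -/
lemma adj_tK_ne {i : Fin 4} (hi : i = 0 ∨ i = 1) : X.adj X.tK i ≠ X.tK := by
  have key : X.adj X.tK 0 ≠ X.tK := by
    intro h
    have h0 : X.perm X.tK 0 0 = 1 := by
      refine (X.perm_tK_adj (Or.inl rfl) h).resolve_left fun h1 => X.face_ne X.tK 0 ?_
      rw [h, h1]
    obtain ⟨i, j, hi, hj, hij⟩ := exists_edge_of_perm _ (X.sign_perm X.tK 0) h0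
    have fold : ∀ a : Fin 4, (ha : a = 0 ∨ a = 1) → ∀ b : Fin 4, (hb : b = 2 ∨ b = 3) →
        X.edgeClass (X.tK, ⟨s(a, b), by revert a b; decide⟩) =
          X.edgeClass (X.tK, ⟨s(a, 2), by revert a; decide⟩) := by
      rintro a ha b (rfl | rfl)
      · rfl
      · have h1 := edgeClass_glue X.toOrientedTriangulation
          (X.tK, Equiv.swap 0 a * Equiv.swap 1 2)
        have h2 : (Equiv.swap 0 a * Equiv.swap 1 2 : Perm (Fin 4)) 3 = 3 := by
          rcases ha with rfl | rfl <;> decide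
        simp only [TetFlag.edge, OrientedTriangulation.glue, h2, X.adj_tK, X.perm_tK] at h1
        convert h1 using 4
        · rcases ha with rfl | rfl <;> decide
        · rcases ha with rfl | rfl <;> decide
    obtain ⟨τ, hτ⟩ : ∃ τ : Perm (Fin 4), τ 0 = 1 ∧ τ 1 = i ∧ τ 3 = 0 := by
      rcases hi with rfl | rfl <;> decide
    have h1 := edgeClass_glue X.toOrientedTriangulation (X.tK, τ)
    simp only [TetFlag.edge, OrientedTriangulation.glue, hτ, h, Perm.coe_mul,
      Function.comp_apply, hij] at h1
    refine X.edge_ne ?_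
    rw [← fold 0 (Or.inl rfl) j hj, h1, fold 1 (Or.inr rfl) i hi]
  rcases hi with rfl | rfl
  · exact key
  · intro h
    have h1 : X.perm X.tK 1 1 = 0 := by
      refine (X.perm_tK_adj (Or.inr rfl) h).resolve_right fun h1 => X.face_ne X.tK 1 ?_
      rw [h, h1]
    have h2 := X.adj_adj X.tK 1
    rw [h, h1] at h2
    exact key h2

lemma perm_of_adj_eq {t : T} (ht : t ≠ X.tK) {i : Fin 4} (h : X.adj t i = X.tK) :
    X.perm t i i = 0 ∨ X.perm t i i = 1 := by
  have h1 := X.adj_adj t i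
  rw [h] at h1
  by_contra hne
  have h2 : X.perm t i i = 2 ∨ X.perm t i i = 3 := by
    generalize X.perm t i i = j at hne ⊢
    revert j
    decide
  rcases h2 with h2 | h2
  · rw [h2, adj_tK_two] at h1
    exact ht h1.symm
  · rw [h2, adj_tK] at h1
    exact ht h1.symm

section Collapse

variable [DecidableEq T]

/-- The tetrahedron that is glued to face `i` of `t` after the collapse of `tK`. -/
def collapseAdj (t : T) (i : Fin 4) : T :=
  if X.adj t i = X.tK then X.adj X.tK (Equiv.swap 0 1 (X.perm t i i)) else X.adj t i

/-- The face pairing of face `i` of `t` after the collapse of `tK`: if face `i` of `t` is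
glued to the face `023` or `123` of `tK`, one continues with the identification of these two faces
that exchanges `0` and `1`, and with the face pairing of the other one. -/
def collapsePerm (t : T) (i : Fin 4) : Perm (Fin 4) :=
  if X.adj t i = X.tK then
    X.perm X.tK (Equiv.swap 0 1 (X.perm t i i)) * Equiv.swap 0 1 * X.perm t i
  else X.perm t i

lemma collapse_spec {t : T} (ht : t ≠ X.tK) (i : Fin 4) :
    X.collapseAdj t i ≠ X.tK ∧
    X.collapseAdj (X.collapseAdj t i) (X.collapsePerm t i i) = t ∧
    X.collapsePerm (X.collapseAdj t i) (X.collapsePerm t i i) = (X.collapsePerm t i)⁻¹ ∧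
    (X.collapseAdj t i, X.collapsePerm t i i) ≠ (t, i) ∧
    Perm.sign (X.collapsePerm t i) = -1 := by
  by_cases h : X.adj t i = X.tK
  · have hj := X.perm_of_adj_eq ht h
    have h1 := X.adj_adj t i
    have h2 := X.perm_perm t i
    rw [h] at h1 h2
    set j := X.perm t i i with hjdef
    set j' := Equiv.swap 0 1 j with hj'def
    have hj' : j' = 0 ∨ j' = 1 := by
      rw [hj'def]
      rcases hj with hj | hj <;> simp [hj]
    have hjj : Equiv.swap 0 1 j' = j := by simp [hj'def]
    have hne : j ≠ j' := by
      rw [hj'def]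
      rcases hj with hj | hj <;> simp [hj]
    have e1 : X.collapseAdj t i = X.adj X.tK j' := by simp [collapseAdj, h, hj'def, hjdef]
    have e2 : X.collapsePerm t i = X.perm X.tK j' * Equiv.swap 0 1 * X.perm t i := by
      simp [collapsePerm, h, hj'def, hjdef]
    have e3 : X.collapsePerm t i i = X.perm X.tK j' j' := by
      rw [e2]
      simp [← hjdef, ← hj'def]
    have h3 := X.adj_adj X.tK j'
    have h4 := X.perm_perm X.tK j'
    refine ⟨?_, ?_, ?_, ?_, ?_⟩
    · rw [e1]
      exact X.adj_tK_ne hj'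
    · rw [e1, e3, collapseAdj, if_pos h3, h4, show (X.perm X.tK j')⁻¹ (X.perm X.tK j' j') = j' by simp, hjj, h1]
    · rw [e3, e1, e2, collapsePerm, if_pos h3, h4, show (X.perm X.tK j')⁻¹ (X.perm X.tK j' j') = j' by simp, hjj, h2]
      simp [mul_assoc]
    · rw [e1, e3]
      intro h5
      have h6 := congrArg Prod.fst h5
      have h7 := congrArg Prod.snd h5
      simp only at h6 h7
      rw [h6, h7] at h4
      have h8 : X.perm t i i = j' := by
        rw [h4, Perm.inv_eq_iff_eq, h7]
      exact hne (hjdef.trans h8)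
    · rw [e2]
      simp [X.sign_perm]
  · have e1 : X.collapseAdj t i = X.adj t i := by simp [collapseAdj, h]
    have e2 : X.collapsePerm t i = X.perm t i := by simp [collapsePerm, h]
    have h1 := X.adj_adj t i
    have h2 := X.perm_perm t i
    refine ⟨?_, ?_, ?_, ?_, ?_⟩
    · rwa [e1]
    · rw [e1, e2, collapseAdj, if_neg (by rwa [h1]), h1]
    · rw [e1, e2, collapsePerm, if_neg (by rwa [h1]), h2]
    · rw [e1, e2]
      exact X.face_ne t i
    · rw [e2]
      exact X.sign_perm t i

/-- The induced ideal triangulation of `M \ K`: the edge `K` is collapsed to a point, so that the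
distinguished face becomes an edge and the two other faces of `tK` are identified with each other.
Its tetrahedra are the tetrahedra different from `tK`. -/
def collapse : OrientedTriangulation {t : T // t ≠ X.tK} where
  adj t i := ⟨X.collapseAdj t i, (X.collapse_spec t.2 i).1⟩
  perm t i := X.collapsePerm t i
  adj_adj t i := Subtype.ext (X.collapse_spec t.2 i).2.1
  perm_perm t i := (X.collapse_spec t.2 i).2.2.1
  face_ne t i h := (X.collapse_spec t.2 i).2.2.2.1 (by
    have h1 := congrArg Prod.fst h
    have h2 := congrArg Prod.snd h
    exact Prod.ext (congrArg Subtype.val h1) h2)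
  sign_perm t i := (X.collapse_spec t.2 i).2.2.2.2

end Collapse

/-! ### Kashaev's ring -/

/-- The oriented short edge of a flag has an end on the distinguished edge `K`. -/
def MeetsK (F : TetFlag T) : Prop :=
  F.1 = X.tK ∧ (s(F.2 0, F.2 1) = s(0, 1) ∨ s(F.2 0, F.2 2) = s(0, 1))

/-- The oriented short edges, of the truncated tetrahedra, that are disjoint from `K`. -/
abbrev ShortEdge := {F : TetFlag T // ¬ X.MeetsK F}

/-- The generators of Kashaev's ring: a pair `u e`, `v e` for each short edge `e`. -/
inductive Gen : Type _
  | u (e : X.ShortEdge)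
  | v (e : X.ShortEdge)

open FreeAlgebra in
/-- The relations of Kashaev's ring. -/
inductive Rel (k : Type*) [CommRing k] : FreeAlgebra k X.Gen → FreeAlgebra k X.Gen → Prop
  /-- Short edges that are glued to each other are the same short edge. -/
  | glue_u (e e' : X.ShortEdge) (h : e'.1 = X.glue e.1) : Rel k (ι k (.u e')) (ι k (.u e))
  | glue_v (e e' : X.ShortEdge) (h : e'.1 = X.glue e.1) : Rel k (ι k (.v e')) (ι k (.v e))
  /-- If `e'` is `e` with the opposite orientation, then `u e' = (u e)⁻¹`
  and `v e' = - (u e)⁻¹ * v e`. -/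
  | reverse_u (e e' : X.ShortEdge) (h : e'.1 = e.1.swapAt 1 2) :
      Rel k (ι k (.u e') * ι k (.u e)) 1
  | reverse_v (e e' : X.ShortEdge) (h : e'.1 = e.1.swapAt 1 2) :
      Rel k (ι k (.v e')) (-(ι k (.u e') * ι k (.v e)))
  /-- Hexagonal face relations: `e` and `e'` lie in the same hexagon, and their terminal points are
  the two ends of one long edge. -/
  | hexagon_u (e e' : X.ShortEdge) (h : e'.1 = e.1.swapAt 0 2) :
      Rel k (ι k (.u e')) (ι k (.v e))
  | hexagon_v (e e' : X.ShortEdge) (h : e'.1 = e.1.swapAt 0 2) :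
      Rel k (ι k (.v e')) (ι k (.u e))
  /-- Triangular face relations: `e₁, e₂, e₃` run around a triangle, in this order. -/
  | triangle_u (e₁ e₂ e₃ : X.ShortEdge) (h₂ : e₂.1 = (e₁.1.swapAt 1 2).swapAt 2 3)
      (h₃ : e₃.1 = (e₂.1.swapAt 1 2).swapAt 2 3) :
      Rel k (ι k (.u e₁) * ι k (.u e₂) * ι k (.u e₃)) 1
  | triangle_v (e₁ e₂ e₃ : X.ShortEdge) (h₂ : e₂.1 = (e₁.1.swapAt 1 2).swapAt 2 3)
      (h₃ : e₃.1 = (e₂.1.swapAt 1 2).swapAt 2 3) :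
      Rel k (ι k (.u e₁) * ι k (.u e₂) * ι k (.v e₃) + ι k (.u e₁) * ι k (.v e₂) + ι k (.v e₁)) 0

/-- Kashaev's noncommutative ring, with coefficients in `k`; the ring itself is the
case `k = ℤ`. -/
abbrev KashaevRing (k : Type*) [CommRing k] := RingQuot (X.Rel k)

/-- The relations that make a ring commutative. -/
inductive CommRel (R : Type*) [Ring R] : R → R → Prop
  | comm (x y : R) : CommRel R (x * y) (y * x)

/-- The abelianization of Kashaev's ring. -/
def KashaevRingAb (k : Type*) [CommRing k] := RingQuot (CommRel (X.KashaevRing k))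

instance (k : Type*) [CommRing k] : CommRing (X.KashaevRingAb k) :=
  { (inferInstance : Ring (RingQuot (CommRel (X.KashaevRing k)))) with
    mul_comm := fun x y => by
      obtain ⟨x, rfl⟩ := RingQuot.mkRingHom_surjective (CommRel (X.KashaevRing k)) x
      obtain ⟨y, rfl⟩ := RingQuot.mkRingHom_surjective (CommRel (X.KashaevRing k)) y
      have h := RingQuot.mkRingHom_rel (CommRel.comm x y)
      rw [map_mul, map_mul] at h
      exact h }

instance (k : Type*) [CommRing k] : Algebra k (X.KashaevRingAb k) :=
  (inferInstance : Algebra k (RingQuot (CommRel (X.KashaevRing k))))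

/-- The image of `v e` in the abelianization of Kashaev's ring. -/
def vGen (k : Type*) [CommRing k] (e : X.ShortEdge) : X.KashaevRingAb k :=
  RingQuot.mkAlgHom k (CommRel (X.KashaevRing k))
    (RingQuot.mkAlgHom k (X.Rel k) (FreeAlgebra.ι k (.v e)))

/-- The short edge of a flag of the induced ideal triangulation, in the corresponding tetrahedron
of the H-triangulation. -/
def shortEdge (F : TetFlag {t : T // t ≠ X.tK}) : X.ShortEdge :=
  ⟨(F.1, F.2), fun h => F.1.2 h.1⟩

end ParticularHTriangulation

end

/-! ### Flags -/

/-! The hexagonal relations replace `u` by `v` on every hexagon without `K`. The short edge of a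
flag `(t, σ)` is then read as the directed edge `σ 0 → σ 1` of the triangle `σ 0 σ 1 σ 2`, and its
`v` as a unit `V (t, σ)` attached to that directed edge. The two relations for reversed short edges
become: reversing the directed edge inverts `V`, and the alternating product of `V` around a
triangle is `-1`. The quotient `V (F.swapAt 2 3) / V F`, for even `F`, is the change of `V` between
the two faces at an edge of a tetrahedron. In terms of these quotients, the triangular relations are
exactly the equations for the shape parameters at a vertex (`triangle_u_iff`, `triangle_v_iff`).

In the tetrahedron `tK`, the triangular relations at the two vertices off `K` determine the `u` and
`v` of the short edge opposite to `K`. Since that short edge is glued to its counterpart at the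
other vertex, one equation remains: the change of `V` at the edge opposite to `K` is 1
(`vUnit_fold`). So homomorphisms from the abelianized ring to a commutative ring correspond to
solutions `V` in its units, the face systems (`IsFaceSystem`). The universal one is
`isFaceSystem_vUnit`, and `kashaevHom` is the homomorphism of a given one.

The map `f` exists because the changes of `V` around an edge telescope. For an edge of the collapsed
triangulation the contributions of `tK` have to be removed, and they cancel by the fold equation
(`prod_lift`).

For the inverse, let shape parameters be given. Suitable weights on the edges of `tK` make the
products around all edges of the H-triangulation trivial (`prod_weight`), so some `V₀` has the
prescribed changes (`exists_potential`). It is unique up to a function of the directed edges, that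
is, a 1-cochain with values in the units. The failure of `V₀` to satisfy the triangle equation is a
2-cochain. It is closed because the six parameters of a tetrahedron have product 1. If `H₁ = 0`,
every 2-cycle is a boundary, by a rank count from the Euler characteristic of the link
(`ker_d₂_le`), so this 2-cochain is a coboundary (`exists_cochain`) and `V₀` can be corrected to a
face system (`exists_isFaceSystem`). Two face systems with the same shape parameters differ by a
1-cocycle, which is trivial since `H₁ = 0` and there is only one vertex (`eq_of_shape`). Existence
over the deformation ring gives a left inverse of `f`, and uniqueness gives surjectivity. -/

namespace TetFlag

variable {T : Type*}

lemma swapAt_swapAt (i j : Fin 4) (F : TetFlag T) : (F.swapAt i j).swapAt i j = F := by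
  simp [swapAt, mul_assoc]

lemma swapAt_comm (F : TetFlag T) :
    (F.swapAt 0 1).swapAt 2 3 = (F.swapAt 2 3).swapAt 0 1 := by
  simp only [swapAt, mul_assoc]
  congr 2
  decide

lemma swapAt_ne (i j k l : Fin 4) (h : Equiv.swap i j ≠ Equiv.swap k l) (F : TetFlag T) :
    F.swapAt i j ≠ F.swapAt k l := by
  intro he
  have := congrArg Prod.snd he
  exact h (mul_left_cancel this)

lemma sign_swapAt {i j : Fin 4} (h : i ≠ j) (F : TetFlag T) :
    Perm.sign (F.swapAt i j).2 = - Perm.sign F.2 := by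
  simp [swapAt, h]

lemma edge_swapAt_two_three (F : TetFlag T) : (F.swapAt 2 3).edge = F.edge := by
  have h0 : Equiv.swap (2 : Fin 4) 3 0 = 0 := by decide
  have h1 : Equiv.swap (2 : Fin 4) 3 1 = 1 := by decide
  simp [edge, swapAt, h0, h1]

lemma edge_swapAt_zero_one (F : TetFlag T) : (F.swapAt 0 1).edge = F.edge := by
  simp [edge, swapAt, Sym2.eq_swap]

/-- The stabilizer of an undirected edge in the alternating group has order 2; its generator is the
half turn that reverses the edge. -/
lemma perm_eq_of_edge_eq : ∀ σ τ : Perm (Fin 4), Perm.sign σ = 1 → Perm.sign τ = 1 →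
    s(σ 0, σ 1) = s(τ 0, τ 1) → σ = τ ∨ σ = τ * Equiv.swap 2 3 * Equiv.swap 0 1 := by
  decide

lemma eq_of_edge_eq {F G : TetFlag T} (hF : Perm.sign F.2 = 1) (hG : Perm.sign G.2 = 1)
    (h : F.edge = G.edge) : F = G ∨ F = (G.swapAt 2 3).swapAt 0 1 := by
  obtain ⟨t, σ⟩ := F
  obtain ⟨t', τ⟩ := G
  simp only [edge, Prod.mk.injEq, Subtype.mk.injEq] at h
  obtain ⟨rfl, h⟩ := h
  rcases perm_eq_of_edge_eq σ τ hF hG h with rfl | rfl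
  · exact Or.inl rfl
  · exact Or.inr rfl

lemma exists_even_edge (i : T × TetEdge) : ∃ F : TetFlag T, Perm.sign F.2 = 1 ∧ F.edge = i := by
  obtain ⟨t, e, he⟩ := i
  induction e with
  | _ a b =>
    have : ∀ a b : Fin 4, a ≠ b → ∃ σ : Perm (Fin 4), Perm.sign σ = 1 ∧ σ 0 = a ∧ σ 1 = b := by
      decide
    obtain ⟨σ, hσ, h0, h1⟩ := this a b (by simpa using he)
    exact ⟨(t, σ), hσ, by simp [edge, h0, h1]⟩

lemma sign_ne_one {F : TetFlag T} (h : Perm.sign F.2 ≠ 1) : Perm.sign F.2 = -1 :=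
  (Int.units_eq_one_or _).resolve_left h

end TetFlag

/-- A fixed-point-free involution has a fundamental domain. -/
lemma exists_half {ι : Type*} [Finite ι] (τ : ι → ι) (h1 : ∀ x, τ (τ x) = x) (h2 : ∀ x, τ x ≠ x) :
    ∃ S : Set ι, ∀ x, x ∉ S ↔ τ x ∈ S := by
  obtain ⟨n, ⟨e⟩⟩ := Finite.exists_equiv_fin ι
  refine ⟨{x | e x < e (τ x)}, fun x => ?_⟩
  have : e (τ x) ≠ e x := fun h => h2 x (e.injective h)
  simp only [Set.mem_ofPred_eq, h1, not_lt]
  exact ⟨fun h => lt_of_le_of_ne h this, le_of_lt⟩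

/-- A fundamental domain of an involution contains half of the elements. -/
lemma two_mul_card_half {ι : Type*} [Finite ι] (τ : ι → ι) (h1 : ∀ x, τ (τ x) = x) (S : Set ι)
    (hS : ∀ x, x ∉ S ↔ τ x ∈ S) : 2 * Nat.card S = Nat.card ι := by
  have e : S ≃ (Sᶜ : Set ι) :=
    { toFun x := ⟨τ x, by rw [Set.mem_compl_iff, hS, h1]; exact x.2⟩
      invFun x := ⟨τ x, (hS x).1 x.2⟩
      left_inv x := Subtype.ext (h1 x)
      right_inv x := Subtype.ext (h1 x) }
  classical
  rw [← Nat.card_congr (Equiv.Set.sumCompl S), Nat.card_sum, ← Nat.card_congr e]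
  ring

/-! ### Directed edges of the glued space and the rotation about them. -/

namespace OrientedTriangulation

variable {T : Type*} (X : OrientedTriangulation T)

lemma glue_glue (F : TetFlag T) : X.glue (X.glue F) = F := by
  simp [glue, X.adj_adj, X.perm_perm]

lemma sign_glue (F : TetFlag T) : Perm.sign (X.glue F).2 = - Perm.sign F.2 := by
  simp [glue, X.sign_perm]

lemma glue_ne_swapAt (F : TetFlag T) {i j : Fin 4} (hi : i ≠ 3) (hj : j ≠ 3) :
    X.glue F ≠ F.swapAt i j := by
  intro h
  have h1 := congrArg Prod.fst h
  have h2 := congrArg (fun G : TetFlag T => G.2 3) h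
  simp only [glue, TetFlag.swapAt, Perm.coe_mul, Function.comp_apply,
    Equiv.swap_apply_of_ne_of_ne hi.symm hj.symm] at h1 h2
  exact X.face_ne F.1 (F.2 3) (Prod.ext h1 h2)

/-- The directed edge `σ 0 → σ 1` of the glued space. -/
def edgeEnd (F : TetFlag T) : X.EdgeEnd := Quot.mk _ F

lemma edgeEnd_glue (F : TetFlag T) : X.edgeEnd (X.glue F) = X.edgeEnd F :=
  (Quot.sound (r := fun F G : TetFlag T => G = X.glue F ∨ G = F.swapAt 2 3) (Or.inl rfl)).symm

lemma edgeEnd_swap (F : TetFlag T) : X.edgeEnd (F.swapAt 2 3) = X.edgeEnd F :=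
  (Quot.sound (r := fun F G : TetFlag T => G = X.glue F ∨ G = F.swapAt 2 3) (Or.inr rfl)).symm

/-- Properties of flags that are invariant under gluing and under `swapAt 2 3` only depend on the
directed edge. -/
lemma edgeEnd_induction {P : TetFlag T → Prop} (hg : ∀ F, P F → P (X.glue F))
    (hs : ∀ F, P F → P (F.swapAt 2 3)) {F G : TetFlag T} (h : X.edgeEnd F = X.edgeEnd G)
    (hF : P F) : P G := by
  let Q : X.EdgeEnd → Prop := Quot.lift P (by
    rintro F G (rfl | rfl)
    · exact propext ⟨hg F, fun h => by simpa [glue_glue] using hg _ h⟩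
    · exact propext ⟨hs F, fun h => by simpa [TetFlag.swapAt_swapAt] using hs _ h⟩)
  have : Q (X.edgeEnd F) = Q (X.edgeEnd G) := by rw [h]
  exact this.mp hF

/-- Reversal of directed edges. -/
def rev : X.EdgeEnd → X.EdgeEnd :=
  Quot.lift (fun F => X.edgeEnd (F.swapAt 0 1)) (by
    rintro F G (rfl | rfl)
    · rw [← X.glue_swap F (by decide) (by decide), edgeEnd_glue]
    · rw [← TetFlag.swapAt_comm, edgeEnd_swap])

lemma rev_edgeEnd (F : TetFlag T) : X.rev (X.edgeEnd F) = X.edgeEnd (F.swapAt 0 1) := rfl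

lemma rev_rev (D : X.EdgeEnd) : X.rev (X.rev D) = D := by
  induction D using Quot.ind with
  | _ F => exact congrArg X.edgeEnd (TetFlag.swapAt_swapAt 0 1 F)

lemma edgeEnd_surjective : Function.Surjective X.edgeEnd := Quot.mk_surjective

instance [Finite T] : Finite X.EdgeEnd := Finite.of_surjective _ X.edgeEnd_surjective

lemma edgeClass_eq_of_edgeEnd_eq {F G : TetFlag T} (h : X.edgeEnd F = X.edgeEnd G) :
    X.edgeClass F.edge = X.edgeClass G.edge :=
  X.edgeEnd_induction (P := fun H => X.edgeClass F.edge = X.edgeClass H.edge)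
    (fun H hH => hH.trans (Quot.sound ⟨H, rfl, rfl⟩))
    (fun H hH => by rw [TetFlag.edge_swapAt_two_three, hH]) h rfl

/-- The rotation around the directed edge `σ 0 → σ 1`, from one tetrahedron to the next. -/
def turn : Perm (TetFlag T) where
  toFun F := X.glue (F.swapAt 2 3)
  invFun F := (X.glue F).swapAt 2 3
  left_inv F := by simp only [glue_glue, TetFlag.swapAt_swapAt]
  right_inv F := by simp only [TetFlag.swapAt_swapAt, glue_glue]

lemma turn_apply (F : TetFlag T) : X.turn F = X.glue (F.swapAt 2 3) := rfl

lemma turn_symm_apply (F : TetFlag T) : X.turn⁻¹ F = (X.glue F).swapAt 2 3 := rfl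

lemma sign_turn (F : TetFlag T) : Perm.sign (X.turn F).2 = Perm.sign F.2 := by
  rw [turn_apply, sign_glue, TetFlag.sign_swapAt (by decide), neg_neg]

lemma sign_turn_zpow (n : ℤ) (F : TetFlag T) :
    Perm.sign ((X.turn ^ n) F).2 = Perm.sign F.2 := by
  induction n using Int.induction_on generalizing F with
  | zero => rfl
  | succ n ih => rw [zpow_add, zpow_one, Perm.mul_apply, ih, sign_turn]
  | pred n ih =>
    rw [zpow_sub, zpow_one, Perm.mul_apply, ih, ← sign_turn, ← Perm.mul_apply, mul_inv_cancel, Perm.one_apply]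

lemma edgeEnd_turn (F : TetFlag T) : X.edgeEnd (X.turn F) = X.edgeEnd F := by
  rw [turn_apply, edgeEnd_glue, edgeEnd_swap]

lemma swapAt_turn (F : TetFlag T) : (X.turn F).swapAt 0 1 = X.turn (F.swapAt 0 1) := by
  rw [turn_apply, turn_apply, ← X.glue_swap _ (by decide) (by decide), TetFlag.swapAt_comm]

/-- The flags at a directed edge form an orbit of the dihedral group generated by the involutions
`glue` and `swapAt 2 3`, whose product is `turn`. -/
lemma exists_turn_of_edgeEnd_eq {F G : TetFlag T} (h : X.edgeEnd F = X.edgeEnd G) :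
    ∃ n : ℤ, G = (X.turn ^ n) F ∨ G = ((X.turn ^ n) F).swapAt 2 3 := by
  refine X.edgeEnd_induction
    (P := fun G => ∃ n : ℤ, G = (X.turn ^ n) F ∨ G = ((X.turn ^ n) F).swapAt 2 3) ?_ ?_ h
    ⟨0, Or.inl rfl⟩
  · rintro G ⟨n, rfl | rfl⟩
    · refine ⟨n - 1, Or.inr ?_⟩
      rw [sub_eq_neg_add, zpow_add, zpow_neg_one, Perm.mul_apply, turn_symm_apply,
        TetFlag.swapAt_swapAt]
    · exact ⟨1 + n, Or.inl (by rw [zpow_add, zpow_one, Perm.mul_apply, turn_apply])⟩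
  · rintro G ⟨n, rfl | rfl⟩
    · exact ⟨n, Or.inr rfl⟩
    · exact ⟨n, Or.inl (TetFlag.swapAt_swapAt _ _ _)⟩

lemma exists_turn_of_edgeEnd_eq_of_sign {F G : TetFlag T} (h : X.edgeEnd F = X.edgeEnd G)
    (hs : Perm.sign F.2 = Perm.sign G.2) : ∃ n : ℤ, (X.turn ^ n) F = G := by
  obtain ⟨n, h | h⟩ := X.exists_turn_of_edgeEnd_eq h
  · exact ⟨n, h.symm⟩
  · rw [h, TetFlag.sign_swapAt (by decide), sign_turn_zpow] at hs
    exact absurd hs (by rcases Int.units_eq_one_or (Perm.sign F.2) with h | h <;> rw [h] <;> decide)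

/-- Such an equation would make the reversal of the edge a reflection of the cyclic sequence of
tetrahedra around it, with a fixed tetrahedron or face in the middle. Moving the base flag by `k`
turns changes `n` to `n - 2 * k`, so that `n` becomes 0 or 1. For 0, two different swaps would agree
on one flag; for 1, a face would be glued to itself. -/
lemma swapAt_zero_one_ne (n : ℤ) :
    ∀ F : TetFlag T, F.swapAt 0 1 ≠ ((X.turn ^ n) F).swapAt 2 3 := by
  have step (n : ℤ) (F : TetFlag T) (h : F.swapAt 0 1 = ((X.turn ^ n) F).swapAt 2 3) (k : ℤ) :
      ((X.turn ^ k) F).swapAt 0 1 = ((X.turn ^ (n - 2 * k)) ((X.turn ^ k) F)).swapAt 2 3 := by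
    have h1 (F : TetFlag T) (k : ℤ) :
        ((X.turn ^ k) F).swapAt 0 1 = (X.turn ^ k) (F.swapAt 0 1) := by
      induction k using Int.induction_on generalizing F with
      | zero => rfl
      | succ n ih => rw [zpow_add, zpow_one, Perm.mul_apply, Perm.mul_apply, ih, swapAt_turn]
      | pred n ih =>
        rw [zpow_sub, zpow_one, Perm.mul_apply, Perm.mul_apply, ih]
        congr 1
        rw [Perm.eq_inv_iff_eq, ← swapAt_turn, ← Perm.mul_apply, mul_inv_cancel, Perm.one_apply]
    have h2 (F : TetFlag T) (k : ℤ) :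
        (X.turn ^ k) (F.swapAt 2 3) = ((X.turn ^ (-k)) F).swapAt 2 3 := by
      induction k using Int.induction_on generalizing F with
      | zero => rfl
      | succ n ih =>
        rw [zpow_add, zpow_one, Perm.mul_apply, turn_apply, TetFlag.swapAt_swapAt, neg_add,
          zpow_add, zpow_neg_one, Perm.mul_apply, turn_symm_apply, ← ih, TetFlag.swapAt_swapAt]
      | pred n ih =>
        rw [zpow_sub, zpow_one, Perm.mul_apply, turn_symm_apply, ih, neg_sub, sub_neg_eq_add,
          add_comm (1 : ℤ), zpow_add, zpow_one, Perm.mul_apply, turn_apply, neg_neg]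
    rw [h1, h, h2, ← Perm.mul_apply, ← Perm.mul_apply, ← zpow_add, ← zpow_add,
      show -k + n = n - 2 * k + k by ring]
  intro F h
  rcases Int.even_or_odd' n with ⟨k, rfl | rfl⟩
  · have := step _ F h k
    rw [sub_self] at this
    exact TetFlag.swapAt_ne 0 1 2 3 (by decide) _ this
  · have h1 := step _ F h k
    rw [add_sub_cancel_left, zpow_one, turn_apply] at h1
    set G := (X.turn ^ k) F
    have h2 := congrArg (TetFlag.swapAt 2 3) h1
    rw [TetFlag.swapAt_comm, TetFlag.swapAt_swapAt] at h2
    exact X.glue_ne_swapAt _ (by decide) (by decide) h2.symm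

/-- No directed edge is identified with its reverse. -/
lemma rev_ne (D : X.EdgeEnd) : X.rev D ≠ D := by
  obtain ⟨F, rfl⟩ := X.edgeEnd_surjective D
  rw [rev_edgeEnd]
  intro h
  -- The first alternative contradicts the orientation: `turn` preserves the parity of a flag and
  -- `swapAt 0 1` changes it.
  obtain ⟨n, h1 | h1⟩ := X.exists_turn_of_edgeEnd_eq h.symm
  · have := congrArg (fun G : TetFlag T => Perm.sign G.2) h1
    simp only [sign_turn_zpow, TetFlag.sign_swapAt (show (0 : Fin 4) ≠ 1 by decide)] at this
    exact absurd this
      (by rcases Int.units_eq_one_or (Perm.sign F.2) with h | h <;> rw [h] <;> decide)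
  · exact X.swapAt_zero_one_ne n F h1

end OrientedTriangulation

/-! ### Undirected edges, and products over the flags around an edge. -/

namespace OrientedTriangulation

variable {T : Type*} (X : OrientedTriangulation T)

variable {X} in
-- Identifications of undirected edges lift to directed ones, because `glue` commutes with `swapAt 0
-- 1`. The four flags over an edge of a tetrahedron are related by `swapAt 0 1` and `swapAt 2 3`;
-- fixing parities leaves two of them to compare.
lemma edgeClass_eq_iff (F : TetFlag T) (i : T × TetEdge) :
    X.edgeClass i = X.edgeClass F.edge ↔ ∃ G, X.edgeEnd G = X.edgeEnd F ∧ G.edge = i := by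
  constructor
  · intro h
    let P : T × TetEdge → Prop := fun i => ∃ G, X.edgeEnd G = X.edgeEnd F ∧ G.edge = i
    have key (H : TetFlag T) : P H.edge → P (X.glue H).edge := by
      have h1 (H : TetFlag T) (h : X.edgeEnd H = X.edgeEnd F) : P (X.glue H).edge :=
        ⟨X.glue H, (X.edgeEnd_glue H).trans h, rfl⟩
      have h2 (H : TetFlag T) (h : X.edgeEnd (H.swapAt 0 1) = X.edgeEnd F) :
          P (X.glue H).edge := by
        have := h1 _ h
        rwa [X.glue_swap _ (by decide) (by decide), TetFlag.edge_swapAt_zero_one] at this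
      rintro ⟨G, hG, he⟩
      have h3 (H : TetFlag T) (h : X.edgeEnd (H.swapAt 2 3) = X.edgeEnd F) :
          P (X.glue H).edge := h1 H ((X.edgeEnd_swap H).symm.trans h)
      have h4 (H : TetFlag T) (h : X.edgeEnd ((H.swapAt 2 3).swapAt 0 1) = X.edgeEnd F) :
          P (X.glue H).edge := by
        rw [← TetFlag.swapAt_comm, edgeEnd_swap] at h
        exact h2 H h
      by_cases sG : Perm.sign G.2 = 1 <;> by_cases sH : Perm.sign H.2 = 1
      · rcases TetFlag.eq_of_edge_eq sG sH he with rfl | rfl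
        · exact h1 _ hG
        · exact h4 _ hG
      · have sH' : Perm.sign (H.swapAt 2 3).2 = 1 := by
          rw [TetFlag.sign_swapAt (by decide), TetFlag.sign_ne_one sH, neg_neg]
        rcases TetFlag.eq_of_edge_eq sG sH' (he.trans H.edge_swapAt_two_three.symm) with rfl | rfl
        · exact h3 _ hG
        · rw [TetFlag.swapAt_swapAt] at hG
          exact h2 _ hG
      · have sG' : Perm.sign (G.swapAt 2 3).2 = 1 := by
          rw [TetFlag.sign_swapAt (by decide), TetFlag.sign_ne_one sG, neg_neg]
        rw [← edgeEnd_swap] at hG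
        rcases TetFlag.eq_of_edge_eq sG' sH (G.edge_swapAt_two_three.trans he) with h | h
        · rw [h] at hG
          exact h1 _ hG
        · rw [h] at hG
          exact h4 _ hG
      · have sG' : Perm.sign (G.swapAt 0 1).2 = 1 := by
          rw [TetFlag.sign_swapAt (by decide), TetFlag.sign_ne_one sG, neg_neg]
        have sH' : Perm.sign (H.swapAt 0 1).2 = 1 := by
          rw [TetFlag.sign_swapAt (by decide), TetFlag.sign_ne_one sH, neg_neg]
        rcases TetFlag.eq_of_edge_eq sG' sH'
          (G.edge_swapAt_zero_one.trans (he.trans H.edge_swapAt_zero_one.symm)) with h | h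
        · rw [← TetFlag.swapAt_swapAt 0 1 G, h, TetFlag.swapAt_swapAt] at hG
          exact h1 _ hG
        · rw [← TetFlag.swapAt_swapAt 0 1 G, h, TetFlag.swapAt_swapAt, TetFlag.swapAt_comm,
            ← TetFlag.swapAt_comm, edgeEnd_swap] at hG
          exact h2 _ hG
    let Q : X.Edge → Prop := Quot.lift P (by
      rintro i j ⟨H, rfl, rfl⟩
      exact propext ⟨key H, fun h => by simpa [glue_glue] using key _ h⟩)
    have : Q (X.edgeClass i) = Q (X.edgeClass F.edge) := by rw [h]
    exact this.mpr ⟨F, rfl, rfl⟩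
  · rintro ⟨G, hG, rfl⟩
    exact X.edgeClass_eq_of_edgeEnd_eq hG

/-- A set of flags that is a union of directed edges. -/
structure EdgeClosed (N : Set (TetFlag T)) : Prop where
  glue : ∀ F ∈ N, X.glue F ∈ N
  swap : ∀ F ∈ N, F.swapAt 2 3 ∈ N

variable {X}

lemma EdgeClosed.glue_iff {N : Set (TetFlag T)} (hN : X.EdgeClosed N) (F : TetFlag T) :
    X.glue F ∈ N ↔ F ∈ N :=
  ⟨fun h => by simpa [glue_glue] using hN.glue _ h, hN.glue F⟩

lemma EdgeClosed.swap_iff {N : Set (TetFlag T)} (hN : X.EdgeClosed N) (F : TetFlag T) :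
    F.swapAt 2 3 ∈ N ↔ F ∈ N :=
  ⟨fun h => by simpa [TetFlag.swapAt_swapAt] using hN.swap _ h, hN.swap F⟩

variable (X)

lemma edgeClosed_univ : X.EdgeClosed Set.univ := ⟨fun _ _ => trivial, fun _ _ => trivial⟩

lemma edgeClosed_edgeEnd (D : X.EdgeEnd) : X.EdgeClosed {F | X.edgeEnd F = D} :=
  ⟨fun F (h : _ = _) => (X.edgeEnd_glue F).trans h, fun F (h : _ = _) => (X.edgeEnd_swap F).trans h⟩

variable {X}

section Products

variable [Fintype T]

open Classical in
/-- The even flags in a set of flags. -/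
noncomputable def evenFlags (N : Set (TetFlag T)) : Finset (TetFlag T) :=
  {F | Perm.sign F.2 = 1 ∧ F ∈ N}

lemma mem_evenFlags {N : Set (TetFlag T)} {F : TetFlag T} :
    F ∈ evenFlags N ↔ Perm.sign F.2 = 1 ∧ F ∈ N := by
  simp [evenFlags]

lemma prod_turn {M : Type*} [CommMonoid M] {N : Set (TetFlag T)} (hN : X.EdgeClosed N)
    (f : TetFlag T → M) : ∏ F ∈ evenFlags N, f (X.turn F) = ∏ F ∈ evenFlags N, f F := by
  refine Finset.prod_bij (fun F _ => X.turn F) ?_ (fun _ _ _ _ h => X.turn.injective h) ?_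
    (fun _ _ => rfl)
  · intro F hF
    rw [mem_evenFlags] at hF ⊢
    exact ⟨(X.sign_turn F).trans hF.1, hN.glue _ (hN.swap _ hF.2)⟩
  · intro F hF
    rw [mem_evenFlags] at hF
    refine ⟨X.turn⁻¹ F, ?_, by rw [← Perm.mul_apply, mul_inv_cancel, Perm.one_apply]⟩
    rw [mem_evenFlags, turn_symm_apply]
    exact ⟨by rw [TetFlag.sign_swapAt (by decide), sign_glue, neg_neg]; exact hF.1,
      hN.swap _ (hN.glue _ hF.2)⟩

/-- For a function that is compatible with the gluing, the total change around directed edges is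
trivial. -/
lemma prod_swap_div {A : Type*} [CommGroup A] {N : Set (TetFlag T)} (hN : X.EdgeClosed N)
    {C : TetFlag T → A} (hC : ∀ F, C (X.glue F) = C F) :
    ∏ F ∈ evenFlags N, C (F.swapAt 2 3) / C F = 1 := by
  -- Since `C` is invariant under gluing, `C (F.swapAt 2 3) = C (X.turn F)`, and `turn` permutes the
  -- even flags in `N`.
  rw [Finset.prod_div_distrib, div_eq_one, ← prod_turn hN C]
  exact Finset.prod_congr rfl fun F _ => (hC _).symm

open Classical in
-- Over an edge of a tetrahedron lie two even flags, with opposite directions, and `hJ` allows at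
-- most one of them in `N`.
lemma prod_evenFlags_edge {M : Type*} [CommMonoid M] {N : Set (TetFlag T)} (hN : X.EdgeClosed N)
    (hJ : ∀ F ∈ N, F.swapAt 0 1 ∉ N) (f : T × TetEdge → M) :
    ∏ F ∈ evenFlags N, f F.edge = ∏ i with ∃ F ∈ N, F.edge = i, f i := by
  refine Finset.prod_bij (fun F _ => F.edge) ?_ ?_ ?_ (fun _ _ => rfl)
  · intro F hF
    rw [mem_evenFlags] at hF
    simp only [Finset.mem_filter, Finset.mem_univ, true_and]
    exact ⟨F, hF.2, rfl⟩
  · intro F hF G hG h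
    rw [mem_evenFlags] at hF hG
    rcases TetFlag.eq_of_edge_eq hF.1 hG.1 h with h | h
    · exact h
    · exact absurd (h ▸ hF.2) (hJ _ (hN.swap _ hG.2))
  · intro i hi
    simp only [Finset.mem_filter, Finset.mem_univ, true_and] at hi
    obtain ⟨F, hF, rfl⟩ := hi
    by_cases h : Perm.sign F.2 = 1
    · exact ⟨F, mem_evenFlags.2 ⟨h, hF⟩, rfl⟩
    · refine ⟨F.swapAt 2 3, mem_evenFlags.2 ⟨?_, hN.swap _ hF⟩, F.edge_swapAt_two_three⟩
      rw [TetFlag.sign_swapAt (by decide), TetFlag.sign_ne_one h, neg_neg]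

open Classical in
lemma prod_edgeClass {M : Type*} [CommMonoid M] (F : TetFlag T) (f : T × TetEdge → M) :
    ∏ i with X.edgeClass i = X.edgeClass F.edge, f i =
      ∏ G ∈ evenFlags {G | X.edgeEnd G = X.edgeEnd F}, f G.edge := by
  rw [prod_evenFlags_edge (X.edgeClosed_edgeEnd _)]
  · simp only [edgeClass_eq_iff, Set.mem_ofPred_eq]
  · intro G (hG : _ = _) (h : X.edgeEnd (G.swapAt 0 1) = _)
    rw [← hG, ← rev_edgeEnd] at h
    exact X.rev_ne _ h

open Classical in
-- The edges of tetrahedra that underlie `N` form a union of edge classes, each of which contributes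
-- 1.
lemma prod_evenFlags_eq_one {M : Type*} [CommMonoid M] {f : T × TetEdge → M}
    (hf : ∀ E : X.Edge, ∏ i with X.edgeClass i = E, f i = 1)
    {N : Set (TetFlag T)} (hN : X.EdgeClosed N) (hJ : ∀ F ∈ N, F.swapAt 0 1 ∉ N) :
    ∏ F ∈ evenFlags N, f F.edge = 1 := by
  rw [prod_evenFlags_edge hN hJ]
  have : Finite X.Edge := Finite.of_surjective X.edgeClass Quot.mk_surjective
  have := Fintype.ofFinite X.Edge
  rw [← Finset.prod_fiberwise _ X.edgeClass]
  refine Finset.prod_eq_one fun E _ => ?_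
  by_cases h : ∃ F ∈ N, X.edgeClass F.edge = E
  · obtain ⟨F, hF, rfl⟩ := h
    rw [← hf (X.edgeClass F.edge)]
    refine Finset.prod_congr ?_ fun _ _ => rfl
    ext i
    simp only [Finset.mem_filter, Finset.mem_univ, true_and, and_iff_right_iff_imp]
    rw [edgeClass_eq_iff]
    rintro ⟨G, hG, rfl⟩
    exact ⟨G, X.edgeEnd_induction (P := (· ∈ N)) hN.glue hN.swap hG.symm hF, rfl⟩
  · rw [Finset.filter_false_of_mem, Finset.prod_empty]
    rintro i hi rfl
    simp only [Finset.mem_filter, Finset.mem_univ, true_and] at hi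
    obtain ⟨F, hF, rfl⟩ := hi
    exact h ⟨F, hF, rfl⟩

end Products

/-! ### Potentials around the edges -/

section Potential

variable [Fintype T] {A : Type*} [CommGroup A]

/-- One period of `turn` runs exactly once through the even flags at the directed edge, and `n` is a
multiple of the period. -/
lemma prod_range_turn {w : TetFlag T → A}
    (hw : ∀ D, ∏ F ∈ evenFlags {F | X.edgeEnd F = D}, w F = 1) {F : TetFlag T}
    (hF : Perm.sign F.2 = 1) {n : ℕ} (hn : (X.turn ^ n) F = F) :
    ∏ i ∈ Finset.range n, w ((X.turn ^ i) F) = 1 := by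
  have hper : F ∈ Function.periodicPts X.turn :=
    (Equiv.injective X.turn).mem_periodicPts F
  have iter (n : ℕ) : X.turn^[n] F = (X.turn ^ n) F := by rw [Equiv.Perm.iterate_eq_pow]
  set m := Function.minimalPeriod X.turn F with hm
  have hm0 : 0 < m := Function.minimalPeriod_pos_of_mem_periodicPts hper
  have hmF : (X.turn ^ m) F = F := by
    rw [← iter]
    exact Function.iterate_minimalPeriod
  have h1 : ∏ i ∈ Finset.range m, w ((X.turn ^ i) F) = 1 := by
    rw [← hw (X.edgeEnd F)]
    refine Finset.prod_bij (fun i _ => (X.turn ^ i) F) ?_ ?_ ?_ (fun _ _ => rfl)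
    · intro i _
      rw [mem_evenFlags]
      refine ⟨by rw [← zpow_natCast, sign_turn_zpow, hF], ?_⟩
      change X.edgeEnd _ = _
      induction i with
      | zero => rfl
      | succ i ih => rw [pow_succ', Perm.mul_apply, edgeEnd_turn, ih (by simp_all; omega)]
    · intro i hi j hj h
      simp only [← iter] at h
      exact Function.iterate_injOn_Iio_minimalPeriod (Finset.mem_range.1 hi)
        (Finset.mem_range.1 hj) h
    · intro G hG
      rw [mem_evenFlags] at hG
      obtain ⟨k, hk⟩ := X.exists_turn_of_edgeEnd_eq_of_sign hG.2.symm (hF.trans hG.1.symm)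
      refine ⟨(k % m).toNat, ?_, ?_⟩
      · have := Int.emod_lt_of_pos k (Int.natCast_pos.2 hm0)
        have := Int.emod_nonneg k (Int.natCast_pos.2 hm0).ne'
        rw [Finset.mem_range]
        omega
      · have h2 (q : ℤ) : (X.turn ^ ((m : ℤ) * q)) F = F := by
          rw [zpow_mul, zpow_natCast]
          exact Perm.zpow_apply_eq_self_of_apply_eq_self hmF q
        rw [← zpow_natCast, Int.toNat_of_nonneg (Int.emod_nonneg k (Int.natCast_pos.2 hm0).ne'),
          ← hk]
        conv_rhs => rw [← Int.emod_add_mul_ediv k m, zpow_add, Perm.mul_apply, h2]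
  obtain ⟨q, rfl⟩ : m ∣ n := by
    rw [hm, ← Function.isPeriodicPt_iff_minimalPeriod_dvd]
    exact (iter n).trans hn
  clear hn
  induction q with
  | zero => simp
  | succ q ih =>
    rw [mul_add, mul_one, Finset.prod_range_add, ih, one_mul, ← h1]
    refine Finset.prod_congr rfl fun i _ => ?_
    rw [add_comm, pow_add, Perm.mul_apply, pow_mul]
    congr 2
    exact Perm.pow_apply_eq_self_of_apply_eq_self hmF q

lemma prod_range_turn_eq {w : TetFlag T → A}
    (hw : ∀ D, ∏ F ∈ evenFlags {F | X.edgeEnd F = D}, w F = 1) {F : TetFlag T}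
    (hF : Perm.sign F.2 = 1) {m n : ℕ} (hn : (X.turn ^ m) F = (X.turn ^ n) F) :
    ∏ i ∈ Finset.range m, w ((X.turn ^ i) F) = ∏ i ∈ Finset.range n, w ((X.turn ^ i) F) := by
  wlog h : m ≤ n generalizing m n
  · exact (this hn.symm (le_of_not_ge h)).symm
  obtain ⟨c, rfl⟩ := Nat.exists_eq_add_of_le h
  rw [Finset.prod_range_add]
  have h1 := prod_range_turn hw (F := (X.turn ^ m) F) (n := c)
    (by rw [← zpow_natCast, sign_turn_zpow, hF])
    (by rw [← Perm.mul_apply, ← pow_add, add_comm, ← hn])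
  simp only [← Perm.mul_apply, ← pow_add] at h1
  simp only [add_comm m, h1, mul_one]

/-- Integrate `w` along the rotation from an even base flag at each directed edge; trivial holonomy
makes the number of turns irrelevant. -/
lemma exists_even_potential {w : TetFlag T → A}
    (hw : ∀ D, ∏ F ∈ evenFlags {F | X.edgeEnd F = D}, w F = 1) :
    ∃ h : TetFlag T → A, ∀ F, Perm.sign F.2 = 1 → h (X.turn F) = w F * h F := by
  have base (D : X.EdgeEnd) : ∃ F, Perm.sign F.2 = 1 ∧ X.edgeEnd F = D := by
    obtain ⟨F, rfl⟩ := X.edgeEnd_surjective D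
    by_cases h : Perm.sign F.2 = 1
    · exact ⟨F, h, rfl⟩
    · refine ⟨F.swapAt 2 3, ?_, X.edgeEnd_swap F⟩
      rw [TetFlag.sign_swapAt (by decide), TetFlag.sign_ne_one h, neg_neg]
  choose b hb1 hb2 using base
  have hn (F : TetFlag T) (hF : Perm.sign F.2 = 1) : ∃ n : ℕ, (X.turn ^ n) (b (X.edgeEnd F)) = F := by
    have h1 : X.turn.SameCycle (b (X.edgeEnd F)) F :=
      X.exists_turn_of_edgeEnd_eq_of_sign (hb2 _) ((hb1 _).trans hF.symm)
    obtain ⟨n, -, h⟩ := h1.exists_pow_eq'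
    exact ⟨n, h⟩
  choose! n hn using hn
  refine ⟨fun F => ∏ i ∈ Finset.range (n F), w ((X.turn ^ i) (b (X.edgeEnd F))), fun F hF => ?_⟩
  have h2 := prod_range_turn_eq hw (hb1 (X.edgeEnd F)) (m := n (X.turn F)) (n := n F + 1) (by
    have := hn (X.turn F) ((X.sign_turn F).trans hF)
    rw [edgeEnd_turn] at this
    rw [this, pow_succ', Perm.mul_apply, hn F hF])
  simp only [edgeEnd_turn]
  rw [h2, Finset.prod_range_succ, hn F hF, mul_comm]

/-- Prescribed changes from tetrahedron to tetrahedron around the edges are realized by a function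
on the directed edges of triangles if their product around each edge is trivial. -/
lemma exists_potential {w : TetFlag T → A} (hJ : ∀ F, w ((F.swapAt 2 3).swapAt 0 1) = w F)
    (hw : ∀ D, ∏ F ∈ evenFlags {F | X.edgeEnd F = D}, w F = 1) :
    ∃ V : TetFlag T → A, (∀ F, V (X.glue F) = V F) ∧ (∀ F, V (F.swapAt 0 1) = (V F)⁻¹) ∧
      ∀ F, Perm.sign F.2 = 1 → V (F.swapAt 2 3) = w F * V F := by
  obtain ⟨H, hH⟩ := exists_even_potential hw
  obtain ⟨S, hS⟩ := exists_half X.rev X.rev_rev X.rev_ne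
  classical
  -- `J` reverses the directed edge but keeps the parity, so it turns the condition on `swapAt 0 1`
  -- into a condition on even flags.
  let J : TetFlag T → TetFlag T := fun F => X.glue (F.swapAt 0 1)
  have signJ (F : TetFlag T) : Perm.sign (J F).2 = Perm.sign F.2 := by
    rw [sign_glue, TetFlag.sign_swapAt (by decide), neg_neg]
  have JJ (F : TetFlag T) : J (J F) = F := by
    simp only [J]
    rw [← X.glue_swap _ (by decide) (by decide), glue_glue, TetFlag.swapAt_swapAt]
  have clJ (F : TetFlag T) : X.edgeEnd (J F) = X.rev (X.edgeEnd F) := by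
    rw [edgeEnd_glue, rev_edgeEnd]
  -- The potential is kept on one direction of each edge and transported, inverted, along `J` to the
  -- other one. Hence `h ∘ J = h⁻¹`; no directed edge equals its reverse, so there is no conflict.
  let h : TetFlag T → A := fun F => if X.edgeEnd F ∈ S then H F else (H (J F))⁻¹
  have hturn (F : TetFlag T) (hF : Perm.sign F.2 = 1) : h (X.turn F) = w F * h F := by
    simp only [h, edgeEnd_turn]
    split_ifs with hD
    · exact hH F hF
    · have e1 : J (X.turn F) = (F.swapAt 2 3).swapAt 0 1 := by
        simp only [J, turn_apply]
        rw [X.glue_swap _ (by decide) (by decide), glue_glue]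
      have e2 : X.turn ((F.swapAt 2 3).swapAt 0 1) = J F := by
        rw [turn_apply, ← TetFlag.swapAt_comm, TetFlag.swapAt_swapAt]
      have e3 := hH ((F.swapAt 2 3).swapAt 0 1) (by
        rw [TetFlag.sign_swapAt (by decide), TetFlag.sign_swapAt (by decide), neg_neg, hF])
      rw [e2, hJ] at e3
      rw [e1, e3, mul_inv, mul_inv_cancel_left]
  have hrev (F : TetFlag T) : h (J F) = (h F)⁻¹ := by
    simp only [h, clJ, JJ]
    by_cases hD : X.edgeEnd F ∈ S
    · have : X.rev (X.edgeEnd F) ∉ S := fun h => (hS _).2 h hD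
      simp [hD, this]
    · simp [hD, (hS _).1 hD]
  have so (F : TetFlag T) (hF : Perm.sign F.2 ≠ 1) : Perm.sign (X.glue F).2 = 1 := by
    rw [sign_glue, TetFlag.sign_ne_one hF, neg_neg]
  have one_ne : (-1 : ℤˣ) ≠ 1 := by decide
  -- An odd flag takes the value of the even flag that is glued to it.
  refine ⟨fun F => if Perm.sign F.2 = 1 then h F else h (X.glue F), ?_, ?_, ?_⟩
  · intro F
    by_cases hF : Perm.sign F.2 = 1
    · simp [sign_glue, hF, one_ne, glue_glue]
    · simp [so F hF, hF]
  · intro F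
    by_cases hF : Perm.sign F.2 = 1
    · simp only [TetFlag.sign_swapAt (show (0 : Fin 4) ≠ 1 by decide), hF, one_ne, if_true, if_false]
      exact hrev F
    · simp only [TetFlag.sign_swapAt (show (0 : Fin 4) ≠ 1 by decide), TetFlag.sign_ne_one hF,
        one_ne, neg_neg, if_true, if_false]
      rw [← hrev]
      simp only [J]
      rw [← X.glue_swap _ (by decide) (by decide), glue_glue]
  · intro F hF
    simp only [TetFlag.sign_swapAt (show (2 : Fin 4) ≠ 3 by decide), hF, one_ne, if_true, if_false]
    exact hturn F hF

end Potential

end OrientedTriangulation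

/-! ### Vanishing of the second cohomology group -/

/-- The quotient of `ker d` by `D` has rank 0, hence is torsion, and `D` is saturated. -/
lemma Submodule.ker_le_of_finrank_le {M N : Type*} [AddCommGroup M] [AddCommGroup N]
    [Module.Finite ℤ M] (d : M →ₗ[ℤ] N) (hd : Function.Surjective d) (D : Submodule ℤ M)
    (hD : D ≤ LinearMap.ker d) (hsat : ∀ (m : ℤ) (x : M), m ≠ 0 → m • x ∈ D → x ∈ D)
    (hrank : Module.finrank ℤ M ≤ Module.finrank ℤ N + Module.finrank ℤ D) :
    LinearMap.ker d ≤ D := by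
  have h1 := (LinearMap.ker d).finrank_quotient_add_finrank
  rw [(d.quotKerEquivOfSurjective hd).finrank_eq] at h1
  have h2 := (D.submoduleOf (LinearMap.ker d)).finrank_quotient_add_finrank
  rw [(Submodule.submoduleOfEquivOfLe hD).finrank_eq] at h2
  have h3 : Module.finrank ℤ (LinearMap.ker d ⧸ D.submoduleOf (LinearMap.ker d)) = 0 := by omega
  rw [Module.finrank_eq_zero_iff] at h3
  intro x hx
  obtain ⟨m, hm, h⟩ := h3 (Submodule.Quotient.mk ⟨x, hx⟩)
  rw [← Submodule.Quotient.mk_smul, Submodule.Quotient.mk_eq_zero] at h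
  exact hsat m x hm h

namespace OrientedTriangulation

variable {T : Type*} (X : OrientedTriangulation T)

/-- The oriented triangle `[σ 0, σ 1, σ 2]`. -/
noncomputable def triangleChain (F : TetFlag T) : X.C₂ := X.triangleRel.mkQ (.single F 1)

lemma triangleChain_glue (F : TetFlag T) : X.triangleChain (X.glue F) = X.triangleChain F := by
  rw [← sub_eq_zero, triangleChain, triangleChain, ← map_sub]
  exact (Submodule.Quotient.mk_eq_zero _).2 (Submodule.subset_span ⟨F, Or.inl rfl⟩)

lemma triangleChain_swap01 (F : TetFlag T) :
    X.triangleChain (F.swapAt 0 1) = - X.triangleChain F := by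
  rw [eq_neg_iff_add_eq_zero, triangleChain, triangleChain, ← map_add]
  exact (Submodule.Quotient.mk_eq_zero _).2 (Submodule.subset_span ⟨F, Or.inr (Or.inl rfl)⟩)

lemma triangleChain_swap12 (F : TetFlag T) :
    X.triangleChain (F.swapAt 1 2) = - X.triangleChain F := by
  rw [eq_neg_iff_add_eq_zero, triangleChain, triangleChain, ← map_add]
  exact (Submodule.Quotient.mk_eq_zero _).2 (Submodule.subset_span ⟨F, Or.inr (Or.inr rfl)⟩)

lemma edgeChain_swap23 (F : TetFlag T) : X.edgeChain (F.swapAt 2 3) = X.edgeChain F := by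
  rw [← sub_eq_zero, edgeChain, edgeChain, ← map_sub]
  exact (Submodule.Quotient.mk_eq_zero _).2 (Submodule.subset_span ⟨F, Or.inr (Or.inl rfl)⟩)

lemma d₂_triangleChain (F : TetFlag T) : X.d₂ (X.triangleChain F) =
    X.edgeChain ((F.swapAt 0 1).swapAt 1 2) - X.edgeChain (F.swapAt 1 2) + X.edgeChain F := by
  simp [d₂, triangleChain]

lemma triangleChain_congr {F G : TetFlag T} (h1 : F.1 = G.1) (h2 : F.2 3 = G.2 3) :
    X.triangleChain F = (Perm.sign F.2 * Perm.sign G.2 : ℤˣ) • X.triangleChain G := by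
  obtain ⟨t, σ⟩ := F
  obtain ⟨t', τ⟩ := G
  obtain rfl : t = t' := h1
  have key : ∀ π : Perm (Fin 4), π 3 = 3 → π = 1 ∨ π = Equiv.swap 0 1 ∨ π = Equiv.swap 1 2 ∨
      π = Equiv.swap 0 1 * Equiv.swap 1 2 ∨ π = Equiv.swap 1 2 * Equiv.swap 0 1 ∨
      π = Equiv.swap 0 1 * Equiv.swap 1 2 * Equiv.swap 0 1 := by decide
  obtain ⟨π, rfl⟩ : ∃ π, σ = τ * π := ⟨τ⁻¹ * σ, by group⟩
  have h3 : π 3 = 3 := τ.injective h2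
  have s1' (τ : Perm (Fin 4)) : X.triangleChain (t, τ * Equiv.swap 0 1) = - X.triangleChain (t, τ) :=
    X.triangleChain_swap01 (t, τ)
  have s2' (τ : Perm (Fin 4)) : X.triangleChain (t, τ * Equiv.swap 1 2) = - X.triangleChain (t, τ) :=
    X.triangleChain_swap12 (t, τ)
  have hs (a : ℤˣ) : a * a = 1 := Int.units_mul_self a
  have n1 : Perm.sign (Equiv.swap (0 : Fin 4) 1) = -1 := Perm.sign_swap (by decide)
  have n2 : Perm.sign (Equiv.swap (1 : Fin 4) 2) = -1 := Perm.sign_swap (by decide)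
  rcases key π h3 with rfl | rfl | rfl | rfl | rfl | rfl <;>
    simp only [← mul_assoc, s1', s2', Perm.sign_mul, n1, n2, mul_one, mul_neg, neg_mul, neg_neg,
      hs, one_smul, Units.neg_smul]

/-- The even permutation that moves `3` to `i` and permutes the vertices in pairs. -/
def faceFlag (i : Fin 4) : Perm (Fin 4) :=
  match i with
  | 0 => Equiv.swap 0 3 * Equiv.swap 1 2
  | 1 => Equiv.swap 0 2 * Equiv.swap 1 3
  | 2 => Equiv.swap 0 1 * Equiv.swap 2 3
  | 3 => 1

lemma sign_faceFlag : ∀ i, Perm.sign (faceFlag i) = 1 := by decide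

lemma faceFlag_three : ∀ i, faceFlag i 3 = i := by decide

section Coordinates

/-- The face of a tetrahedron that is glued to a given one. -/
def glueFace (x : T × Fin 4) : T × Fin 4 := (X.adj x.1 x.2, X.perm x.1 x.2 x.2)

lemma glueFace_glueFace (x : T × Fin 4) : X.glueFace (X.glueFace x) = x := by
  simp [glueFace, X.adj_adj, X.perm_perm]

lemma glueFace_ne (x : T × Fin 4) : X.glueFace x ≠ x := X.face_ne x.1 x.2

lemma face_glue (F : TetFlag T) :
    ((X.glue F).1, (X.glue F).2 3) = X.glueFace (F.1, F.2 3) := rfl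

open Classical in
/-- The coordinates of oriented 2-chains with respect to the faces of the tetrahedra. -/
noncomputable def faceCoord : X.C₂ →ₗ[ℤ] (T × Fin 4 → ℤ) :=
  X.triangleRel.liftQ
    (Finsupp.linearCombination ℤ fun F : TetFlag T => (Perm.sign F.2 : ℤ) •
      (Pi.single (F.1, F.2 3) 1 - Pi.single (X.glueFace (F.1, F.2 3)) 1 : T × Fin 4 → ℤ)) <| by
    have h01 : Equiv.swap (0 : Fin 4) 1 3 = 3 := by decide
    have h12 : Equiv.swap (1 : Fin 4) 2 3 = 3 := by decide
    rw [triangleRel, Submodule.span_le]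
    rintro c ⟨F, rfl | rfl | rfl⟩
    · simp only [SetLike.mem_coe, LinearMap.mem_ker, map_sub, Finsupp.linearCombination_single,
        one_smul, face_glue, glueFace_glueFace, sign_glue, Units.val_neg, neg_smul]
      module
    · simp [TetFlag.swapAt, h01]
    · simp [TetFlag.swapAt, h12]

open Classical in
lemma faceCoord_triangleChain (F : TetFlag T) : X.faceCoord (X.triangleChain F) =
    (Perm.sign F.2 : ℤ) •
      (Pi.single (F.1, F.2 3) 1 - Pi.single (X.glueFace (F.1, F.2 3)) 1 : T × Fin 4 → ℤ) := by
  simp [faceCoord, triangleChain]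

lemma triangleChain_induction {P : X.C₂ → Prop} (h0 : P 0) (hadd : ∀ x y, P x → P y → P (x + y))
    (hsmul : ∀ (m : ℤ) x, P x → P (m • x)) (h1 : ∀ F, P (X.triangleChain F)) (x : X.C₂) : P x := by
  obtain ⟨x, rfl⟩ := X.triangleRel.mkQ_surjective x
  induction x using Finsupp.induction_linear with
  | zero => simpa using h0
  | add x y hx hy => simpa using hadd _ _ hx hy
  | single F m =>
    have := hsmul m _ (h1 F)
    rwa [triangleChain, ← map_smul, Finsupp.smul_single, smul_eq_mul, mul_one] at this

variable [Fintype T]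

/-- A 2-chain with given coordinates. -/
noncomputable def chainOfCoord (S : Set (T × Fin 4)) : (T × Fin 4 → ℤ) →ₗ[ℤ] X.C₂ :=
  open Classical in
  ∑ x : T × Fin 4 with x ∈ S,
    (LinearMap.proj x).smulRight (X.triangleChain (x.1, faceFlag x.2))

/-- A triangle of the glued space comes from two faces, exchanged by `glueFace`, of which `S`
contains one. The two coordinates have opposite signs because gluings are odd. -/
lemma chainOfCoord_faceCoord {S : Set (T × Fin 4)} (hS : ∀ x, x ∉ S ↔ X.glueFace x ∈ S)
    (c : X.C₂) : X.chainOfCoord S (X.faceCoord c) = c := by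
  induction c using triangleChain_induction with
  | h0 => simp
  | hadd x y hx hy => rw [map_add, map_add, hx, hy]
  | hsmul m x hx => rw [map_smul, map_smul, hx]
  | h1 F =>
    classical
    have e : X.chainOfCoord S (X.faceCoord (X.triangleChain F)) =
        ∑ x : T × Fin 4, ((Perm.sign F.2 : ℤ) *
          (Pi.single (M := fun _ => ℤ) (F.1, F.2 3) 1 x -
            Pi.single (M := fun _ => ℤ) (X.glueFace (F.1, F.2 3)) 1 x)) •
          (if x ∈ S then X.triangleChain (x.1, faceFlag x.2) else 0) := by
      rw [faceCoord_triangleChain]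
      simp only [chainOfCoord, Finset.sum_filter, LinearMap.sum_apply]
      refine Finset.sum_congr rfl fun x _ => ?_
      split_ifs <;> simp
    rw [e]
    simp only [mul_sub, sub_smul, Finset.sum_sub_distrib, Pi.single_apply, mul_ite, mul_one,
      mul_zero, ite_smul, zero_smul, Finset.sum_ite_eq', Finset.mem_univ, if_true]
    by_cases h : (F.1, F.2 3) ∈ S
    · have h' : X.glueFace (F.1, F.2 3) ∉ S := fun h' => (hS _).2 h' h
      rw [if_pos h, if_neg h', smul_zero, sub_zero]
      rw [X.triangleChain_congr (F := F) (G := (F.1, faceFlag (F.2 3))) rfl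
        (faceFlag_three _).symm, sign_faceFlag, mul_one]
      rfl
    · have h' := (hS _).1 h
      rw [if_neg h, if_pos h', smul_zero, zero_sub, ← X.triangleChain_glue F]
      rw [X.triangleChain_congr (F := X.glue F) (G := ((X.glue F).1, faceFlag ((X.glue F).2 3))) rfl
        (faceFlag_three _).symm, sign_faceFlag, mul_one, sign_glue, Units.neg_smul]
      rfl

lemma faceCoord_injective : Function.Injective X.faceCoord := by
  obtain ⟨S, hS⟩ := exists_half X.glueFace X.glueFace_glueFace X.glueFace_ne
  exact Function.LeftInverse.injective (g := X.chainOfCoord S) (X.chainOfCoord_faceCoord hS)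

instance : Module.Finite ℤ X.C₂ := by
  obtain ⟨S, hS⟩ := exists_half X.glueFace X.glueFace_glueFace X.glueFace_ne
  exact Module.Finite.of_surjective (X.chainOfCoord S)
    (Function.LeftInverse.surjective (X.chainOfCoord_faceCoord hS))

/-- The `4 * |T|` faces of the tetrahedra are glued in pairs, and the coordinates on one face of
each pair determine a chain. -/
lemma finrank_C₂_le : Module.finrank ℤ X.C₂ ≤ 2 * Fintype.card T := by
  obtain ⟨S, hS⟩ := exists_half X.glueFace X.glueFace_glueFace X.glueFace_ne
  classical
  let r : X.C₂ →ₗ[ℤ] (S → ℤ) := (LinearMap.funLeft ℤ ℤ Subtype.val) ∘ₗ X.faceCoord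
  have hr : Function.Injective r := by
    intro x y h
    rw [← X.chainOfCoord_faceCoord hS x, ← X.chainOfCoord_faceCoord hS y]
    simp only [chainOfCoord, LinearMap.sum_apply, LinearMap.smulRight_apply, LinearMap.proj_apply]
    refine Finset.sum_congr rfl fun s hs => ?_
    rw [show X.faceCoord x s = X.faceCoord y s from congrFun h ⟨s, (Finset.mem_filter.1 hs).2⟩]
  have h1 := LinearMap.finrank_le_finrank_of_injective hr
  have h2 := two_mul_card_half X.glueFace X.glueFace_glueFace S hS
  rw [Module.finrank_fintype_fun_eq_card] at h1
  simp only [Nat.card_eq_fintype_card, Fintype.card_prod, Fintype.card_fin] at h2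
  omega

/-- The sum of the boundaries of the tetrahedra, with given coefficients. -/
noncomputable def d₃ : (T → ℤ) →ₗ[ℤ] X.C₂ :=
  ∑ t : T, (LinearMap.proj t).smulRight (∑ i, X.triangleChain (t, faceFlag i))

lemma d₃_apply (y : T → ℤ) : X.d₃ y = ∑ t, y t • ∑ i, X.triangleChain (t, faceFlag i) := by
  simp [d₃]

/-- The tetrahedra on the two sides of a triangle induce opposite orientations on it. -/
lemma faceCoord_d₃ (y : T → ℤ) (x : T × Fin 4) :
    X.faceCoord (X.d₃ y) x = y x.1 - y (X.glueFace x).1 := by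
  classical
  have h (z : T × Fin 4) : X.glueFace z = x ↔ z = X.glueFace x :=
    ⟨fun h => by rw [← h, glueFace_glueFace], fun h => by rw [h, glueFace_glueFace]⟩
  have e : X.faceCoord (X.d₃ y) x = ∑ z : T × Fin 4, y z.1 * ((if z = x then 1 else 0) -
      (if z = X.glueFace x then 1 else 0)) := by
    rw [d₃_apply, Fintype.sum_prod_type]
    simp only [map_sum, map_smul, faceCoord_triangleChain, sign_faceFlag, faceFlag_three,
      Units.val_one, one_smul, Finset.sum_apply, Pi.smul_apply, Pi.sub_apply, smul_eq_mul,
      Pi.single_apply, Finset.mul_sum, ← h]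
    simp only [eq_comm]
  rw [e]
  simp [mul_sub]

end Coordinates

section Connected

variable {X}

/-- All flags represent the single vertex, and the moves that relate them stay in a tetrahedron or
pass to an adjacent one. -/
lemma IsOneVertexManifold.connected (hX : X.IsOneVertexManifold) {P : T → Prop}
    (hP : ∀ t i, P t → P (X.adj t i)) {t : T} (ht : P t) (t' : T) : P t' := by
  let Q : X.Vertex → Prop := Quot.lift (fun F => P F.1) (by
    rintro F G (rfl | rfl | rfl)
    · refine propext ⟨fun h => hP _ _ h, fun h => ?_⟩
      have := hP _ ((X.glue F).2 3) h
      change P (X.glue (X.glue F)).1 at this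
      rwa [glue_glue] at this
    · rfl
    · rfl)
  have := (Nat.card_eq_one_iff_unique.1 hX.card_vertex).1
  have h : Q (X.vertex (t, 1)) = Q (X.vertex (t', 1)) := by
    rw [Subsingleton.elim (X.vertex (t, 1)) (X.vertex (t', 1))]
  exact h.mp ht

/-- With a single vertex every 1-chain is a cycle, so `H₁` is the cokernel of `d₂`. -/
lemma IsOneVertexManifold.d₂_surjective (hX : X.IsOneVertexManifold) (h : Subsingleton X.H₁) :
    Function.Surjective X.d₂ := by
  have := (Nat.card_eq_one_iff_unique.1 hX.card_vertex).1
  have h1 (c : X.C₁) : c ∈ LinearMap.ker X.d₁ := by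
    obtain ⟨c, rfl⟩ := X.edgeRel.mkQ_surjective c
    rw [LinearMap.mem_ker]
    induction c using Finsupp.induction_linear with
    | zero => simp
    | add x y hx hy => rw [map_add, map_add, hx, hy, add_zero]
    | single F m =>
      simp [d₁, Subsingleton.elim (X.vertex (F.swapAt 0 1)) (X.vertex F)]
  intro c
  have h2 := (Submodule.Quotient.mk_eq_zero _).1
    (Subsingleton.elim (Submodule.Quotient.mk ⟨c, h1 c⟩ : X.H₁) 0)
  exact h2

end Connected

end OrientedTriangulation

namespace OrientedTriangulation

variable {T : Type*} {X : OrientedTriangulation T}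

lemma edgeChain_congr {t : T} {σ τ : Perm (Fin 4)} (h0 : σ 0 = τ 0) (h1 : σ 1 = τ 1) :
    X.edgeChain (t, σ) = X.edgeChain (t, τ) := by
  have key : ∀ π : Perm (Fin 4), π 0 = 0 → π 1 = 1 → π = 1 ∨ π = Equiv.swap 2 3 := by decide
  obtain ⟨π, rfl⟩ : ∃ π, σ = τ * π := ⟨τ⁻¹ * σ, by group⟩
  rcases key π (τ.injective h0) (τ.injective h1) with rfl | rfl
  · rw [mul_one]
  · exact X.edgeChain_swap23 (t, τ)

lemma edgeChain_add_reverse {t : T} {σ τ : Perm (Fin 4)} (h0 : σ 0 = τ 1) (h1 : σ 1 = τ 0) :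
    X.edgeChain (t, σ) + X.edgeChain (t, τ) = 0 := by
  rw [edgeChain_congr (σ := σ) (τ := τ * Equiv.swap 0 1) (by simpa using h0) (by simpa using h1)]
  have := X.edgeChain_swap (t, τ)
  rw [TetFlag.swapAt] at this
  rw [this, neg_add_cancel]

/-- Each of the six edges occurs in two of the faces, and the two occurrences cancel. -/
lemma d₂_boundary (t : T) : ∑ i, X.d₂ (X.triangleChain (t, faceFlag i)) = 0 := by
  simp only [Fin.sum_univ_four, d₂_triangleChain, TetFlag.swapAt]
  have h (σ τ : Perm (Fin 4)) (h0 : σ 0 = τ 1) (h1 : σ 1 = τ 0) :=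
    edgeChain_add_reverse (X := X) (t := t) h0 h1
  have h' (σ τ : Perm (Fin 4)) (h0 : σ 0 = τ 0) (h1 : σ 1 = τ 1) :=
    edgeChain_congr (X := X) (t := t) h0 h1
  have c01 := h (faceFlag 3) (faceFlag 2) (by decide) (by decide)
  have c23 := h (faceFlag 1) (faceFlag 0) (by decide) (by decide)
  have c12 := h (faceFlag 3 * Equiv.swap 0 1 * Equiv.swap 1 2)
    (faceFlag 0 * Equiv.swap 0 1 * Equiv.swap 1 2) (by decide) (by decide)
  have c03 := h (faceFlag 2 * Equiv.swap 0 1 * Equiv.swap 1 2)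
    (faceFlag 1 * Equiv.swap 0 1 * Equiv.swap 1 2) (by decide) (by decide)
  have c02 := h (faceFlag 3 * Equiv.swap 1 2) (faceFlag 1 * Equiv.swap 1 2) (by decide) (by decide)
  have c13 := h (faceFlag 2 * Equiv.swap 1 2) (faceFlag 0 * Equiv.swap 1 2) (by decide) (by decide)
  rw [add_eq_zero_iff_eq_neg] at c01 c23 c12 c03 c02 c13
  rw [c01, c23, c12, c03, c02, c13]
  abel

open Classical in
/-- The coordinates of oriented 1-chains with respect to the directed edges. -/
noncomputable def edgeCoord (X : OrientedTriangulation T) : X.C₁ →ₗ[ℤ] (X.EdgeEnd → ℤ) :=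
  X.edgeRel.liftQ
    (Finsupp.linearCombination ℤ fun F : TetFlag T =>
      (Pi.single (X.edgeEnd F) 1 - Pi.single (X.rev (X.edgeEnd F)) 1 : X.EdgeEnd → ℤ)) <| by
    rw [edgeRel, Submodule.span_le]
    rintro c ⟨F, rfl | rfl | rfl⟩
    · simp [edgeEnd_glue]
    · simp [edgeEnd_swap]
    · simp [← rev_edgeEnd, rev_rev]

open Classical in
lemma edgeCoord_edgeChain (F : TetFlag T) : X.edgeCoord (X.edgeChain F) =
    (Pi.single (X.edgeEnd F) 1 - Pi.single (X.rev (X.edgeEnd F)) 1 : X.EdgeEnd → ℤ) := by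
  simp [edgeCoord, edgeChain]

lemma IsOneVertexManifold.nonempty (hX : X.IsOneVertexManifold) : Nonempty T := by
  obtain ⟨v⟩ := (Nat.card_eq_one_iff_unique.1 hX.card_vertex).2
  induction v using Quot.ind with
  | _ F => exact ⟨F.1⟩

lemma IsOneVertexManifold.sub_dvd (hX : X.IsOneVertexManifold) {y : T → ℤ} {m : ℤ}
    (h : ∀ t i, m ∣ y t - y (X.adj t i)) (t t' : T) : m ∣ y t - y t' := by
  refine hX.connected (P := fun t' => m ∣ y t - y t') (fun t' i h' => ?_) (t := t) (by simp) t'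
  have := dvd_add h' (h t' i)
  rwa [sub_add_sub_cancel] at this

/-- If `H₁ = 0`, a multiplicative function of the directed edges with trivial coboundary is
trivial. -/
lemma IsOneVertexManifold.eq_one_of_cocycle (hX : X.IsOneVertexManifold) (h : Subsingleton X.H₁)
    {A : Type*} [CommGroup A] {C : TetFlag T → A} (hglue : ∀ F, C (X.glue F) = C F)
    (h23 : ∀ F, C (F.swapAt 2 3) = C F) (h01 : ∀ F, C (F.swapAt 0 1) = (C F)⁻¹)
    (hC : ∀ F, C ((F.swapAt 0 1).swapAt 1 2) * (C (F.swapAt 1 2))⁻¹ * C F = 1) (F : TetFlag T) :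
    C F = 1 := by
  let c : X.C₁ →ₗ[ℤ] Additive A := X.edgeRel.liftQ
    (Finsupp.linearCombination ℤ fun F : TetFlag T => Additive.ofMul (C F)) <| by
      rw [edgeRel, Submodule.span_le]
      rintro c ⟨F, rfl | rfl | rfl⟩
      · simp [hglue]
      · simp [h23]
      · simp [h01]
  have hc (F : TetFlag T) : c (X.edgeChain F) = Additive.ofMul (C F) := by simp [c, edgeChain]
  have h0 : ∀ b, c (X.d₂ b) = 0 := by
    intro b
    induction b using triangleChain_induction with
    | h0 => simp
    | hadd x y hx hy => rw [map_add, map_add, hx, hy, add_zero]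
    | hsmul m x hx => rw [map_smul, map_smul, hx, smul_zero]
    | h1 F =>
      rw [d₂_triangleChain, map_add, map_sub, hc, hc, hc, sub_eq_add_neg]
      exact congrArg Additive.ofMul (hC F)
  -- The cochain `c` kills boundaries, and every edge is a boundary.
  obtain ⟨b, hb⟩ := hX.d₂_surjective h (X.edgeChain F)
  have := h0 b
  rw [hb, hc] at this
  exact Additive.ofMul.injective this

section Rank

variable [Fintype T]

/-- The coordinates on one direction of each edge map the 1-chains onto a free group whose rank is
half the number of directed edges. -/
lemma card_edgeEnd_le : Nat.card X.EdgeEnd ≤ 2 * Module.finrank ℤ X.C₁ := by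
  obtain ⟨S, hS⟩ := exists_half X.rev X.rev_rev X.rev_ne
  classical
  have := Fintype.ofFinite X.EdgeEnd
  have : Module.Finite ℤ X.C₁ := by infer_instance
  let r : X.C₁ →ₗ[ℤ] (S → ℤ) := (LinearMap.funLeft ℤ ℤ Subtype.val) ∘ₗ X.edgeCoord
  have hr : Function.Surjective r := by
    rw [← LinearMap.range_eq_top, eq_top_iff, ← (Pi.basisFun ℤ S).span_eq, Submodule.span_le]
    rintro _ ⟨s, rfl⟩
    obtain ⟨F, hF⟩ := X.edgeEnd_surjective s
    refine ⟨X.edgeChain F, ?_⟩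
    ext s'
    have h1 : s'.1 ≠ X.rev s.1 := fun h => (hS s).2 (h ▸ s'.2) s.2
    simp [r, LinearMap.funLeft_apply, edgeCoord_edgeChain, hF, Pi.single_apply, h1, Subtype.ext_iff]
  have h1 := LinearMap.finrank_le_finrank_of_surjective hr
  have h2 := two_mul_card_half X.rev X.rev_rev S hS
  rw [Module.finrank_fintype_fun_eq_card, ← Nat.card_eq_fintype_card] at h1
  omega

/-- At most four of the `24 * |T|` flags represent the same short edge: two directions, on two sides
of a face. -/
lemma le_card_linkEdge : 6 * Fintype.card T ≤ Nat.card X.LinkEdge := by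
  classical
  let q : TetFlag T → X.LinkEdge := Quot.mk _
  have hq : Function.Surjective q := Quot.mk_surjective
  have : Finite X.LinkEdge := Finite.of_surjective q hq
  have := Fintype.ofFinite X.LinkEdge
  have key (F G : TetFlag T) (h : q F = q G) :
      G ∈ ({F, X.glue F, F.swapAt 1 2, X.glue (F.swapAt 1 2)} : Finset (TetFlag T)) := by
    let P : TetFlag T → Prop := fun G =>
      G ∈ ({F, X.glue F, F.swapAt 1 2, X.glue (F.swapAt 1 2)} : Finset (TetFlag T))
    have hg (G : TetFlag T) (h : P G) : P (X.glue G) := by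
      simp only [P, Finset.mem_insert, Finset.mem_singleton] at h ⊢
      rcases h with rfl | rfl | rfl | rfl <;> simp [glue_glue]
    have hs (G : TetFlag T) (h : P G) : P (G.swapAt 1 2) := by
      simp only [P, Finset.mem_insert, Finset.mem_singleton] at h ⊢
      have e := X.glue_swap F (i := 1) (j := 2) (by decide) (by decide)
      rcases h with rfl | rfl | rfl | rfl <;> simp [e, TetFlag.swapAt_swapAt]
    let Q : X.LinkEdge → Prop := Quot.lift P (by
      rintro F G (rfl | rfl)
      · exact propext ⟨hg F, fun h => by simpa [glue_glue] using hg _ h⟩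
      · exact propext ⟨hs F, fun h => by simpa [TetFlag.swapAt_swapAt] using hs _ h⟩)
    have h1 : Q (q F) = Q (q G) := by rw [h]
    exact h1.mp (by simp [Q, P, q])
  have h1 := Finset.card_le_mul_card_image_of_maps_to (f := q) (s := Finset.univ)
    (t := Finset.univ) (fun _ _ => Finset.mem_univ _) 4 (by
      intro b _
      obtain ⟨F, rfl⟩ := hq b
      refine (Finset.card_le_card (t := {F, X.glue F, F.swapAt 1 2, X.glue (F.swapAt 1 2)})
        fun G hG => key F G (Finset.mem_filter.1 hG).2.symm).trans Finset.card_le_four)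
  rw [Finset.card_univ, Finset.card_univ, Fintype.card_prod, Fintype.card_perm, Fintype.card_fin,
    ← Nat.card_eq_fintype_card (α := X.LinkEdge)] at h1
  rw [show Nat.factorial 4 = 24 from rfl] at h1
  omega

lemma IsOneVertexManifold.d₃_eq_zero_iff (hX : X.IsOneVertexManifold) (y : T → ℤ) :
    X.d₃ y = 0 ↔ ∀ t t', y t = y t' := by
  constructor
  · intro h t t'
    rw [← sub_eq_zero, ← zero_dvd_iff]
    refine hX.sub_dvd (fun t i => ?_) t t'
    have := X.faceCoord_d₃ y (t, i)
    rw [h, map_zero] at this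
    rw [zero_dvd_iff]
    exact this.symm
  · intro h
    apply X.faceCoord_injective
    rw [map_zero]
    ext x
    rw [faceCoord_d₃, h x.1 (X.glueFace x).1, sub_self, Pi.zero_apply]

/-- By connectedness the kernel of `d₃` consists of constant functions, so its rank is at most 1. -/
lemma IsOneVertexManifold.card_le_finrank_range_d₃ (hX : X.IsOneVertexManifold) :
    Fintype.card T ≤ Module.finrank ℤ (LinearMap.range X.d₃) + 1 := by
  have := hX.nonempty
  have t := Classical.arbitrary T
  have h1 := (LinearMap.ker X.d₃).finrank_quotient_add_finrank
  rw [X.d₃.quotKerEquivRange.finrank_eq, Module.finrank_fintype_fun_eq_card] at h1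
  have h2 : Module.finrank ℤ (LinearMap.ker X.d₃) ≤ Module.finrank ℤ ℤ := by
    refine LinearMap.finrank_le_finrank_of_injective
      (f := (LinearMap.proj t) ∘ₗ (LinearMap.ker X.d₃).subtype) fun y z h => ?_
    have hy := (hX.d₃_eq_zero_iff _).1 y.2
    have hz := (hX.d₃_eq_zero_iff _).1 z.2
    ext t'
    rw [hy t' t, hz t' t]
    exact h
  rw [Module.finrank_self] at h2
  omega

/-- The coordinates of `d₃ y` are the differences of `y` across the faces. If `m` divides all of
them, it divides `y t - y t₀` by connectedness, and the quotients form a preimage of `c`. -/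
lemma IsOneVertexManifold.range_d₃_saturated (hX : X.IsOneVertexManifold) (m : ℤ) (c : X.C₂)
    (hm : m ≠ 0) (h : m • c ∈ LinearMap.range X.d₃) : c ∈ LinearMap.range X.d₃ := by
  have := hX.nonempty
  have t₀ := Classical.arbitrary T
  obtain ⟨y, hy⟩ := h
  have h1 (t : T) : m ∣ y t - y t₀ := by
    refine hX.sub_dvd (fun t i => ?_) t t₀
    have := X.faceCoord_d₃ y (t, i)
    rw [hy, map_smul] at this
    exact ⟨_, this.symm⟩
  choose z hz using h1
  refine ⟨z, X.faceCoord_injective ?_⟩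
  ext x
  have h2 := X.faceCoord_d₃ y x
  rw [hy, map_smul, Pi.smul_apply, smul_eq_mul] at h2
  rw [faceCoord_d₃]
  apply mul_left_cancel₀ hm
  rw [h2, mul_sub, ← hz, ← hz]
  ring

/-- In a closed 3-manifold with trivial first homology group, every 2-cycle is a boundary. -/
lemma IsOneVertexManifold.ker_d₂_le (hX : X.IsOneVertexManifold) (h : Subsingleton X.H₁) :
    LinearMap.ker X.d₂ ≤ LinearMap.range X.d₃ := by
  refine Submodule.ker_le_of_finrank_le X.d₂ (hX.d₂_surjective h) _ ?_ hX.range_d₃_saturated ?_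
  · rintro _ ⟨y, rfl⟩
    rw [LinearMap.mem_ker, d₃_apply]
    simp only [map_sum, map_smul, d₂_boundary, smul_zero, Finset.sum_const_zero]
  -- Euler characteristic 2 gives at least `2 * |T| + 2` directed edges, so `C₁` has rank at least
  -- `|T| + 1`. The image of `d₃` has rank at least `|T| - 1`, and `C₂` has rank at most `2 * |T|`.
  · have h1 := hX.link_sphere
    have h2 := le_card_linkEdge (X := X)
    have h3 := card_edgeEnd_le (X := X)
    have h4 := hX.card_le_finrank_range_d₃
    have h5 := X.finrank_C₂_le
    rw [linkEulerChar] at h1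
    simp only [Nat.card_eq_fintype_card (α := T × Fin 4), Fintype.card_prod, Fintype.card_fin] at h1
    push_cast at h1
    omega

/-- If `H₁ = 0`, a closed multiplicative function of the oriented triangles is a coboundary. -/
lemma IsOneVertexManifold.exists_cochain (hX : X.IsOneVertexManifold) (h : Subsingleton X.H₁)
    {A : Type*} [CommGroup A] {ε : TetFlag T → A} (hglue : ∀ F, ε (X.glue F) = ε F)
    (h01 : ∀ F, ε (F.swapAt 0 1) = (ε F)⁻¹) (h12 : ∀ F, ε (F.swapAt 1 2) = (ε F)⁻¹)
    (hε : ∀ t, ∏ i, ε (t, faceFlag i) = 1) :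
    ∃ C : TetFlag T → A, (∀ F, C (X.glue F) = C F) ∧ (∀ F, C (F.swapAt 2 3) = C F) ∧
      (∀ F, C (F.swapAt 0 1) = (C F)⁻¹) ∧
      ∀ F, C ((F.swapAt 0 1).swapAt 1 2) * (C (F.swapAt 1 2))⁻¹ * C F = ε F := by
  let e : X.C₂ →ₗ[ℤ] Additive A := X.triangleRel.liftQ
    (Finsupp.linearCombination ℤ fun F : TetFlag T => Additive.ofMul (ε F)) <| by
      rw [triangleRel, Submodule.span_le]
      rintro c ⟨F, rfl | rfl | rfl⟩
      · simp [hglue]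
      · simp [h01]
      · simp [h12]
  have he (F : TetFlag T) : e (X.triangleChain F) = Additive.ofMul (ε F) := by
    simp [e, triangleChain]
  have hker : LinearMap.ker X.d₂ ≤ LinearMap.ker e := by
    refine (hX.ker_d₂_le h).trans ?_
    rintro _ ⟨y, rfl⟩
    rw [LinearMap.mem_ker, d₃_apply]
    simp only [map_sum, map_smul, he]
    refine Finset.sum_eq_zero fun t _ => ?_
    rw [← ofMul_prod, hε, ofMul_one, smul_zero]
  -- Since `d₂` is surjective and `e` vanishes on its kernel, `e` descends to the 1-chains.
  let c : X.C₁ →ₗ[ℤ] Additive A := (LinearMap.ker X.d₂).liftQ e hker ∘ₗ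
    (X.d₂.quotKerEquivOfSurjective (hX.d₂_surjective h)).symm.toLinearMap
  have hc (b : X.C₂) : c (X.d₂ b) = e b := by
    have : (X.d₂.quotKerEquivOfSurjective (hX.d₂_surjective h)).symm (X.d₂ b) =
        Submodule.Quotient.mk b := by
      rw [LinearEquiv.symm_apply_eq]
      rfl
    simp only [c, LinearMap.comp_apply, LinearEquiv.coe_coe, this]
    exact Submodule.liftQ_apply _ _ _
  refine ⟨fun F => (c (X.edgeChain F)).toMul, ?_, ?_, ?_, ?_⟩
  · intro F
    simp only [edgeChain_glue]
  · intro F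
    simp only [edgeChain_swap23]
  · intro F
    simp only [edgeChain_swap, map_neg, toMul_neg]
  · intro F
    have := hc (X.triangleChain F)
    rw [d₂_triangleChain, he, map_add, map_sub, sub_eq_add_neg] at this
    exact congrArg Additive.toMul this

end Rank

end OrientedTriangulation

/-! ### Flags of a particular H-triangulation -/

namespace ParticularHTriangulation

variable {T : Type*} (X : ParticularHTriangulation T)

/-- The triangle of a flag does not contain the distinguished edge `K`. -/
def AvoidsK (F : TetFlag T) : Prop := F.1 = X.tK → F.2 3 = 0 ∨ F.2 3 = 1

variable {X}

lemma avoidsK_of_ne {F : TetFlag T} (h : F.1 ≠ X.tK) : X.AvoidsK F := fun h' => absurd h' h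

lemma AvoidsK.glue {F : TetFlag T} (h : X.AvoidsK F) : X.AvoidsK (X.glue F) := by
  intro h1
  by_cases hF : F.1 = X.tK
  · have h2 := X.adj_tK_ne (h hF)
    refine absurd ?_ h2
    rw [← hF]
    exact h1.trans hF.symm
  · exact X.perm_of_adj_eq hF h1

lemma avoidsK_glue_iff {F : TetFlag T} : X.AvoidsK (X.glue F) ↔ X.AvoidsK F :=
  ⟨fun h => by simpa [X.glue_glue] using h.glue, AvoidsK.glue⟩

lemma AvoidsK.glue_ne {F : TetFlag T} (h : X.AvoidsK F) (hF : F.1 = X.tK) :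
    (X.glue F).1 ≠ X.tK := by
  have h2 := X.adj_tK_ne (h hF)
  rwa [← hF] at h2 ⊢

lemma avoidsK_swapAt_iff {F : TetFlag T} {i j : Fin 4} (hi : i ≠ 3) (hj : j ≠ 3) :
    X.AvoidsK (F.swapAt i j) ↔ X.AvoidsK F := by
  simp [AvoidsK, TetFlag.swapAt, Equiv.swap_apply_of_ne_of_ne hi.symm hj.symm]

lemma AvoidsK.swapAt {F : TetFlag T} (h : X.AvoidsK F) {i j : Fin 4} (hi : i ≠ 3) (hj : j ≠ 3) :
    X.AvoidsK (F.swapAt i j) := (avoidsK_swapAt_iff hi hj).2 h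

lemma avoidsK_tK {σ : Perm (Fin 4)} (h : σ 3 = 0 ∨ σ 3 = 1) : X.AvoidsK (X.tK, σ) := fun _ => h

lemma not_avoidsK_tK {σ : Perm (Fin 4)} (h : σ 3 = 2 ∨ σ 3 = 3) : ¬ X.AvoidsK (X.tK, σ) := by
  intro h'
  have := h' rfl
  generalize σ 3 = a at *
  revert a
  decide

lemma AvoidsK.not_meetsK {F : TetFlag T} (h : X.AvoidsK F) : ¬ X.MeetsK F := by
  rintro ⟨h1, h2⟩
  have key : ∀ σ : Perm (Fin 4), (σ 3 = 0 ∨ σ 3 = 1) →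
      ¬ (s(σ 0, σ 1) = s(0, 1) ∨ s(σ 0, σ 2) = s(0, 1)) := by decide
  exact key F.2 (h h1) h2

variable (X)

lemma glue_tK {σ : Perm (Fin 4)} (h : σ 3 = 2 ∨ σ 3 = 3) :
    X.glue (X.tK, σ) = (X.tK, Equiv.swap 2 3 * σ) := by
  rcases h with h | h
  · simp [OrientedTriangulation.glue, h, adj_tK_two, perm_tK_two]
  · simp [OrientedTriangulation.glue, h, X.adj_tK, X.perm_tK]

/-- The edge lies on one of the two faces that are folded onto each other, and the fold exchanges
the vertices 2 and 3. -/
lemma edgeEnd_fold {σ : Perm (Fin 4)} (h : σ 2 = 2 ∨ σ 2 = 3) :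
    X.edgeEnd (X.tK, Equiv.swap 2 3 * σ) = X.edgeEnd (X.tK, σ) := by
  have h1 := X.glue_tK (σ := σ * Equiv.swap 2 3) (by simpa using h)
  have h2 := X.edgeEnd_glue (X.tK, σ * Equiv.swap 2 3)
  rw [h1, ← mul_assoc] at h2
  exact (X.edgeEnd_swap (X.tK, Equiv.swap 2 3 * σ)).symm.trans
    (h2.trans (X.edgeEnd_swap (X.tK, σ)))

lemma not_isDiag : ∀ {a : Fin 4}, a = 0 ∨ a = 1 → ¬ s(a, 2).IsDiag := by
  decide

lemma edgeClass_tK {a b : Fin 4} (ha : a = 0 ∨ a = 1) (hb : b = 2 ∨ b = 3) (h : ¬ s(a, b).IsDiag) :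
    X.edgeClass (X.tK, ⟨s(a, b), h⟩) =
      X.edgeClass (X.tK, ⟨s(a, 2), not_isDiag ha⟩) := by
  obtain ⟨σ, h0, h1, h2⟩ : ∃ σ : Perm (Fin 4), σ 0 = a ∧ σ 1 = b ∧ (σ 2 = 2 ∨ σ 2 = 3) := by
    clear h
    revert a b
    decide
  rcases hb with rfl | rfl
  · rfl
  · have := X.edgeClass_eq_of_edgeEnd_eq (X.edgeEnd_fold h2)
    simp only [TetFlag.edge, Perm.coe_mul, Function.comp_apply, h0, h1] at this
    rw [← this]
    congr 4
    · rcases ha with rfl | rfl <;> decide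

lemma edgeEnd_tK_ne {σ τ : Perm (Fin 4)} {b c : Fin 4} (hb : b = 2 ∨ b = 3) (hc : c = 2 ∨ c = 3)
    (hσ : s(σ 0, σ 1) = s(0, b)) (hτ : s(τ 0, τ 1) = s(1, c)) :
    X.edgeEnd (X.tK, σ) ≠ X.edgeEnd (X.tK, τ) := by
  intro h
  have h1 := X.edgeClass_eq_of_edgeEnd_eq h
  simp only [TetFlag.edge, hσ, hτ] at h1
  rw [X.edgeClass_tK (Or.inl rfl) hb, X.edgeClass_tK (Or.inr rfl) hc] at h1
  exact X.edge_ne h1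

/-- Here `σ` is a directed edge between an end of `K` and a vertex off `K`. The even flags `τ` are:
`σ` itself and its image under the fold; those at `K`; those at the edge 23; those at the other end
of `K`, excluded later by `edge_ne`; and reversed ones, excluded later by `rev_ne`. -/
lemma perm_cases : ∀ σ : Perm (Fin 4), Perm.sign σ = 1 → (σ 2 = 2 ∨ σ 2 = 3) →
    (σ 3 = 0 ∨ σ 3 = 1) → ∀ τ : Perm (Fin 4), Perm.sign τ = 1 →
    τ = σ ∨ τ = Equiv.swap 2 3 * σ * Equiv.swap 2 3 ∨
    ((τ 2 = 2 ∨ τ 2 = 3) ∧ (τ 3 = 2 ∨ τ 3 = 3)) ∨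
    ((τ 2 = 0 ∨ τ 2 = 1) ∧ (τ 3 = 0 ∨ τ 3 = 1)) ∨
    (∃ b c, (b = 2 ∨ b = 3) ∧ (c = 2 ∨ c = 3) ∧ s(σ 0, σ 1) = s(0, b) ∧ s(τ 0, τ 1) = s(1, c)) ∨
    (∃ b c, (b = 2 ∨ b = 3) ∧ (c = 2 ∨ c = 3) ∧ s(τ 0, τ 1) = s(0, b) ∧ s(σ 0, σ 1) = s(1, c)) ∨
    τ = σ * Equiv.swap 0 1 * Equiv.swap 2 3 ∨ τ = Equiv.swap 2 3 * σ * Equiv.swap 0 1 := by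
  decide

section Fold

variable [Fintype T]

/-- Set `C` to 1 on the triangles that contain `K`; then its changes around the directed edge of `σ`
multiply to 1. The tetrahedra other than `tK` contribute nothing, nor does `tK` at the edges `K` and
23. Because the edges 02 and 12 are different in `M`, only the two sectors of `tK` next to the
distinguished face remain, and they compare the two sides of the claim. -/
lemma apply_fold_of_sign {A : Type*} [CommGroup A] {C : TetFlag T → A}
    (hglue : ∀ F, X.AvoidsK F → C (X.glue F) = C F)
    (hswap : ∀ F, F.1 ≠ X.tK → C (F.swapAt 2 3) = C F)
    (hfold : ∀ σ : Perm (Fin 4), (σ 2 = 0 ∨ σ 2 = 1) → (σ 3 = 0 ∨ σ 3 = 1) →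
      C (X.tK, σ * Equiv.swap 2 3) = C (X.tK, σ))
    {σ : Perm (Fin 4)} (hs : Perm.sign σ = 1) (h2 : σ 2 = 2 ∨ σ 2 = 3) (h3 : σ 3 = 0 ∨ σ 3 = 1) :
    C (X.tK, Equiv.swap 2 3 * σ) = C (X.tK, σ) := by
  classical
  let C' : TetFlag T → A := fun F => if X.AvoidsK F then C F else 1
  have hC' (F) : C' (X.glue F) = C' F := by
    simp only [C', avoidsK_glue_iff]
    split_ifs with h
    · exact hglue F h
    · rfl
  have h := OrientedTriangulation.prod_swap_div
    (X.edgeClosed_edgeEnd (X.edgeEnd (X.tK, σ))) hC'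
  have e1 : Equiv.swap (2 : Fin 4) 3 2 = 3 := by decide
  have e2 : Equiv.swap (2 : Fin 4) 3 3 = 2 := by decide
  have h2' : (Equiv.swap 2 3 * σ : Perm (Fin 4)) 2 = 2 ∨ (Equiv.swap 2 3 * σ : Perm (Fin 4)) 2 = 3 := by
    rcases h2 with h | h <;> simp [h]
  have h3' : (Equiv.swap 2 3 * σ : Perm (Fin 4)) 3 = 0 ∨ (Equiv.swap 2 3 * σ : Perm (Fin 4)) 3 = 1 := by
    rcases h3 with h | h <;> rw [Perm.mul_apply, h] <;> decide
  have sgn : Perm.sign (Equiv.swap (2 : Fin 4) 3) = -1 := Perm.sign_swap (by decide)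
  rw [Finset.prod_eq_mul (X.tK, σ) (X.tK, Equiv.swap 2 3 * σ * Equiv.swap 2 3)] at h
  · have a1 : C' (X.tK, σ) = C (X.tK, σ) := if_pos (avoidsK_tK h3)
    have a2 : C' (TetFlag.swapAt 2 3 (X.tK, σ)) = 1 :=
      if_neg (not_avoidsK_tK (by simpa using h2))
    have a3 : C' (X.tK, Equiv.swap 2 3 * σ * Equiv.swap 2 3) = 1 :=
      if_neg (not_avoidsK_tK (by simpa using h2'))
    have a4 : C' (TetFlag.swapAt 2 3 (X.tK, Equiv.swap 2 3 * σ * Equiv.swap 2 3)) =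
        C (X.tK, Equiv.swap 2 3 * σ) := by
      rw [TetFlag.swapAt, mul_assoc _ (Equiv.swap 2 3), Equiv.swap_mul_self, mul_one]
      exact if_pos (avoidsK_tK h3')
    rw [a1, a2, a3, a4, div_one, one_div, inv_mul_eq_one] at h
    exact h.symm
  · intro h
    have := congrArg (fun F : TetFlag T => F.2 3) h
    simp only [Perm.mul_apply, e2] at this
    have h4 : Equiv.swap 2 3 (σ 2) = σ 3 := this.symm
    revert h2 h3 h4
    generalize σ 2 = a
    generalize σ 3 = b
    revert a b
    decide
  · rintro ⟨t, τ⟩ hF ⟨hne1, hne2⟩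
    rw [OrientedTriangulation.mem_evenFlags] at hF
    obtain ⟨hτ, hD⟩ := hF
    change X.edgeEnd (t, τ) = _ at hD
    by_cases ht : t = X.tK
    · subst ht
      rcases perm_cases σ hs h2 h3 τ hτ with h | h | h | h | h | h | h | h
      · exact absurd (by rw [h]) hne1
      · exact absurd (by rw [h]) hne2
      · have a1 : C' (X.tK, τ) = 1 := if_neg (not_avoidsK_tK h.2)
        have a2 : C' (TetFlag.swapAt 2 3 (X.tK, τ)) = 1 :=
          if_neg (not_avoidsK_tK (by simpa using h.1))
        rw [a1, a2, div_one]
      · have a1 : C' (X.tK, τ) = C (X.tK, τ) := if_pos (avoidsK_tK h.2)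
        have a2 : C' (TetFlag.swapAt 2 3 (X.tK, τ)) = C (X.tK, τ * Equiv.swap 2 3) :=
          if_pos (avoidsK_tK (by simpa using h.1))
        rw [a1, a2, hfold τ h.1 h.2, div_self']
      · obtain ⟨b, c, hb, hc, h4, h5⟩ := h
        exact absurd hD.symm (X.edgeEnd_tK_ne hb hc h4 h5)
      · obtain ⟨b, c, hb, hc, h4, h5⟩ := h
        exact absurd hD (X.edgeEnd_tK_ne hb hc h4 h5)
      · have h4 := X.rev_ne (X.edgeEnd (X.tK, σ))
        rw [X.rev_edgeEnd, ← X.edgeEnd_swap] at h4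
        exact absurd (by rw [← hD, h]; rfl) h4
      · have h4 := X.rev_ne (X.edgeEnd (X.tK, Equiv.swap 2 3 * σ))
        rw [X.rev_edgeEnd, X.edgeEnd_fold h2] at h4
        exact absurd (by rw [← hD, h]; rfl) h4
    · have a1 : C' (t, τ) = C (t, τ) := if_pos (avoidsK_of_ne ht)
      have a2 : C' (TetFlag.swapAt 2 3 (t, τ)) = C (TetFlag.swapAt 2 3 (t, τ)) :=
        if_pos (avoidsK_of_ne ht)
      rw [a1, a2, hswap _ ht, div_self']
  · intro h
    exact absurd (OrientedTriangulation.mem_evenFlags.2 ⟨hs, (rfl : X.edgeEnd _ = _)⟩) h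
  · intro h
    refine absurd (OrientedTriangulation.mem_evenFlags.2 ⟨?_, ?_⟩) h
    · simp [sgn, hs]
    · exact (X.edgeEnd_swap (X.tK, Equiv.swap 2 3 * σ)).trans (X.edgeEnd_fold h2)

/-- A function of the directed edges of triangles that only depends on the directed edge outside of
`tK` is compatible with the fold of the distinguished face. -/
lemma apply_fold {A : Type*} [CommGroup A] {C : TetFlag T → A}
    (hglue : ∀ F, X.AvoidsK F → C (X.glue F) = C F)
    (hswap : ∀ F, F.1 ≠ X.tK → C (F.swapAt 2 3) = C F)
    (hfold : ∀ σ : Perm (Fin 4), (σ 2 = 0 ∨ σ 2 = 1) → (σ 3 = 0 ∨ σ 3 = 1) →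
      C (X.tK, σ * Equiv.swap 2 3) = C (X.tK, σ))
    {σ : Perm (Fin 4)} (h2 : σ 2 = 2 ∨ σ 2 = 3) (h3 : σ 3 = 0 ∨ σ 3 = 1) :
    C (X.tK, Equiv.swap 2 3 * σ) = C (X.tK, σ) := by
  by_cases hs : Perm.sign σ = 1
  · exact X.apply_fold_of_sign hglue hswap hfold hs h2 h3
  · have sgn : Perm.sign (Equiv.swap (2 : Fin 4) 3) = -1 := Perm.sign_swap (by decide)
    have := X.apply_fold_of_sign hglue hswap hfold (σ := Equiv.swap 2 3 * σ)
      (by rw [Perm.sign_mul, sgn, (Int.units_eq_one_or _).resolve_left hs]; rfl)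
      (by rcases h2 with h | h <;> simp [h])
      (by rcases h3 with h | h <;> rw [Perm.mul_apply, h] <;> decide)
    rw [← mul_assoc, Equiv.swap_mul_self, one_mul] at this
    exact this.symm

end Fold

end ParticularHTriangulation

/-- The permutation with values `a, b, c` at `0, 1, 2`, for different `a, b, c`. -/
def perm4 (a b c : Fin 4) : Perm (Fin 4) :=
  Equiv.swap 0 a * Equiv.swap 1 (Equiv.swap 0 a b) *
    Equiv.swap 2 (Equiv.swap 1 (Equiv.swap 0 a b) (Equiv.swap 0 a c))

/-- Units attached to the directed edges of the triangles of a tetrahedron, such that reversing the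
edge inverts the unit, and the product around a triangle is `-1`. -/
structure IsTriangleSystem {B : Type*} [CommRing B] (w : Perm (Fin 4) → Bˣ) : Prop where
  reverse : ∀ σ, w (σ * Equiv.swap 0 1) = (w σ)⁻¹
  face : ∀ σ, w (σ * Equiv.swap 0 1 * Equiv.swap 1 2) * (w (σ * Equiv.swap 1 2))⁻¹ * w σ = -1

/-! ### The equations in a single tetrahedron. -/

namespace IsTriangleSystem

variable {B : Type*} [CommRing B] {w : Perm (Fin 4) → Bˣ} (hw : IsTriangleSystem w)

include hw

lemma swap_eq {σ τ ρ : Perm (Fin 4)} (hτ : τ = σ * Equiv.swap 1 2)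
    (hρ : ρ = σ * Equiv.swap 0 1 * Equiv.swap 1 2) : w τ = - (w ρ * w σ) := by
  have h := hw.face σ
  rw [mul_right_comm, mul_inv_eq_iff_eq_mul] at h
  rw [hτ, hρ, h, neg_one_mul, neg_neg]

lemma reverse_eq {σ τ : Perm (Fin 4)} (hτ : τ = σ * Equiv.swap 0 1) : w τ = (w σ)⁻¹ := by
  rw [hτ, hw.reverse]

lemma params : w (perm4 0 2 1) = - (w (perm4 1 2 0) * w (perm4 0 1 2)) ∧
    w (perm4 0 3 2) = - (w (perm4 2 3 0) * w (perm4 0 2 3)) ∧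
    w (perm4 0 1 3) = - (w (perm4 3 1 0) * w (perm4 0 3 1)) ∧
    w (perm4 2 1 0) = (w (perm4 1 2 0))⁻¹ ∧ w (perm4 3 2 0) = (w (perm4 2 3 0))⁻¹ ∧
    w (perm4 1 3 0) = (w (perm4 3 1 0))⁻¹ :=
  ⟨hw.swap_eq (by decide) (by decide), hw.swap_eq (by decide) (by decide),
    hw.swap_eq (by decide) (by decide), hw.reverse_eq (by decide), hw.reverse_eq (by decide),
    hw.reverse_eq (by decide)⟩

/-- The relation between the `u` around a vertex is equivalent to the relation between the products
of the shape parameters at the vertex. -/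
lemma triangle_u_iff :
    w (perm4 2 1 0) * w (perm4 3 2 0) * w (perm4 1 3 0) = 1 ↔
      w (perm4 0 1 3) / w (perm4 0 1 2) * (w (perm4 0 2 1) / w (perm4 0 2 3)) *
        (w (perm4 0 3 2) / w (perm4 0 3 1)) = -1 := by
  obtain ⟨h1, h2, h3, h4, h5, h6⟩ := hw.params
  rw [h1, h2, h3, h4, h5, h6]
  generalize w (perm4 0 1 2) = a
  generalize w (perm4 0 2 3) = b
  generalize w (perm4 0 3 1) = c
  generalize w (perm4 1 2 0) = p
  generalize w (perm4 2 3 0) = q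
  generalize w (perm4 3 1 0) = r
  -- With `p, q, r` the values on the edges 1 → 2, 2 → 3, 3 → 1 of the faces at the vertex 0, both
  -- sides of the equivalence say `p * q * r = 1`.
  have e1 : p⁻¹ * q⁻¹ * r⁻¹ = (p * q * r)⁻¹ := by rw [mul_inv, mul_inv]
  have e2 : -(r * c) / a * (-(p * a) / b) * (-(q * b) / c) = -(p * q * r) := by
    simp only [neg_div, neg_mul, mul_neg, neg_neg, neg_inj]
    rw [div_mul_div_comm, div_mul_div_comm, div_eq_iff_eq_mul]
    ac_rfl
  rw [e1, e2, inv_eq_one, neg_inj]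

/-- The relation between the `v` around a vertex is equivalent to the relation between two
shape parameters at the vertex. -/
lemma triangle_v_iff (hu : w (perm4 2 1 0) * w (perm4 3 2 0) * w (perm4 1 3 0) = 1) :
    (w (perm4 2 1 0) * w (perm4 3 2 0) * w (perm4 0 3 1) + w (perm4 2 1 0) * w (perm4 0 2 3) +
        w (perm4 0 1 2) : B) = 0 ↔
      ((w (perm4 0 2 1) / w (perm4 0 2 3) : Bˣ) : B) -
        (w (perm4 0 1 3) / w (perm4 0 1 2) : Bˣ) * (w (perm4 0 2 1) / w (perm4 0 2 3) : Bˣ) = 1 := by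
  obtain ⟨h1, h2, h3, h4, h5, h6⟩ := hw.params
  rw [h4, h5, h6] at hu
  rw [h1, h3, h4, h5]
  generalize w (perm4 0 1 2) = a at *
  generalize w (perm4 0 2 3) = b at *
  generalize w (perm4 0 3 1) = c at *
  generalize w (perm4 1 2 0) = p at *
  generalize w (perm4 2 3 0) = q at *
  generalize w (perm4 3 1 0) = r at *
  have hr : q⁻¹ = p * r := by
    have : p⁻¹ * q⁻¹ * r⁻¹ = 1 := hu
    rw [mul_inv_eq_one, inv_mul_eq_iff_eq_mul] at this
    exact this
  rw [hr]
  simp only [div_eq_mul_inv, Units.val_mul, Units.val_neg]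
  have ha := a.mul_inv
  have hb := b.mul_inv
  have hp := p.inv_mul
  constructor
  · intro h
    linear_combination (-(p : B) * ↑b⁻¹) * h - (r * c * ↑b⁻¹ * p : B) * ha + hb +
      ((p : B) * r * c * ↑b⁻¹ + ↑b⁻¹ * b) * hp
  · intro h
    linear_combination (-(↑p⁻¹ : B) * b) * h - (↑p⁻¹ * b * r * c * p * ↑b⁻¹ : B) * ha -
      (a * ↑p⁻¹ * p + ↑p⁻¹ * p * r * c  : B) * hb - (a : B) * hp

end IsTriangleSystem

/-! ### Face systems, and the universal one in Kashaev's ring. -/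

namespace ParticularHTriangulation

variable {T : Type*} (X : ParticularHTriangulation T)

/-- The unit-valued solutions of the equations for the `v` of the short edges in the hexagons
that do not contain `K` (with the value `-1` in the others); the `u` are expressed through the `v`
by the hexagonal relations. -/
structure IsFaceSystem {B : Type*} [CommRing B] (V : TetFlag T → Bˣ) : Prop where
  glue : ∀ F, V (X.glue F) = V F
  reverse : ∀ F, V (F.swapAt 0 1) = (V F)⁻¹
  face : ∀ F, V ((F.swapAt 0 1).swapAt 1 2) * (V (F.swapAt 1 2))⁻¹ * V F = -1
  triangle_u : ∀ t, t ≠ X.tK → ∀ σ, V (t, σ * perm4 2 1 0) * V (t, σ * perm4 3 2 0) *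
    V (t, σ * perm4 1 3 0) = 1
  triangle_v : ∀ t, t ≠ X.tK → ∀ σ, (V (t, σ * perm4 2 1 0) * V (t, σ * perm4 3 2 0) *
    V (t, σ * perm4 0 3 1) + V (t, σ * perm4 2 1 0) * V (t, σ * perm4 0 2 3) +
    V (t, σ * perm4 0 1 2) : B) = 0
  fold : ∀ σ : Perm (Fin 4), (σ 2 = 0 ∨ σ 2 = 1) → (σ 3 = 0 ∨ σ 3 = 1) →
    V (X.tK, σ * Equiv.swap 2 3) = V (X.tK, σ)

section KashaevRing

variable (k : Type*) [CommRing k]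

/-- The projection of the free algebra to the abelianization of Kashaev's ring. -/
noncomputable def proj : FreeAlgebra k X.Gen →ₐ[k] X.KashaevRingAb k :=
  (RingQuot.mkAlgHom k (CommRel (X.KashaevRing k))).comp (RingQuot.mkAlgHom k (X.Rel k))

/-- The image of `u e` in the abelianization of Kashaev's ring. -/
noncomputable def uGen (e : X.ShortEdge) : X.KashaevRingAb k := X.proj k (FreeAlgebra.ι k (.u e))

lemma vGen_eq (e : X.ShortEdge) : X.vGen k e = X.proj k (FreeAlgebra.ι k (.v e)) := rfl

variable {X k} in
lemma proj_rel {a b : FreeAlgebra k X.Gen} (h : X.Rel k a b) : X.proj k a = X.proj k b :=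
  congrArg (RingQuot.mkAlgHom k (CommRel (X.KashaevRing k))) (RingQuot.mkAlgHom_rel k h)

lemma proj_surjective : Function.Surjective (X.proj k) :=
  (RingQuot.mkAlgHom_surjective k _).comp (RingQuot.mkAlgHom_surjective k _)

variable {X}

lemma uGen_glue (e e' : X.ShortEdge) (h : e'.1 = X.glue e.1) : X.uGen k e' = X.uGen k e :=
  proj_rel (.glue_u e e' h)

lemma uGen_reverse (e e' : X.ShortEdge) (h : e'.1 = e.1.swapAt 1 2) :
    X.uGen k e' * X.uGen k e = 1 := by
  simpa [uGen] using proj_rel (k := k) (.reverse_u e e' h)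

lemma vGen_reverse (e e' : X.ShortEdge) (h : e'.1 = e.1.swapAt 1 2) :
    X.vGen k e' = -(X.uGen k e' * X.vGen k e) := by
  simpa [uGen, vGen_eq] using proj_rel (k := k) (.reverse_v e e' h)

lemma uGen_hexagon (e e' : X.ShortEdge) (h : e'.1 = e.1.swapAt 0 2) :
    X.uGen k e' = X.vGen k e :=
  proj_rel (.hexagon_u e e' h)

lemma uGen_triangle (e₁ e₂ e₃ : X.ShortEdge) (h₂ : e₂.1 = (e₁.1.swapAt 1 2).swapAt 2 3)
    (h₃ : e₃.1 = (e₂.1.swapAt 1 2).swapAt 2 3) :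
    X.uGen k e₁ * X.uGen k e₂ * X.uGen k e₃ = 1 := by
  simpa [uGen] using proj_rel (k := k) (.triangle_u e₁ e₂ e₃ h₂ h₃)

lemma vGen_triangle (e₁ e₂ e₃ : X.ShortEdge) (h₂ : e₂.1 = (e₁.1.swapAt 1 2).swapAt 2 3)
    (h₃ : e₃.1 = (e₂.1.swapAt 1 2).swapAt 2 3) :
    X.uGen k e₁ * X.uGen k e₂ * X.vGen k e₃ + X.uGen k e₁ * X.vGen k e₂ + X.vGen k e₁ = 0 := by
  simpa [uGen, vGen_eq] using proj_rel (k := k) (.triangle_v e₁ e₂ e₃ h₂ h₃)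

lemma not_meetsK_reverse {F : TetFlag T} (h : ¬ X.MeetsK F) : ¬ X.MeetsK (F.swapAt 1 2) := by
  have h0 : Equiv.swap (1 : Fin 4) 2 0 = 0 := by decide
  simpa [MeetsK, TetFlag.swapAt, h0, or_comm] using h

variable (X) in
/-- The element `u e`, as a unit. -/
noncomputable def uUnit (e : X.ShortEdge) : (X.KashaevRingAb k)ˣ where
  val := X.uGen k e
  inv := X.uGen k ⟨e.1.swapAt 1 2, not_meetsK_reverse e.2⟩
  val_inv := by rw [mul_comm]; exact uGen_reverse k _ _ rfl
  inv_val := uGen_reverse k _ _ rfl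

lemma AvoidsK.swap02 {F : TetFlag T} (h : X.AvoidsK F) : X.AvoidsK (F.swapAt 0 2) :=
  h.swapAt (by decide) (by decide)

open Classical in
variable (X) in
/-- The elements `v e` of Kashaev's ring, for short edges in hexagons that do not contain `K`. -/
noncomputable def vUnit (F : TetFlag T) : (X.KashaevRingAb k)ˣ :=
  -- The default value `-1` satisfies the reversal and face equations, which therefore hold for all
  -- flags.
  if h : X.AvoidsK F then X.uUnit k ⟨F.swapAt 0 2, h.swap02.not_meetsK⟩ else -1

lemma vUnit_of_avoidsK {F : TetFlag T} (h : X.AvoidsK F) :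
    X.vUnit k F = X.uUnit k ⟨F.swapAt 0 2, h.swap02.not_meetsK⟩ := dif_pos h

lemma coe_vUnit {F : TetFlag T} (h : X.AvoidsK F) :
    (X.vUnit k F : X.KashaevRingAb k) = X.vGen k ⟨F, h.not_meetsK⟩ := by
  rw [vUnit_of_avoidsK k h]
  exact uGen_hexagon k _ _ rfl

lemma uUnit_eq {F : TetFlag T} (h : X.AvoidsK F) :
    X.uUnit k ⟨F, h.not_meetsK⟩ = X.vUnit k (F.swapAt 0 2) := by
  rw [vUnit_of_avoidsK k h.swap02]
  congr 2
  exact (TetFlag.swapAt_swapAt _ _ _).symm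

lemma vUnit_of_not_avoidsK {F : TetFlag T} (h : ¬ X.AvoidsK F) : X.vUnit k F = -1 := dif_neg h

lemma vUnit_glue (F : TetFlag T) : X.vUnit k (X.glue F) = X.vUnit k F := by
  by_cases h : X.AvoidsK F
  · rw [vUnit_of_avoidsK k h, vUnit_of_avoidsK k h.glue]
    exact Units.ext (uGen_glue k _ _ (X.glue_swap F (by decide) (by decide)).symm)
  · rw [vUnit_of_not_avoidsK k h, vUnit_of_not_avoidsK k (mt avoidsK_glue_iff.1 h)]

lemma not_avoidsK_swapAt {F : TetFlag T} (h : ¬ X.AvoidsK F) {i j : Fin 4} (hi : i ≠ 3)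
    (hj : j ≠ 3) : ¬ X.AvoidsK (F.swapAt i j) := mt (avoidsK_swapAt_iff hi hj).1 h

/-- The hexagonal move `swapAt 0 2` conjugates the reversal of short edges, `swapAt 1 2`, to the
reversal `swapAt 0 1` of the directed edge, so this is the relation for `u` of a reversed short
edge. -/
lemma vUnit_reverse (F : TetFlag T) : X.vUnit k (F.swapAt 0 1) = (X.vUnit k F)⁻¹ := by
  by_cases h : X.AvoidsK F
  · rw [← mul_eq_one_iff_eq_inv, vUnit_of_avoidsK k h,
      vUnit_of_avoidsK k (h.swapAt (by decide) (by decide))]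
    refine Units.ext (uGen_reverse k _ _ ?_)
    simp only [TetFlag.swapAt, mul_assoc]
    congr 2
    decide
  · rw [vUnit_of_not_avoidsK k h, vUnit_of_not_avoidsK k
      (not_avoidsK_swapAt h (by decide) (by decide)), inv_neg, inv_one]

/-- This is the relation for `v` of a reversed short edge, with its `u` rewritten as a `v` by the
hexagonal relation. -/
lemma vUnit_face (F : TetFlag T) :
    X.vUnit k ((F.swapAt 0 1).swapAt 1 2) * (X.vUnit k (F.swapAt 1 2))⁻¹ * X.vUnit k F = -1 := by
  by_cases h : X.AvoidsK F
  · have h12 : X.AvoidsK (F.swapAt 1 2) := h.swapAt (by decide) (by decide)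
    have h1 := vGen_reverse k ⟨F, h.not_meetsK⟩ ⟨F.swapAt 1 2, h12.not_meetsK⟩ rfl
    have h2 : (F.swapAt 1 2).swapAt 0 2 = (F.swapAt 0 1).swapAt 1 2 := by
      simp only [TetFlag.swapAt, mul_assoc]
      congr 2
      decide
    have h3 : X.vUnit k (F.swapAt 1 2) =
        - (X.vUnit k ((F.swapAt 0 1).swapAt 1 2) * X.vUnit k F) := by
      rw [← h2, ← uUnit_eq k h12]
      ext
      rw [coe_vUnit k h12, h1, Units.val_neg, Units.val_mul, coe_vUnit k h]
      rfl
    rw [h3, mul_right_comm, mul_inv_eq_iff_eq_mul, neg_mul_neg, one_mul]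
  · have n12 := not_avoidsK_swapAt h (show (1 : Fin 4) ≠ 3 by decide) (show (2 : Fin 4) ≠ 3 by decide)
    have n01 := not_avoidsK_swapAt (not_avoidsK_swapAt h (show (0 : Fin 4) ≠ 3 by decide)
      (show (1 : Fin 4) ≠ 3 by decide)) (show (1 : Fin 4) ≠ 3 by decide)
      (show (2 : Fin 4) ≠ 3 by decide)
    rw [vUnit_of_not_avoidsK k h, vUnit_of_not_avoidsK k n12, vUnit_of_not_avoidsK k n01,
      inv_neg, inv_one, neg_mul_neg, one_mul, one_mul]

variable {k} in
lemma _root_.IsTriangleSystem.of_flags {B : Type*} [CommRing B] {V : TetFlag T → Bˣ}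
    (hr : ∀ F, V (F.swapAt 0 1) = (V F)⁻¹)
    (hf : ∀ F, V ((F.swapAt 0 1).swapAt 1 2) * (V (F.swapAt 1 2))⁻¹ * V F = -1) (t : T)
    (σ : Perm (Fin 4)) : IsTriangleSystem fun π => V (t, σ * π) where
  reverse π := by
    rw [← mul_assoc]
    exact hr (t, σ * π)
  face π := by
    rw [← mul_assoc, ← mul_assoc, ← mul_assoc]
    exact hf (t, σ * π)

/-- In the ring of Kashaev, the short edge opposite to `K` is a product of other ones. -/
lemma uUnit_opposite {σ : Perm (Fin 4)} (h2 : σ 2 = 0 ∨ σ 2 = 1) (h3 : σ 3 = 0 ∨ σ 3 = 1)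
    (h : ¬ X.MeetsK (X.tK, σ * perm4 0 2 3)) :
    X.uUnit k ⟨(X.tK, σ * perm4 0 2 3), h⟩ * X.vUnit k (X.tK, σ * perm4 1 3 0) *
      X.vUnit k (X.tK, σ * perm4 2 1 0) = 1 := by
  have a2 : X.AvoidsK (X.tK, σ * perm4 0 3 1) := avoidsK_tK h2
  have a3 : X.AvoidsK (X.tK, σ * perm4 0 1 2) := avoidsK_tK h3
  have e2 : TetFlag.swapAt 0 2 (X.tK, σ * perm4 0 3 1) = (X.tK, σ * perm4 1 3 0) := by
    simp only [TetFlag.swapAt, mul_assoc]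
    congr 2
    decide
  have e3 : TetFlag.swapAt 0 2 (X.tK, σ * perm4 0 1 2) = (X.tK, σ * perm4 2 1 0) := by
    simp only [TetFlag.swapAt, mul_assoc]
    congr 2
    decide
  rw [← e2, ← e3, ← uUnit_eq k a2, ← uUnit_eq k a3]
  refine Units.ext (uGen_triangle k _ _ _ ?_ ?_)
  · simp only [TetFlag.swapAt, mul_assoc]
    congr 2
    decide
  · simp only [TetFlag.swapAt, mul_assoc]
    congr 2
    decide

lemma not_meetsK_opposite {σ : Perm (Fin 4)} (h2 : σ 2 = 0 ∨ σ 2 = 1) (h3 : σ 3 = 0 ∨ σ 3 = 1) :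
    ¬ X.MeetsK (X.tK, σ * perm4 0 2 3) := by
  rintro ⟨-, h⟩
  have key : ∀ σ : Perm (Fin 4), (σ 2 = 0 ∨ σ 2 = 1) → (σ 3 = 0 ∨ σ 3 = 1) →
    ¬ (s((σ * perm4 0 2 3) 0, (σ * perm4 0 2 3) 1) = s(0, 1) ∨
      s((σ * perm4 0 2 3) 0, (σ * perm4 0 2 3) 2) = s(0, 1)) := by decide
  exact key σ h2 h3 h

lemma glue_opposite {σ : Perm (Fin 4)} (h2 : σ 2 = 0 ∨ σ 2 = 1) (h3 : σ 3 = 0 ∨ σ 3 = 1) :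
    X.glue (X.tK, σ * perm4 0 2 3) = (X.tK, σ * perm4 1 2 3) := by
  have key : ∀ σ : Perm (Fin 4), (σ 2 = 0 ∨ σ 2 = 1) → (σ 3 = 0 ∨ σ 3 = 1) →
    ((σ * perm4 0 2 3) 3 = 2 ∨ (σ * perm4 0 2 3) 3 = 3) ∧
      Equiv.swap 2 3 * (σ * perm4 0 2 3) = σ * perm4 1 2 3 := by decide
  rw [X.glue_tK (key σ h2 h3).1, (key σ h2 h3).2]

/-- The short edge opposite to `K` in the face 012 is glued to the one in the face 013. The
triangular relations at the vertices 2 and 3 give two expressions for its `u` (`uUnit_opposite`),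
and comparing them yields the equation. -/
lemma vUnit_fold {σ : Perm (Fin 4)} (h2 : σ 2 = 0 ∨ σ 2 = 1) (h3 : σ 3 = 0 ∨ σ 3 = 1) :
    X.vUnit k (X.tK, σ * Equiv.swap 2 3) = X.vUnit k (X.tK, σ) := by
  have s2 : (σ * Equiv.swap 0 1 : Perm (Fin 4)) 2 = 0 ∨ (σ * Equiv.swap 0 1 : Perm (Fin 4)) 2 = 1 :=
    h2
  have s3 : (σ * Equiv.swap 0 1 : Perm (Fin 4)) 3 = 0 ∨ (σ * Equiv.swap 0 1 : Perm (Fin 4)) 3 = 1 :=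
    h3
  have h1 := uUnit_opposite (X := X) k h2 h3 (not_meetsK_opposite h2 h3)
  have h1' := uUnit_opposite (X := X) k s2 s3 (not_meetsK_opposite s2 s3)
  have hg : X.uUnit k ⟨_, not_meetsK_opposite s2 s3⟩ =
      X.uUnit k ⟨_, not_meetsK_opposite (X := X) h2 h3⟩ := by
    refine Units.ext (uGen_glue k _ _ ?_)
    simp only [glue_opposite h2 h3, mul_assoc]
    congr 2
    decide
  have hw := IsTriangleSystem.of_flags (vUnit_reverse (X := X) k) (vUnit_face k) X.tK σ
  have e1 := hw.swap_eq (σ := perm4 0 1 2) (τ := perm4 0 2 1) (ρ := perm4 1 2 0) (by decide)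
    (by decide)
  have e2 := hw.swap_eq (σ := perm4 0 3 1) (τ := perm4 0 1 3) (ρ := perm4 3 1 0) (by decide)
    (by decide)
  have e3 := hw.reverse_eq (σ := perm4 0 2 1) (τ := perm4 2 0 1) (by decide)
  have e4 := hw.reverse_eq (σ := perm4 1 2 0) (τ := perm4 2 1 0) (by decide)
  have e5 := hw.reverse_eq (σ := perm4 3 1 0) (τ := perm4 1 3 0) (by decide)
  have m (π ρ : Perm (Fin 4)) (h : Equiv.swap 0 1 * π = ρ) :
      X.vUnit k (X.tK, σ * Equiv.swap 0 1 * π) = X.vUnit k (X.tK, σ * ρ) := by rw [mul_assoc, h]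
  rw [hg, m _ (perm4 0 3 1) (by decide), m _ (perm4 2 0 1) (by decide), ← h1, mul_assoc, mul_assoc,
    mul_right_inj] at h1'
  rw [show Equiv.swap 2 3 = perm4 0 1 3 by decide, e2]
  rw [e3, e1, e4, e5, mul_inv_eq_iff_eq_mul] at h1'
  rw [show X.vUnit k (X.tK, σ) = X.vUnit k (X.tK, σ * perm4 0 1 2) by
    rw [show perm4 0 1 2 = 1 by decide, mul_one]]
  rw [h1']
  generalize X.vUnit k (X.tK, σ * perm4 0 1 2) = a
  generalize X.vUnit k (X.tK, σ * perm4 3 1 0) = r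
  generalize X.vUnit k (X.tK, σ * perm4 1 2 0) = p
  simp only [mul_neg, neg_neg, mul_assoc, mul_inv_cancel_left, inv_mul_cancel_left]

lemma coe_vUnit_swap {t : T} {σ τ : Perm (Fin 4)} (h : X.AvoidsK (t, σ))
    (hτ : τ = σ * Equiv.swap 0 2) :
    (X.vUnit k (t, τ) : X.KashaevRingAb k) = X.uGen k ⟨(t, σ), h.not_meetsK⟩ := by
  subst hτ
  exact congrArg Units.val (uUnit_eq k h).symm

variable (X) in
/-- The elements `v e` of Kashaev's ring form a face system. -/
lemma isFaceSystem_vUnit : X.IsFaceSystem (X.vUnit k) where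
  glue := vUnit_glue k
  reverse := vUnit_reverse k
  face := vUnit_face k
  fold _ := vUnit_fold k
  triangle_u t ht σ := by
    have ha (π : Perm (Fin 4)) : X.AvoidsK (t, π) := avoidsK_of_ne ht
    ext
    push_cast
    rw [coe_vUnit_swap k (ha (σ * perm4 0 1 2)) (by rw [mul_assoc]; congr 1; decide),
      coe_vUnit_swap k (ha (σ * perm4 0 2 3)) (by rw [mul_assoc]; congr 1; decide),
      coe_vUnit_swap k (ha (σ * perm4 0 3 1)) (by rw [mul_assoc]; congr 1; decide)]
    apply uGen_triangle
    · simp only [TetFlag.swapAt, mul_assoc]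
      congr 2
      decide
    · simp only [TetFlag.swapAt, mul_assoc]
      congr 2
      decide
  triangle_v t ht σ := by
    have ha (π : Perm (Fin 4)) : X.AvoidsK (t, π) := avoidsK_of_ne ht
    rw [coe_vUnit_swap k (ha (σ * perm4 0 1 2)) (by rw [mul_assoc]; congr 1; decide),
      coe_vUnit_swap k (ha (σ * perm4 0 2 3)) (by rw [mul_assoc]; congr 1; decide),
      coe_vUnit k (ha _), coe_vUnit k (ha _), coe_vUnit k (ha _)]
    apply vGen_triangle
    · simp only [TetFlag.swapAt, mul_assoc]
      congr 2
      decide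
    · simp only [TetFlag.swapAt, mul_assoc]
      congr 2
      decide

end KashaevRing

end ParticularHTriangulation

/-! ### Products of shape parameters around the edges of the collapsed triangulation. -/

namespace ParticularHTriangulation

variable {T : Type*} {X : ParticularHTriangulation T}

variable (X) in
/-- A flag of the collapsed triangulation, as a flag of the H-triangulation. -/
def lift (F : TetFlag {t : T // t ≠ X.tK}) : TetFlag T := (F.1.1, F.2)

lemma lift_swapAt (F : TetFlag {t : T // t ≠ X.tK}) (i j : Fin 4) :
    X.lift (F.swapAt i j) = (X.lift F).swapAt i j := rfl

variable (X) in
/-- The flags in a set of flags of the collapsed triangulation, together with the flags of `tK` which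
are glued to them. -/
def extend (N : Set (TetFlag {t : T // t ≠ X.tK})) : Set (TetFlag T) :=
  {F | F ∈ X.lift '' N ∨ F.1 = X.tK ∧ X.glue F ∈ X.lift '' N}

lemma lift_injective : Function.Injective X.lift := fun _ _ h =>
  Prod.ext (Subtype.ext (congrArg (fun F => F.1) h)) (congrArg (fun F : TetFlag T => F.2) h)

lemma mem_lift_image {N : Set (TetFlag {t : T // t ≠ X.tK})} {F : TetFlag {t : T // t ≠ X.tK}} :
    X.lift F ∈ X.lift '' N ↔ F ∈ N := lift_injective.mem_set_image

lemma ne_of_mem_lift_image {N : Set (TetFlag {t : T // t ≠ X.tK})} {F : TetFlag T}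
    (h : F ∈ X.lift '' N) : F.1 ≠ X.tK := by
  obtain ⟨G, -, rfl⟩ := h
  exact G.1.2

lemma exists_lift {F : TetFlag T} (h : F.1 ≠ X.tK) : ∃ G, X.lift G = F := ⟨(⟨F.1, h⟩, F.2), rfl⟩

lemma lift_mem_extend {N : Set (TetFlag {t : T // t ≠ X.tK})} {F : TetFlag {t : T // t ≠ X.tK}} :
    X.lift F ∈ X.extend N ↔ F ∈ N := by
  simp only [extend, Set.mem_ofPred_eq, mem_lift_image, or_iff_left_iff_imp]
  exact fun h => absurd h.1 F.1.2

lemma tK_mem_extend {N : Set (TetFlag {t : T // t ≠ X.tK})} {σ : Perm (Fin 4)} :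
    (X.tK, σ) ∈ X.extend N ↔ X.glue (X.tK, σ) ∈ X.lift '' N := by
  simp only [extend, Set.mem_ofPred_eq, true_and, or_iff_right_iff_imp]
  exact fun h => absurd rfl (ne_of_mem_lift_image h)

lemma tK_not_mem_extend {N : Set (TetFlag {t : T // t ≠ X.tK})} {σ : Perm (Fin 4)}
    (h : σ 3 = 2 ∨ σ 3 = 3) : (X.tK, σ) ∉ X.extend N := by
  rw [tK_mem_extend, X.glue_tK h]
  exact fun h => ne_of_mem_lift_image h rfl

section Collapse

variable [DecidableEq T]

lemma collapse_glue_of_ne (F : TetFlag {t : T // t ≠ X.tK}) (h : (X.glue (X.lift F)).1 ≠ X.tK) :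
    X.lift (X.collapse.glue F) = X.glue (X.lift F) := by
  change X.adj F.1 (F.2 3) ≠ X.tK at h
  simp only [lift, OrientedTriangulation.glue, collapse, collapseAdj, collapsePerm, if_neg h]

lemma collapse_glue_of_eq (F : TetFlag {t : T // t ≠ X.tK}) {σ : Perm (Fin 4)}
    (h : X.glue (X.lift F) = (X.tK, σ)) :
    X.lift (X.collapse.glue F) = X.glue (X.tK, Equiv.swap 0 1 * σ) := by
  have h1 : X.adj F.1 (F.2 3) = X.tK := congrArg Prod.fst h
  have h2 : X.perm F.1 (F.2 3) * F.2 = σ := congrArg Prod.snd h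
  subst h2
  simp only [lift, OrientedTriangulation.glue, collapse, collapseAdj, collapsePerm, if_pos h1,
    Perm.coe_mul, Function.comp_apply, mul_assoc]

lemma AvoidsK.collapse_glue {σ : Perm (Fin 4)} (h : X.AvoidsK (X.tK, σ)) :
    X.lift (X.collapse.glue (⟨(X.glue (X.tK, σ)).1, h.glue_ne rfl⟩, (X.glue (X.tK, σ)).2)) =
      X.glue (X.tK, Equiv.swap 0 1 * σ) :=
  collapse_glue_of_eq _ (X.glue_glue _)

variable {N : Set (TetFlag {t : T // t ≠ X.tK})} (hN : X.collapse.EdgeClosed N)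

include hN

lemma glue_mem_extend_iff (F : TetFlag T) : X.glue F ∈ X.extend N ↔ F ∈ X.extend N := by
  have key (F : TetFlag T) (h : F ∈ X.extend N) : X.glue F ∈ X.extend N := by
    by_cases hF : F.1 = X.tK
    · rcases h with h | h
      · exact absurd hF (ne_of_mem_lift_image h)
      · exact Or.inl h.2
    · obtain ⟨F, rfl⟩ := exists_lift hF
      by_cases hg : (X.glue (X.lift F)).1 = X.tK
      · refine Or.inr ⟨hg, ?_⟩
        rw [X.glue_glue, mem_lift_image, ← lift_mem_extend]
        exact h
      · rw [← collapse_glue_of_ne F hg, lift_mem_extend]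
        exact hN.glue _ (lift_mem_extend.1 h)
  exact ⟨fun h => by simpa [X.glue_glue] using key _ h, key F⟩

lemma swapAt_mem_extend_iff {F : TetFlag T} (hF : F.1 ≠ X.tK) :
    F.swapAt 2 3 ∈ X.extend N ↔ F ∈ X.extend N := by
  obtain ⟨F, rfl⟩ := exists_lift hF
  rw [← lift_swapAt, lift_mem_extend, lift_mem_extend, hN.swap_iff]

/-- Passing through `tK` by the exchange of 0 and 1 is a gluing of the collapsed triangulation. -/
lemma jump_mem_extend_iff {σ : Perm (Fin 4)} (h : σ 3 = 0 ∨ σ 3 = 1) :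
    (X.tK, Equiv.swap 0 1 * σ) ∈ X.extend N ↔ (X.tK, σ) ∈ X.extend N := by
  have ha : X.AvoidsK (X.tK, σ) := avoidsK_tK h
  have h1 := ha.collapse_glue
  rw [← glue_mem_extend_iff hN, ← h1, lift_mem_extend, hN.glue_iff, ← lift_mem_extend,
    ← glue_mem_extend_iff hN (X.tK, σ)]
  rfl

omit hN in
lemma swap_zero_one_mul : ∀ σ : Perm (Fin 4), (σ 2 = 0 ∨ σ 2 = 1) → (σ 3 = 0 ∨ σ 3 = 1) →
    Equiv.swap 0 1 * σ = σ * Equiv.swap 2 3 := by decide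

/-- Apply `apply_fold` to the indicator function of `extend N`, with values in an infinite cyclic
group. -/
lemma fold_mem_extend_iff [Fintype T] {σ : Perm (Fin 4)} (h2 : σ 2 = 2 ∨ σ 2 = 3)
    (h3 : σ 3 = 0 ∨ σ 3 = 1) :
    (X.tK, Equiv.swap 2 3 * σ) ∈ X.extend N ↔ (X.tK, σ) ∈ X.extend N := by
  classical
  have h := X.apply_fold (C := fun F => if F ∈ X.extend N then Multiplicative.ofAdd (1 : ℤ) else 1)
    (fun F _ => by simp only [glue_mem_extend_iff hN])
    (fun F hF => by simp only [swapAt_mem_extend_iff hN hF])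
    (fun σ h2 h3 => by simp only [← swap_zero_one_mul σ h2 h3, jump_mem_extend_iff hN h3]) h2 h3
  have hne : Multiplicative.ofAdd (1 : ℤ) ≠ 1 := by decide
  by_cases h4 : (X.tK, Equiv.swap 2 3 * σ) ∈ X.extend N <;>
    by_cases h5 : (X.tK, σ) ∈ X.extend N <;> simp_all

end Collapse

lemma filter_even : (Finset.univ.filter fun σ : Perm (Fin 4) => Perm.sign σ = 1) =
    {perm4 2 3 0, perm4 3 2 1, perm4 0 1 2, perm4 1 0 3, perm4 0 2 3, perm4 0 3 1, perm4 1 2 0,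
      perm4 1 3 2, perm4 2 0 1, perm4 3 0 2, perm4 2 1 3, perm4 3 1 0} := by
  decide

namespace IsFaceSystem

variable {B : Type*} [CommRing B] {V : TetFlag T → Bˣ} (hV : X.IsFaceSystem V)

include hV

lemma triangleSystem (t : T) (σ : Perm (Fin 4)) : IsTriangleSystem fun π => V (t, σ * π) :=
  .of_flags hV.reverse hV.face t σ

lemma triangleSystem_one (t : T) : IsTriangleSystem fun π => V (t, π) := by
  simpa using hV.triangleSystem t 1

/-- The face equations of 023 and 123 reduce this to the equality of the values on 2 → 3 in these
faces, which is the fold equation. -/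
lemma mul_eq_mul : V (X.tK, perm4 0 3 2) * V (X.tK, perm4 1 2 3) =
    V (X.tK, perm4 0 2 3) * V (X.tK, perm4 1 3 2) := by
  have hw := hV.triangleSystem_one X.tK
  have h1 := hw.swap_eq (σ := perm4 0 2 3) (τ := perm4 0 3 2) (ρ := perm4 2 3 0) (by decide)
    (by decide)
  have h2 := hw.swap_eq (σ := perm4 1 2 3) (τ := perm4 1 3 2) (ρ := perm4 2 3 1) (by decide)
    (by decide)
  have h3 := hV.fold (perm4 2 3 0) (by decide) (by decide)
  rw [show perm4 2 3 0 * Equiv.swap 2 3 = perm4 2 3 1 by decide] at h3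
  rw [h1, h2, h3]
  simp only [neg_mul, mul_neg, mul_assoc, mul_left_comm]

lemma mul_eq_mul' : V (X.tK, perm4 3 0 2) * V (X.tK, perm4 2 1 3) =
    V (X.tK, perm4 2 0 3) * V (X.tK, perm4 3 1 2) := by
  have hw := hV.triangleSystem_one X.tK
  rw [hw.reverse_eq (σ := perm4 0 3 2) (τ := perm4 3 0 2) (by decide),
    hw.reverse_eq (σ := perm4 1 2 3) (τ := perm4 2 1 3) (by decide),
    hw.reverse_eq (σ := perm4 0 2 3) (τ := perm4 2 0 3) (by decide),
    hw.reverse_eq (σ := perm4 1 3 2) (τ := perm4 3 1 2) (by decide), ← mul_inv, ← mul_inv,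
    hV.mul_eq_mul]

variable [Fintype T] [DecidableEq T]

/-- The product of the shape parameters around an edge. -/
lemma prod_lift {N : Set (TetFlag {t : T // t ≠ X.tK})} (hN : X.collapse.EdgeClosed N) :
    ∏ F ∈ OrientedTriangulation.evenFlags N,
      V (X.lift (F.swapAt 2 3)) / V (X.lift F) = 1 := by
  classical
  -- `V` is cut off outside `extend N` in a way compatible with gluing, so its changes over all even
  -- flags multiply to 1. It remains to see that `tK` contributes 1.
  let C : TetFlag T → Bˣ := fun F => if F ∈ X.extend N then V F else 1
  have hC (F) : C (X.glue F) = C F := by simp only [C, glue_mem_extend_iff hN, hV.glue]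
  have h := OrientedTriangulation.prod_swap_div X.edgeClosed_univ hC
  rw [OrientedTriangulation.evenFlags,
    ← Finset.prod_filter_mul_prod_filter_not _ (fun F : TetFlag T => F.1 = X.tK),
    Finset.filter_filter, Finset.filter_filter] at h
  have e1 : ∏ F : TetFlag T with (Perm.sign F.2 = 1 ∧ F ∈ Set.univ) ∧ ¬ F.1 = X.tK,
      C (F.swapAt 2 3) / C F = ∏ F ∈ OrientedTriangulation.evenFlags N,
      V (X.lift (F.swapAt 2 3)) / V (X.lift F) := by
    symm
    refine Finset.prod_of_injOn X.lift lift_injective.injOn ?_ ?_ ?_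
    · intro F hF
      have := OrientedTriangulation.mem_evenFlags.1 hF
      simp only [Finset.coe_filter, Finset.mem_univ, Set.mem_univ, true_and, and_true,
        Set.mem_ofPred_eq]
      exact ⟨this.1, F.1.2⟩
    · intro F hF hF'
      simp only [Finset.mem_filter, Finset.mem_univ, Set.mem_univ, true_and, and_true] at hF
      obtain ⟨G, rfl⟩ := exists_lift hF.2
      have hG : G ∉ N := fun hG => hF' ⟨G, OrientedTriangulation.mem_evenFlags.2 ⟨hF.1, hG⟩, rfl⟩
      simp only [C, swapAt_mem_extend_iff hN hF.2, lift_mem_extend, if_neg hG, div_one]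
    · intro F hF
      have := (OrientedTriangulation.mem_evenFlags.1 hF).2
      simp only [C, lift_mem_extend, ← lift_swapAt, hN.swap_iff, if_pos this]
  have e2 : ∏ F : TetFlag T with (Perm.sign F.2 = 1 ∧ F ∈ Set.univ) ∧ F.1 = X.tK,
      C (F.swapAt 2 3) / C F =
      ∏ σ : Perm (Fin 4) with Perm.sign σ = 1, C (X.tK, σ * Equiv.swap 2 3) / C (X.tK, σ) := by
    symm
    refine Finset.prod_of_injOn (fun σ => (X.tK, σ)) (fun σ _ τ _ h => congrArg Prod.snd h) ?_ ?_ ?_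
    · intro σ hσ
      simpa using hσ
    · rintro ⟨t, σ⟩ hF hF'
      simp only [Finset.mem_filter, Finset.mem_univ, Set.mem_univ, true_and, and_true] at hF
      obtain ⟨hσ, rfl⟩ := hF
      exact absurd ⟨σ, by simpa using hσ, rfl⟩ hF'
    · intro σ _
      rfl
  -- The edge 23 contributes 1 by the fold equation, and `K` because no triangle at `K` belongs to
  -- `extend N`. The other four edges are all in or all out of `extend N`, separately for each
  -- direction, and cancel by `mul_eq_mul` and `mul_eq_mul'`.
  have e3 : ∏ σ : Perm (Fin 4) with Perm.sign σ = 1,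
      C (X.tK, σ * Equiv.swap 2 3) / C (X.tK, σ) = 1 := by
    have bad {σ : Perm (Fin 4)} (h : σ 3 = 2 ∨ σ 3 = 3) : C (X.tK, σ) = 1 :=
      if_neg (tK_not_mem_extend h)
    have edge {σ τ : Perm (Fin 4)} (h2 : σ 2 = 0 ∨ σ 2 = 1) (h3 : σ 3 = 0 ∨ σ 3 = 1)
        (h : τ = σ * Equiv.swap 2 3) : C (X.tK, τ) = C (X.tK, σ) := by
      subst h
      have hm : (X.tK, σ * Equiv.swap 2 3) ∈ X.extend N ↔ (X.tK, σ) ∈ X.extend N := by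
        rw [← swap_zero_one_mul σ h2 h3, jump_mem_extend_iff hN h3]
      simp only [C, hm, hV.fold σ h2 h3]
    have jump {σ τ : Perm (Fin 4)} (h3 : σ 3 = 0 ∨ σ 3 = 1) (hτ : τ = Equiv.swap 0 1 * σ) :
        (X.tK, τ) ∈ X.extend N ↔ (X.tK, σ) ∈ X.extend N := by
      rw [hτ, jump_mem_extend_iff hN h3]
    have fold {σ τ : Perm (Fin 4)} (h2 : σ 2 = 2 ∨ σ 2 = 3) (h3 : σ 3 = 0 ∨ σ 3 = 1)
        (hτ : τ = Equiv.swap 2 3 * σ) : (X.tK, τ) ∈ X.extend N ↔ (X.tK, σ) ∈ X.extend N := by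
      rw [hτ, fold_mem_extend_iff hN h2 h3]
    have m1 : (X.tK, perm4 0 3 2) ∈ X.extend N ↔ (X.tK, perm4 0 2 3) ∈ X.extend N :=
      fold (σ := perm4 0 2 3) (by decide) (by decide) (by decide)
    have m2 : (X.tK, perm4 1 2 3) ∈ X.extend N ↔ (X.tK, perm4 0 2 3) ∈ X.extend N :=
      jump (σ := perm4 0 2 3) (by decide) (by decide)
    have m3 : (X.tK, perm4 1 3 2) ∈ X.extend N ↔ (X.tK, perm4 0 2 3) ∈ X.extend N :=
      (jump (σ := perm4 0 3 2) (by decide) (by decide)).trans m1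
    have m4 : (X.tK, perm4 3 0 2) ∈ X.extend N ↔ (X.tK, perm4 2 0 3) ∈ X.extend N :=
      fold (σ := perm4 2 0 3) (by decide) (by decide) (by decide)
    have m5 : (X.tK, perm4 2 1 3) ∈ X.extend N ↔ (X.tK, perm4 2 0 3) ∈ X.extend N :=
      jump (σ := perm4 2 0 3) (by decide) (by decide)
    have m6 : (X.tK, perm4 3 1 2) ∈ X.extend N ↔ (X.tK, perm4 2 0 3) ∈ X.extend N :=
      (jump (σ := perm4 3 0 2) (by decide) (by decide)).trans m4
    have p1 : C (X.tK, perm4 0 3 2) * C (X.tK, perm4 1 2 3) =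
        C (X.tK, perm4 0 2 3) * C (X.tK, perm4 1 3 2) := by
      simp only [C, m1, m2, m3]
      split_ifs
      · exact hV.mul_eq_mul
      · rfl
    have p2 : C (X.tK, perm4 3 0 2) * C (X.tK, perm4 2 1 3) =
        C (X.tK, perm4 2 0 3) * C (X.tK, perm4 3 1 2) := by
      simp only [C, m4, m5, m6]
      split_ifs
      · exact hV.mul_eq_mul'
      · rfl
    rw [filter_even]
    repeat rw [Finset.prod_insert (by decide)]
    rw [Finset.prod_singleton,
      edge (σ := perm4 2 3 0) (τ := perm4 2 3 0 * Equiv.swap 2 3) (by decide) (by decide) rfl,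
      edge (σ := perm4 3 2 1) (τ := perm4 3 2 1 * Equiv.swap 2 3) (by decide) (by decide) rfl,
      bad (σ := perm4 0 1 2) (by decide), bad (σ := perm4 0 1 2 * Equiv.swap 2 3) (by decide),
      bad (σ := perm4 1 0 3) (by decide), bad (σ := perm4 1 0 3 * Equiv.swap 2 3) (by decide),
      bad (σ := perm4 0 2 3 * Equiv.swap 2 3) (by decide),
      bad (σ := perm4 0 3 1) (by decide), bad (σ := perm4 1 2 0) (by decide),
      bad (σ := perm4 1 3 2 * Equiv.swap 2 3) (by decide),
      bad (σ := perm4 2 0 1) (by decide), bad (σ := perm4 3 0 2 * Equiv.swap 2 3) (by decide),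
      bad (σ := perm4 2 1 3 * Equiv.swap 2 3) (by decide), bad (σ := perm4 3 1 0) (by decide),
      show perm4 0 3 1 * Equiv.swap 2 3 = perm4 0 3 2 by decide,
      show perm4 1 2 0 * Equiv.swap 2 3 = perm4 1 2 3 by decide,
      show perm4 2 0 1 * Equiv.swap 2 3 = perm4 2 0 3 by decide,
      show perm4 3 1 0 * Equiv.swap 2 3 = perm4 3 1 2 by decide]
    simp only [div_self', div_one, one_mul, one_div]
    rw [← eq_mul_inv_iff_mul_eq] at p1 p2
    rw [p1, p2]
    generalize C (X.tK, perm4 0 2 3) = a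
    generalize C (X.tK, perm4 1 2 3) = b
    generalize C (X.tK, perm4 1 3 2) = c
    generalize C (X.tK, perm4 2 0 3) = d
    generalize C (X.tK, perm4 2 1 3) = e
    generalize C (X.tK, perm4 3 1 2) = f
    simp only [mul_inv, inv_inv]
    have : a⁻¹ * (a * c * b⁻¹ * (b * (c⁻¹ * (d * (d⁻¹ * f⁻¹ * e * (e⁻¹ * f)))))) =
      (a⁻¹ * a) * (c⁻¹ * c) * (b⁻¹ * b) * (d⁻¹ * d) * (f⁻¹ * f) * (e⁻¹ * e) := by ac_rfl
    rw [this]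
    simp
  rw [← e1, ← h, eq_comm]
  convert one_mul _
  convert e2.trans e3

end IsFaceSystem

end ParticularHTriangulation

namespace ParticularHTriangulation.IsFaceSystem

variable {T : Type*} {X : ParticularHTriangulation T} {B : Type*} [CommRing B]
  {V : TetFlag T → Bˣ} (k : Type*) [CommRing k] [Algebra k B]

/-! ### From face systems to points of the deformation variety -/

section Shape

variable (V) in
/-- The shape parameter of an edge, defined by a face system. -/
noncomputable def shapeUnit (i : {t : T // t ≠ X.tK} × TetEdge) : Bˣ :=
  V (X.lift ((TetFlag.exists_even_edge i).choose.swapAt 2 3)) /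
    V (X.lift (TetFlag.exists_even_edge i).choose)

variable (hV : X.IsFaceSystem V)

include hV

/-- The two even flags over an edge differ by the half turn, which inverts the two values and
exchanges them; the quotient is independent of the choice. -/
lemma shapeUnit_edge {F : TetFlag {t : T // t ≠ X.tK}} (hF : Perm.sign F.2 = 1) :
    shapeUnit V F.edge = V (X.lift (F.swapAt 2 3)) / V (X.lift F) := by
  have h := (TetFlag.exists_even_edge F.edge).choose_spec
  rw [shapeUnit]
  rcases TetFlag.eq_of_edge_eq h.1 hF h.2 with h | h
  · rw [h]
  · rw [h, TetFlag.swapAt_comm, TetFlag.swapAt_swapAt]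
    simp only [lift_swapAt, hV.reverse]
    rw [inv_div_inv]

variable [Fintype T] [DecidableEq T]

/-- The point of the deformation variety defined by a face system. -/
noncomputable def shapeHom : X.collapse.DeformationRing k →ₐ[k] B :=
  Ideal.Quotient.liftₐ _ (MvPolynomial.aeval fun i => (shapeUnit V i : B)) (by
    suffices h : ∀ p ∈ X.collapse.shapeEquations k,
        MvPolynomial.aeval (fun i => (shapeUnit V i : B)) p = 0 by
      have h1 : Ideal.span (X.collapse.shapeEquations k) ≤
          RingHom.ker (MvPolynomial.aeval (R := k) fun i => (shapeUnit V i : B)) :=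
        Ideal.span_le.2 h
      exact fun p hp => h1 hp
    rintro p (⟨F, hF, h⟩ | ⟨E, rfl⟩)
    · obtain ⟨⟨t, ht⟩, σ⟩ := F
      have hw := hV.triangleSystem t σ
      have hu := hV.triangle_u t ht σ
      have hv := hV.triangle_v t ht σ
      have e (π : Perm (Fin 4)) (hπ : Perm.sign π = 1) :
          shapeUnit V (TetFlag.edge ((⟨t, ht⟩ : {t : T // t ≠ X.tK}), σ * π)) =
            V (t, σ * (π * Equiv.swap 2 3)) / V (t, σ * π) := by
        rw [hV.shapeUnit_edge (by rw [Perm.sign_mul, hπ]; exact (mul_one _).trans hF), ← mul_assoc]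
        rfl
      have e1 : shapeUnit V (TetFlag.edge ((⟨t, ht⟩ : {t : T // t ≠ X.tK}), σ)) =
          V (t, σ * perm4 0 1 3) / V (t, σ * perm4 0 1 2) := by
        have := e (perm4 0 1 2) (by decide)
        rw [show perm4 0 1 2 * Equiv.swap 2 3 = perm4 0 1 3 by decide] at this
        simpa only [show perm4 0 1 2 = 1 by decide, mul_one] using this
      have e2 : shapeUnit V (TetFlag.edge (TetFlag.swapAt 1 2
          ((⟨t, ht⟩ : {t : T // t ≠ X.tK}), σ))) =
          V (t, σ * perm4 0 2 1) / V (t, σ * perm4 0 2 3) := by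
        have := e (perm4 0 2 3) (by decide)
        rw [show perm4 0 2 3 * Equiv.swap 2 3 = perm4 0 2 1 by decide] at this
        rw [← this, ← TetFlag.edge_swapAt_two_three]
        simp only [TetFlag.swapAt, mul_assoc]
        congr 4
        decide
      have e3 : shapeUnit V (TetFlag.edge (TetFlag.swapAt 1 3
          ((⟨t, ht⟩ : {t : T // t ≠ X.tK}), σ))) =
          V (t, σ * perm4 0 3 2) / V (t, σ * perm4 0 3 1) := by
        have := e (perm4 0 3 1) (by decide)
        rw [show perm4 0 3 1 * Equiv.swap 2 3 = perm4 0 3 2 by decide] at this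
        rw [← this, ← TetFlag.edge_swapAt_two_three]
        simp only [TetFlag.swapAt, mul_assoc]
        congr 4
        decide
      rcases h with rfl | rfl
      · simp only [map_add, map_mul, MvPolynomial.aeval_X, map_one]
        rw [e1, e2, e3, ← Units.val_mul, ← Units.val_mul, hw.triangle_u_iff.1 hu]
        simp
      · simp only [map_sub, map_mul, MvPolynomial.aeval_X, map_one]
        rw [e1, e2, (hw.triangle_v_iff hu).1 hv, sub_self]
    · simp only [map_sub, map_prod, MvPolynomial.aeval_X, map_one, sub_eq_zero]
      obtain ⟨i, rfl⟩ : ∃ i, X.collapse.edgeClass i = E := Quot.exists_rep E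
      obtain ⟨F, -, rfl⟩ := TetFlag.exists_even_edge i
      rw [← Units.coe_prod, OrientedTriangulation.prod_edgeClass, ← Units.val_one,
        ← hV.prod_lift (X.collapse.edgeClosed_edgeEnd (X.collapse.edgeEnd F))]
      congr 1
      exact Finset.prod_congr rfl fun G hG =>
        hV.shapeUnit_edge (OrientedTriangulation.mem_evenFlags.1 hG).1)

lemma shapeHom_shape {F : TetFlag {t : T // t ≠ X.tK}} (hF : Perm.sign F.2 = 1) :
    hV.shapeHom k (X.collapse.shape k F) =
      ((V (X.lift (F.swapAt 2 3)) / V (X.lift F) : Bˣ) : B) := by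
  rw [← hV.shapeUnit_edge hF]
  change MvPolynomial.aeval _ (MvPolynomial.X F.edge) = _
  rw [MvPolynomial.aeval_X]

end Shape

/-! ### From face systems to homomorphisms from Kashaev's ring -/

section Lift

open Classical in
variable (X V) in
/-- The values of the generators `u e`. -/
noncomputable def uVal (F : TetFlag T) : B :=
  if X.AvoidsK F then V (F.swapAt 0 2) else
    -- On the short edge opposite to `K`, the value is forced by the triangular relation for `u`.
    V (F.1, F.2 * perm4 2 3 0) * V (F.1, F.2 * perm4 3 1 0)

open Classical in
variable (X V) in
/-- The values of the generators `v e`. -/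
noncomputable def vVal (F : TetFlag T) : B := if X.AvoidsK F then V F else 0

lemma uVal_of_avoidsK {F : TetFlag T} (h : X.AvoidsK F) : uVal X V F = V (F.swapAt 0 2) := if_pos h

lemma vVal_of_avoidsK {F : TetFlag T} (h : X.AvoidsK F) : vVal X V F = V F := if_pos h

lemma vVal_opposite {σ : Perm (Fin 4)} (h : σ 1 = 2 ∨ σ 1 = 3) :
    vVal X V (X.tK, σ * perm4 0 2 3) = 0 := if_neg (not_avoidsK_tK h)

lemma uVal_opposite {σ : Perm (Fin 4)} (h : σ 1 = 2 ∨ σ 1 = 3) :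
    uVal X V (X.tK, σ * perm4 0 2 3) = V (X.tK, σ * perm4 3 1 0) * V (X.tK, σ * perm4 1 2 0) := by
  rw [uVal, if_neg (not_avoidsK_tK h)]
  simp only [mul_assoc]
  congr 5 <;> decide

lemma exists_opposite {F : TetFlag T} (h : ¬ X.MeetsK F) (h' : ¬ X.AvoidsK F) :
    ∃ σ : Perm (Fin 4), (σ 1 = 2 ∨ σ 1 = 3) ∧ (σ 2 = 0 ∨ σ 2 = 1) ∧ (σ 3 = 0 ∨ σ 3 = 1) ∧
      F = (X.tK, σ * perm4 0 2 3) := by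
  obtain ⟨t, τ⟩ := F
  have key : ∀ τ : Perm (Fin 4), ¬ (s(τ 0, τ 1) = s(0, 1) ∨ s(τ 0, τ 2) = s(0, 1)) →
      ¬ (τ 3 = 0 ∨ τ 3 = 1) → (τ 3 = 2 ∨ τ 3 = 3) ∧ (τ 1 = 0 ∨ τ 1 = 1) ∧ (τ 2 = 0 ∨ τ 2 = 1) := by
    decide
  simp only [AvoidsK, Classical.not_imp] at h'
  obtain ⟨rfl, h3⟩ := h'
  obtain ⟨h1, h2, h3⟩ := key τ (fun h4 => h ⟨rfl, h4⟩) h3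
  refine ⟨τ * perm4 0 3 1, h1, h2, h3, ?_⟩
  rw [mul_assoc, show perm4 0 3 1 * perm4 0 2 3 = 1 by decide, mul_one]

lemma one_two_of_two_three : ∀ σ : Perm (Fin 4), (σ 2 = 0 ∨ σ 2 = 1) → (σ 3 = 0 ∨ σ 3 = 1) →
    (σ 0 = 2 ∨ σ 0 = 3) ∧ (σ 1 = 2 ∨ σ 1 = 3) := by decide

variable (X V) in
/-- The triangular relations. -/
def Triangle (F₁ F₂ F₃ : TetFlag T) : Prop :=
  uVal X V F₁ * uVal X V F₂ * uVal X V F₃ = 1 ∧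
    uVal X V F₁ * uVal X V F₂ * vVal X V F₃ + uVal X V F₁ * vVal X V F₂ + vVal X V F₁ = 0

lemma Triangle.rotate {F₁ F₂ F₃ : TetFlag T} (h : Triangle X V F₁ F₂ F₃) :
    Triangle X V F₃ F₁ F₂ := by
  obtain ⟨h1, h2⟩ := h
  refine ⟨by linear_combination h1, ?_⟩
  linear_combination uVal X V F₃ * h2 - vVal X V F₃ * h1

variable (hV : X.IsFaceSystem V)

include hV

lemma fold_eq {σ : Perm (Fin 4)} (h2 : σ 2 = 0 ∨ σ 2 = 1) (h3 : σ 3 = 0 ∨ σ 3 = 1) :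
    V (X.tK, σ * perm4 0 1 2) = - (V (X.tK, σ * perm4 3 1 0) * V (X.tK, σ * perm4 0 3 1)) := by
  have hw := hV.triangleSystem X.tK σ
  have e := hw.swap_eq (σ := perm4 0 3 1) (τ := perm4 0 1 3) (ρ := perm4 3 1 0) (by decide)
    (by decide)
  rw [← e, show perm4 0 1 3 = Equiv.swap 2 3 by decide, hV.fold σ h2 h3,
    show perm4 0 1 2 = 1 by decide, mul_one]

/-- Only the short edge opposite to `K` needs an argument: there the fold equation equates the
products assigned at the vertices 2 and 3. -/
lemma uVal_glue {F : TetFlag T} (h : ¬ X.MeetsK F) : uVal X V (X.glue F) = uVal X V F := by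
  by_cases ha : X.AvoidsK F
  · rw [uVal_of_avoidsK ha, uVal_of_avoidsK ha.glue, ← X.glue_swap _ (by decide) (by decide),
      hV.glue]
  · obtain ⟨σ, h1, h2, h3, rfl⟩ := exists_opposite h ha
    have h0 := (one_two_of_two_three σ h2 h3).1
    have e0 : σ * perm4 1 2 3 = σ * Equiv.swap 0 1 * perm4 0 2 3 := by
      rw [mul_assoc]
      congr 1
      decide
    rw [glue_opposite h2 h3, e0, uVal_opposite (by simpa using h0), uVal_opposite h1, mul_assoc,
      mul_assoc, show Equiv.swap 0 1 * perm4 3 1 0 = perm4 3 0 1 by decide,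
      show Equiv.swap 0 1 * perm4 1 2 0 = perm4 0 2 1 by decide]
    have hw := hV.triangleSystem X.tK σ
    have e1 := hw.swap_eq (σ := perm4 0 1 2) (τ := perm4 0 2 1) (ρ := perm4 1 2 0) (by decide)
      (by decide)
    have e3 := hw.reverse_eq (σ := perm4 0 3 1) (τ := perm4 3 0 1) (by decide)
    rw [e1, e3, hV.fold_eq h2 h3, ← Units.val_mul, ← Units.val_mul]
    congr 1
    generalize V (X.tK, σ * perm4 0 3 1) = c
    generalize V (X.tK, σ * perm4 3 1 0) = r
    generalize V (X.tK, σ * perm4 1 2 0) = p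
    simp only [mul_neg, neg_neg]
    rw [show c⁻¹ * (p * (r * c)) = c⁻¹ * c * (r * p) by ac_rfl, inv_mul_cancel,
      one_mul]

lemma vVal_glue {F : TetFlag T} : vVal X V (X.glue F) = vVal X V F := by
  by_cases ha : X.AvoidsK F
  · rw [vVal_of_avoidsK ha, vVal_of_avoidsK ha.glue, hV.glue]
  · rw [vVal, vVal, if_neg ha, if_neg (mt avoidsK_glue_iff.1 ha)]

lemma reverse_eq {F G : TetFlag T} (h : G = F.swapAt 0 1) : V G * V F = 1 := by
  rw [h, hV.reverse, inv_mul_cancel]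

lemma uVal_reverse {F : TetFlag T} (h : ¬ X.MeetsK F) :
    uVal X V (F.swapAt 1 2) * uVal X V F = 1 := by
  by_cases ha : X.AvoidsK F
  · rw [uVal_of_avoidsK ha, uVal_of_avoidsK (ha.swapAt (by decide) (by decide)), ← Units.val_mul,
      hV.reverse_eq, Units.val_one]
    simp only [TetFlag.swapAt, mul_assoc]
    congr 2
    decide
  · obtain ⟨σ, h1, h2, h3, rfl⟩ := exists_opposite h ha
    have e0 : TetFlag.swapAt 1 2 (X.tK, σ * perm4 0 2 3) =
        (X.tK, σ * Equiv.swap 2 3 * perm4 0 2 3) := by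
      simp only [TetFlag.swapAt, mul_assoc]
      congr 2
      decide
    rw [e0, uVal_opposite (σ := σ * Equiv.swap 2 3) h1, uVal_opposite h1, mul_assoc σ, mul_assoc σ,
      show Equiv.swap 2 3 * perm4 3 1 0 = perm4 2 1 0 by decide,
      show Equiv.swap 2 3 * perm4 1 2 0 = perm4 1 3 0 by decide]
    have hw := hV.triangleSystem X.tK σ
    have e1 := hw.reverse_eq (σ := perm4 1 2 0) (τ := perm4 2 1 0) (by decide)
    have e2 := hw.reverse_eq (σ := perm4 3 1 0) (τ := perm4 1 3 0) (by decide)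
    rw [e1, e2, ← Units.val_mul, ← Units.val_mul, ← Units.val_mul]
    refine congrArg Units.val (?_ : _ = (1 : Bˣ))
    group

lemma vVal_reverse (F : TetFlag T) :
    vVal X V (F.swapAt 1 2) = -(uVal X V (F.swapAt 1 2) * vVal X V F) := by
  by_cases ha : X.AvoidsK F
  · have ha' : X.AvoidsK (F.swapAt 1 2) := ha.swapAt (by decide) (by decide)
    rw [uVal_of_avoidsK ha', vVal_of_avoidsK ha, vVal_of_avoidsK ha', ← Units.val_mul,
      ← Units.val_neg]
    congr 1
    have e : (F.swapAt 1 2).swapAt 0 2 = (F.swapAt 0 1).swapAt 1 2 := by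
      simp only [TetFlag.swapAt, mul_assoc]
      congr 2
      decide
    have h := hV.face F
    rw [mul_right_comm, mul_inv_eq_iff_eq_mul] at h
    rw [e, h, neg_one_mul, neg_neg]
  · rw [vVal, if_neg (not_avoidsK_swapAt ha (by decide) (by decide)), vVal, if_neg ha, mul_zero,
      neg_zero]

omit hV in
-- A hexagon that contains `K` has a single short edge disjoint from `K`, so it carries no hexagonal
-- relation.
lemma avoidsK_of_swap02 {F : TetFlag T} (h : ¬ X.MeetsK F) (h' : ¬ X.MeetsK (F.swapAt 0 2)) :
    X.AvoidsK F := by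
  intro ht
  have key : ∀ τ : Perm (Fin 4), ¬ (s(τ 0, τ 1) = s(0, 1) ∨ s(τ 0, τ 2) = s(0, 1)) →
      ¬ (s(τ 2, τ 1) = s(0, 1) ∨ s(τ 2, τ 0) = s(0, 1)) → τ 3 = 0 ∨ τ 3 = 1 := by
    decide
  exact key F.2 (fun h1 => h ⟨ht, h1⟩) fun h1 => h' ⟨ht, h1⟩

lemma triangle_of_ne {t : T} (ht : t ≠ X.tK) (σ : Perm (Fin 4)) :
    Triangle X V (t, σ * perm4 0 1 2) (t, σ * perm4 0 2 3) (t, σ * perm4 0 3 1) := by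
  have ha (π : Perm (Fin 4)) : X.AvoidsK (t, π) := avoidsK_of_ne ht
  have e1 : TetFlag.swapAt 0 2 (t, σ * perm4 0 1 2) = (t, σ * perm4 2 1 0) := by
    rw [TetFlag.swapAt, mul_assoc]
    congr 2
    decide
  have e2 : TetFlag.swapAt 0 2 (t, σ * perm4 0 2 3) = (t, σ * perm4 3 2 0) := by
    rw [TetFlag.swapAt, mul_assoc]
    congr 2
    decide
  have e3 : TetFlag.swapAt 0 2 (t, σ * perm4 0 3 1) = (t, σ * perm4 1 3 0) := by
    rw [TetFlag.swapAt, mul_assoc]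
    congr 2
    decide
  rw [Triangle, uVal_of_avoidsK (ha _), uVal_of_avoidsK (ha _), uVal_of_avoidsK (ha _),
    vVal_of_avoidsK (ha _), vVal_of_avoidsK (ha _), vVal_of_avoidsK (ha _), e1, e2, e3]
  refine ⟨?_, hV.triangle_v t ht σ⟩
  rw [← Units.val_mul, ← Units.val_mul, hV.triangle_u t ht σ, Units.val_one]

/-- The first relation holds by the choice of `uVal` on the short edge opposite to `K`. In the
second one, `vVal` is 0 on that short edge, and the other two terms cancel by the fold equation. -/
lemma triangle_opposite {σ : Perm (Fin 4)} (h2 : σ 2 = 0 ∨ σ 2 = 1) (h3 : σ 3 = 0 ∨ σ 3 = 1) :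
    Triangle X V (X.tK, σ * perm4 0 2 3) (X.tK, σ * perm4 0 3 1) (X.tK, σ * perm4 0 1 2) := by
  have h1 := (one_two_of_two_three σ h2 h3).2
  have a2 : X.AvoidsK (X.tK, σ * perm4 0 3 1) := avoidsK_tK h2
  have a3 : X.AvoidsK (X.tK, σ * perm4 0 1 2) := avoidsK_tK h3
  have e2 : TetFlag.swapAt 0 2 (X.tK, σ * perm4 0 1 2) = (X.tK, σ * perm4 2 1 0) := by
    rw [TetFlag.swapAt, mul_assoc]
    congr 2
    decide
  have e3 : TetFlag.swapAt 0 2 (X.tK, σ * perm4 0 3 1) = (X.tK, σ * perm4 1 3 0) := by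
    rw [TetFlag.swapAt, mul_assoc]
    congr 2
    decide
  have hw := hV.triangleSystem X.tK σ
  have r1 := hw.reverse_eq (σ := perm4 1 2 0) (τ := perm4 2 1 0) (by decide)
  have r2 := hw.reverse_eq (σ := perm4 3 1 0) (τ := perm4 1 3 0) (by decide)
  rw [Triangle, uVal_opposite h1, vVal_opposite h1, uVal_of_avoidsK a2, uVal_of_avoidsK a3,
    vVal_of_avoidsK a2, vVal_of_avoidsK a3, e2, e3, r1, r2, hV.fold_eq h2 h3, Units.val_neg,
    Units.val_mul]
  have i1 := (V (X.tK, σ * perm4 1 2 0)).mul_inv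
  have i2 := (V (X.tK, σ * perm4 3 1 0)).mul_inv
  constructor
  · linear_combination (V (X.tK, σ * perm4 3 1 0) * ↑(V (X.tK, σ * perm4 3 1 0))⁻¹ : B) * i1 + i2
  · linear_combination (-(V (X.tK, σ * perm4 3 1 0) * V (X.tK, σ * perm4 1 2 0) *
      V (X.tK, σ * perm4 0 3 1) : B)) * i2

lemma triangle_of_not_meetsK {F₁ F₂ F₃ : TetFlag T} (h₂ : F₂ = (F₁.swapAt 1 2).swapAt 2 3)
    (h₃ : F₃ = (F₂.swapAt 1 2).swapAt 2 3) (n₁ : ¬ X.MeetsK F₁) (n₂ : ¬ X.MeetsK F₂)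
    (n₃ : ¬ X.MeetsK F₃) : Triangle X V F₁ F₂ F₃ := by
  obtain ⟨t, τ⟩ := F₁
  have f1 : ((t, τ) : TetFlag T) = (t, τ * perm4 0 1 2) := by
    rw [show perm4 0 1 2 = 1 by decide, mul_one]
  have f2 : F₂ = (t, τ * perm4 0 2 3) := by
    rw [h₂]
    simp only [TetFlag.swapAt, mul_assoc]
    congr 2
    decide
  have f3 : F₃ = (t, τ * perm4 0 3 1) := by
    rw [h₃, f2]
    simp only [TetFlag.swapAt, mul_assoc]
    congr 2
    decide
  rw [f2] at n₂
  rw [f3] at n₃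
  rw [f1, f2, f3]
  by_cases ht : t = X.tK
  · subst ht
    -- In `tK`, all short edges of a triangle avoid `K` only at the vertices 2 and 3. The cases tell
    -- which of the three short edges is the one opposite to `K`; the relations are invariant under
    -- rotation.
    have key : ∀ τ : Perm (Fin 4), s(τ 0, τ 1) ≠ s(0, 1) → s(τ 0, τ 2) ≠ s(0, 1) →
        s(τ 0, τ 3) ≠ s(0, 1) → (τ 1 < 2 ∧ τ 2 < 2) ∨ (τ 2 < 2 ∧ τ 3 < 2) ∨ (τ 3 < 2 ∧ τ 1 < 2) := by
      decide
    have lt : ∀ a : Fin 4, a < 2 → a = 0 ∨ a = 1 := by decide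
    rcases key τ (fun h => n₁ ⟨rfl, .inl h⟩) (fun h => n₁ ⟨rfl, .inr h⟩)
        (fun h => n₃ ⟨rfl, .inl h⟩) with
      h | h | h
    · have := hV.triangle_opposite (σ := τ * perm4 0 3 1) (lt _ h.1) (lt _ h.2)
      simp only [mul_assoc] at this
      convert this using 3 <;> decide
    · have := hV.triangle_opposite (σ := τ) (lt _ h.1) (lt _ h.2)
      exact this.rotate
    · have := hV.triangle_opposite (σ := τ * perm4 0 2 3) (lt _ h.1) (lt _ h.2)
      simp only [mul_assoc] at this
      convert this.rotate.rotate using 3 <;> decide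
  · exact hV.triangle_of_ne ht τ

/-- The homomorphism from Kashaev's ring defined by a face system. -/
noncomputable def kashaevHom : X.KashaevRingAb k →ₐ[k] B :=
  RingQuot.liftAlgHom k ⟨RingQuot.liftAlgHom k ⟨FreeAlgebra.lift k fun
    | .u e => uVal X V e.1
    | .v e => vVal X V e.1, by
      intro a b h
      cases h with
      | glue_u e e' h => simp [h, hV.uVal_glue e.2]
      | glue_v e e' h => simp [h, hV.vVal_glue]
      | reverse_u e e' h => simp [h, hV.uVal_reverse e.2]
      | reverse_v e e' h => simp [h, hV.vVal_reverse]
      | hexagon_u e e' h =>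
        have ha : X.AvoidsK e.1 := avoidsK_of_swap02 e.2 (h ▸ e'.2)
        simp [h, uVal_of_avoidsK ha.swap02, vVal_of_avoidsK ha, TetFlag.swapAt_swapAt]
      | hexagon_v e e' h =>
        have ha : X.AvoidsK e.1 := avoidsK_of_swap02 e.2 (h ▸ e'.2)
        simp [h, uVal_of_avoidsK ha, vVal_of_avoidsK ha.swap02]
      | triangle_u e₁ e₂ e₃ h₂ h₃ =>
        simpa using (hV.triangle_of_not_meetsK h₂ h₃ e₁.2 e₂.2 e₃.2).1
      | triangle_v e₁ e₂ e₃ h₂ h₃ =>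
        simpa using (hV.triangle_of_not_meetsK h₂ h₃ e₁.2 e₂.2 e₃.2).2⟩, by
    rintro _ _ ⟨x, y⟩
    rw [map_mul, map_mul, mul_comm]⟩

lemma kashaevHom_vGen {F : TetFlag T} (h : X.AvoidsK F) (h' : ¬ X.MeetsK F) :
    hV.kashaevHom k (X.vGen k ⟨F, h'⟩) = V F := by
  rw [kashaevHom, vGen, ← vVal_of_avoidsK h]
  erw [RingQuot.liftAlgHom_mkAlgHom_apply, RingQuot.liftAlgHom_mkAlgHom_apply]
  simp

end Lift

end ParticularHTriangulation.IsFaceSystem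

/-! ### Shape parameters as units -/

namespace OrientedTriangulation

variable {T : Type*} [Fintype T] {X : OrientedTriangulation T} {k : Type*} [CommRing k]

lemma shape_mul {F : TetFlag T} (hF : Perm.sign F.2 = 1) :
    X.shape k F * X.shape k (F.swapAt 1 2) * X.shape k (F.swapAt 1 3) = -1 := by
  rw [eq_neg_iff_add_eq_zero]
  exact Ideal.Quotient.eq_zero_iff_mem.2 (Ideal.subset_span (.inl ⟨F, hF, .inl rfl⟩))

lemma shape_sub {F : TetFlag T} (hF : Perm.sign F.2 = 1) :
    X.shape k (F.swapAt 1 2) - X.shape k F * X.shape k (F.swapAt 1 2) = 1 := by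
  rw [← sub_eq_zero]
  exact Ideal.Quotient.eq_zero_iff_mem.2 (Ideal.subset_span (.inl ⟨F, hF, .inr rfl⟩))

variable (X k) in
lemma isUnit_mk_X (i : T × TetEdge) :
    IsUnit (Ideal.Quotient.mk (Ideal.span (X.shapeEquations k)) (MvPolynomial.X i)) := by
  obtain ⟨F, hF, rfl⟩ := TetFlag.exists_even_edge i
  have h := X.shape_mul (k := k) hF
  exact IsUnit.of_mul_eq_one (-(X.shape k (F.swapAt 1 2) * X.shape k (F.swapAt 1 3)))
    (by change X.shape k F * _ = 1; linear_combination -h)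

variable (X k) in
/-- The shape parameters, as units of the coordinate ring of the deformation variety. -/
noncomputable def zUnit (i : T × TetEdge) : (X.DeformationRing k)ˣ := (X.isUnit_mk_X k i).unit

lemma coe_zUnit (F : TetFlag T) : (X.zUnit k F.edge : X.DeformationRing k) = X.shape k F :=
  (X.isUnit_mk_X k F.edge).unit_spec

open Classical in
/-- A point, with values in a ring `B`, of the deformation variety. -/
structure IsShapeSystem (X : OrientedTriangulation T) {B : Type*} [CommRing B]
    (z : T × TetEdge → Bˣ) : Prop where
  mul : ∀ F : TetFlag T, Perm.sign F.2 = 1 →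
    z F.edge * z (F.swapAt 1 2).edge * z (F.swapAt 1 3).edge = -1
  sub : ∀ F : TetFlag T, Perm.sign F.2 = 1 →
    (z (F.swapAt 1 2).edge - z F.edge * z (F.swapAt 1 2).edge : B) = 1
  prod : ∀ E : X.Edge, ∏ i with X.edgeClass i = E, z i = 1

variable (X k) in
lemma isShapeSystem_zUnit : X.IsShapeSystem (X.zUnit k) where
  mul F hF := by
    ext
    push_cast
    rw [coe_zUnit, coe_zUnit, coe_zUnit, shape_mul hF]
  sub F hF := by rw [coe_zUnit, coe_zUnit, shape_sub hF]
  prod E := by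
    ext
    rw [Units.coe_prod, Units.val_one]
    have h := Ideal.Quotient.eq_zero_iff_mem.2 (Ideal.subset_span
      (show _ ∈ X.shapeEquations k from .inr ⟨E, rfl⟩))
    rw [map_sub, map_one, map_prod, sub_eq_zero] at h
    exact h

/-- Opposite edges of a tetrahedron have the same shape parameter. -/
lemma IsShapeSystem.opposite {B : Type*} [CommRing B] {z : T × TetEdge → Bˣ}
    (hz : X.IsShapeSystem z) (t : T) {σ τ : Perm (Fin 4)} (hσ : Perm.sign σ = 1)
    (hτ : τ = σ * perm4 2 3 0) :
    z (TetFlag.edge (t, τ)) = z (TetFlag.edge (t, σ)) := by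
  subst hτ
  have sgn : Perm.sign (perm4 0 3 1) = 1 := by decide
  have sgn' : Perm.sign (perm4 3 0 2) = 1 := by decide
  -- At the two ends of the edge `σ 0 σ 3`, with parameter `x`, the second vertex equation reads `y
  -- * (1 - x) = 1`, once for the parameter `y` of `σ 0 σ 1` and once for that of `σ 2 σ 3`.
  have h1 := hz.sub (t, σ * perm4 0 3 1) (by simp [hσ, sgn])
  have h2 := hz.sub (t, σ * perm4 3 0 2) (by simp [hσ, sgn'])
  have e1 : TetFlag.edge (TetFlag.swapAt 1 2 (t, σ * perm4 0 3 1)) = TetFlag.edge (t, σ) := by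
    rw [← TetFlag.edge_swapAt_two_three]
    simp only [TetFlag.swapAt, mul_assoc]
    rw [show perm4 0 3 1 * (Equiv.swap 1 2 * Equiv.swap 2 3) = 1 by decide, mul_one]
  have e2 : TetFlag.edge (TetFlag.swapAt 1 2 (t, σ * perm4 3 0 2)) =
      TetFlag.edge (t, σ * perm4 2 3 0) := by
    rw [← TetFlag.edge_swapAt_zero_one]
    simp only [TetFlag.swapAt, mul_assoc]
    rw [show perm4 3 0 2 * (Equiv.swap 1 2 * Equiv.swap 0 1) = perm4 2 3 0 by decide]
  have e3 : TetFlag.edge (t, σ * perm4 3 0 2) = TetFlag.edge (t, σ * perm4 0 3 1) := by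
    rw [← TetFlag.edge_swapAt_two_three, ← TetFlag.edge_swapAt_zero_one]
    simp only [TetFlag.swapAt, mul_assoc]
    rw [show perm4 3 0 2 * (Equiv.swap 2 3 * Equiv.swap 0 1) = perm4 0 3 1 by decide]
  rw [e1] at h1
  rw [e2, e3] at h2
  ext
  linear_combination (z (TetFlag.edge (t, σ)) : B) * h2 -
    (z (TetFlag.edge (t, σ * perm4 2 3 0)) : B) * h1

end OrientedTriangulation

namespace ParticularHTriangulation

variable {T : Type*} (X : ParticularHTriangulation T)

/-! ### The edges of the distinguished tetrahedron -/

/-- The directed edge of `tK` from `a` to `2`. -/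
def spoke (a : Fin 4) : X.EdgeEnd := X.edgeEnd (X.tK, perm4 a 2 3)

lemma edgeEnd_eq_spoke {a : Fin 4} (ha : a = 0 ∨ a = 1) {σ : Perm (Fin 4)} (h0 : σ 0 = a)
    (h1 : σ 1 = 2 ∨ σ 1 = 3) : X.edgeEnd (X.tK, σ) = X.spoke a := by
  have key : ∀ a : Fin 4, (a = 0 ∨ a = 1) → ∀ σ : Perm (Fin 4), σ 0 = a → (σ 1 = 2 ∨ σ 1 = 3) →
      σ = perm4 a 2 3 ∨ σ = perm4 a 2 3 * Equiv.swap 2 3 ∨ σ = Equiv.swap 2 3 * perm4 a 2 3 ∨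
      σ = Equiv.swap 2 3 * perm4 a 2 3 * Equiv.swap 2 3 := by decide
  have key' : ∀ a : Fin 4, (a = 0 ∨ a = 1) → perm4 a 2 3 2 = 3 := by decide
  have hf := X.edgeEnd_fold (σ := perm4 a 2 3) (.inr (key' a ha))
  have hs (τ : Perm (Fin 4)) : X.edgeEnd (X.tK, τ * Equiv.swap 2 3) = X.edgeEnd (X.tK, τ) :=
    X.edgeEnd_swap (X.tK, τ)
  rcases key a ha σ h0 h1 with rfl | rfl | rfl | rfl
  · rfl
  · exact hs _
  · exact hf
  · exact (hs _).trans hf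

lemma edgeEnd_eq_rev_spoke {a : Fin 4} (ha : a = 0 ∨ a = 1) {σ : Perm (Fin 4)} (h1 : σ 1 = a)
    (h0 : σ 0 = 2 ∨ σ 0 = 3) : X.edgeEnd (X.tK, σ) = X.rev (X.spoke a) := by
  rw [← X.edgeEnd_eq_spoke ha (σ := σ * Equiv.swap 0 1) (by simpa using h1) (by simpa using h0),
    X.rev_edgeEnd, TetFlag.swapAt, mul_assoc, Equiv.swap_mul_self, mul_one]

lemma spoke_ne : X.spoke 0 ≠ X.spoke 1 :=
  X.edgeEnd_tK_ne (.inl rfl) (.inl rfl) (by decide) (by decide)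

lemma spoke_ne_rev : X.spoke 0 ≠ X.rev (X.spoke 1) :=
  X.edgeEnd_tK_ne (τ := perm4 1 2 3 * Equiv.swap 0 1) (.inl rfl) (.inl rfl) (by decide) (by decide)

lemma rev_spoke_ne : X.rev (X.spoke 0) ≠ X.spoke 1 := fun h =>
  X.spoke_ne_rev (by rw [← h, X.rev_rev])

section Lift

variable {X} [DecidableEq T]

/-- A gluing after the collapse is either an old one or a jump across `tK`. A jump at the edge 23 is
the move `swapAt 2 3` inside `tK`, so only jumps at the edges between an end of `K` and 2 or 3 need
the hypothesis `hj`. -/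
lemma edgeClosed_preimage_lift {M : Set (TetFlag T)} (hM : X.EdgeClosed M)
    (hj : ∀ σ : Perm (Fin 4), (σ 2 = 2 ∨ σ 2 = 3) → (σ 3 = 0 ∨ σ 3 = 1) → (X.tK, σ) ∈ M →
      (X.tK, Equiv.swap 0 1 * σ) ∈ M) : X.collapse.EdgeClosed (X.lift ⁻¹' M) where
  swap F hF := hM.swap _ hF
  glue F hF := by
    rw [Set.mem_preimage] at hF ⊢
    by_cases h : (X.glue (X.lift F)).1 = X.tK
    · have ha : X.AvoidsK (X.glue (X.lift F)) := (avoidsK_of_ne F.1.2).glue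
      have h3 := ha h
      have hG : X.glue (X.lift F) = (X.tK, (X.glue (X.lift F)).2) := Prod.ext h rfl
      rw [collapse_glue_of_eq F hG]
      have hF' := hM.glue _ hF
      rw [hG] at hF'
      apply hM.glue
      generalize (X.glue (X.lift F)).2 = σ at *
      have key : ∀ a : Fin 4, (a = 0 ∨ a = 1) ∨ (a = 2 ∨ a = 3) := by decide
      rcases key (σ 2) with h2 | h2
      · rw [swap_zero_one_mul σ h2 h3]
        exact hM.swap _ hF'
      · exact hj σ h2 h3 hF'
    · rw [collapse_glue_of_ne F h]
      exact hM.glue _ hF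

omit [DecidableEq T] in
lemma spoke_cases {σ : Perm (Fin 4)} (h2 : σ 2 = 2 ∨ σ 2 = 3) (h3 : σ 3 = 0 ∨ σ 3 = 1) :
    X.edgeEnd (X.tK, σ) = X.spoke 0 ∧ X.edgeEnd (X.tK, Equiv.swap 0 1 * σ) = X.spoke 1 ∨
    X.edgeEnd (X.tK, σ) = X.spoke 1 ∧ X.edgeEnd (X.tK, Equiv.swap 0 1 * σ) = X.spoke 0 ∨
    X.edgeEnd (X.tK, σ) = X.rev (X.spoke 0) ∧
      X.edgeEnd (X.tK, Equiv.swap 0 1 * σ) = X.rev (X.spoke 1) ∨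
    X.edgeEnd (X.tK, σ) = X.rev (X.spoke 1) ∧
      X.edgeEnd (X.tK, Equiv.swap 0 1 * σ) = X.rev (X.spoke 0) := by
  have key : ∀ σ : Perm (Fin 4), (σ 2 = 2 ∨ σ 2 = 3) → (σ 3 = 0 ∨ σ 3 = 1) →
      ((σ 0 = 0 ∨ σ 0 = 1) ∧ (σ 1 = 2 ∨ σ 1 = 3)) ∨ ((σ 1 = 0 ∨ σ 1 = 1) ∧ (σ 0 = 2 ∨ σ 0 = 3)) := by
    decide
  have m (τ : Perm (Fin 4)) (i : Fin 4) : (Equiv.swap 0 1 * τ : Perm (Fin 4)) i = Equiv.swap 0 1 (τ i) := rfl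
  have f : ∀ a : Fin 4, (a = 2 ∨ a = 3) → Equiv.swap 0 1 a = 2 ∨ Equiv.swap 0 1 a = 3 := by decide
  rcases key σ h2 h3 with ⟨h0 | h0, h1⟩ | ⟨h1 | h1, h0⟩
  · exact .inl ⟨X.edgeEnd_eq_spoke (.inl rfl) h0 h1,
      X.edgeEnd_eq_spoke (.inr rfl) (by rw [m, h0]; decide) (f _ h1)⟩
  · exact .inr (.inl ⟨X.edgeEnd_eq_spoke (.inr rfl) h0 h1,
      X.edgeEnd_eq_spoke (.inl rfl) (by rw [m, h0]; decide) (f _ h1)⟩)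
  · exact .inr (.inr (.inl ⟨X.edgeEnd_eq_rev_spoke (.inl rfl) h1 h0,
      X.edgeEnd_eq_rev_spoke (.inr rfl) (by rw [m, h1]; decide) (f _ h0)⟩))
  · exact .inr (.inr (.inr ⟨X.edgeEnd_eq_rev_spoke (.inr rfl) h1 h0,
      X.edgeEnd_eq_rev_spoke (.inl rfl) (by rw [m, h1]; decide) (f _ h0)⟩))

variable [Fintype T] {A : Type*} [CommGroup A]

/-- Split a product over the flags of the H-triangulation into the contributions of the
tetrahedron `tK` and of the other ones. -/
lemma prod_evenFlags_split (M : Set (TetFlag T)) (f : TetFlag T → A) :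
    ∏ F ∈ OrientedTriangulation.evenFlags M, f F =
      (∏ F ∈ OrientedTriangulation.evenFlags (X.lift ⁻¹' M), f (X.lift F)) *
      (open Classical in ∏ σ : Perm (Fin 4) with Perm.sign σ = 1,
        if (X.tK, σ) ∈ M then f (X.tK, σ) else 1) := by
  classical
  rw [← Finset.prod_filter_not_mul_prod_filter (OrientedTriangulation.evenFlags M)
    (fun F : TetFlag T => F.1 = X.tK), ← Finset.prod_filter, Finset.filter_filter]
  congr 1
  · symm
    refine Finset.prod_of_injOn X.lift lift_injective.injOn ?_ ?_ ?_
    · intro F hF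
      have := OrientedTriangulation.mem_evenFlags.1 hF
      simp only [Finset.coe_filter, Set.mem_ofPred_eq, OrientedTriangulation.mem_evenFlags]
      exact ⟨⟨this.1, this.2⟩, F.1.2⟩
    · intro F hF hF'
      simp only [Finset.mem_filter, OrientedTriangulation.mem_evenFlags] at hF
      obtain ⟨G, rfl⟩ := exists_lift hF.2
      exact absurd ⟨G, OrientedTriangulation.mem_evenFlags.2 ⟨hF.1.1, hF.1.2⟩, rfl⟩ hF'
    · intro F _
      rfl
  · symm
    refine Finset.prod_of_injOn (fun σ => (X.tK, σ)) (fun σ _ τ _ h => congrArg Prod.snd h) ?_ ?_ ?_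
    · intro σ hσ
      simpa [OrientedTriangulation.mem_evenFlags] using hσ
    · rintro ⟨t, σ⟩ hF hF'
      simp only [Finset.mem_filter, OrientedTriangulation.mem_evenFlags] at hF
      obtain ⟨hσ, rfl⟩ := hF
      exact absurd ⟨σ, by simpa using hσ, rfl⟩ hF'
    · intro σ _
      rfl

variable (X) in
/-- The product of the shape parameters of the tetrahedra other than `tK` around a directed edge of
the H-triangulation. -/
noncomputable def outerProd (z : {t : T // t ≠ X.tK} × TetEdge → A) (D : X.EdgeEnd) : A :=
  ∏ F ∈ OrientedTriangulation.evenFlags (X.lift ⁻¹' {F | X.edgeEnd F = D}), z F.edge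

lemma outerProd_rev (z : {t : T // t ≠ X.tK} × TetEdge → A) (D : X.EdgeEnd) :
    X.outerProd z (X.rev D) = X.outerProd z D := by
  have hs (F : TetFlag {t : T // t ≠ X.tK}) (h : Perm.sign F.2 = 1) :
      Perm.sign ((F.swapAt 2 3).swapAt 0 1).2 = 1 := by
    rw [TetFlag.sign_swapAt (by decide), TetFlag.sign_swapAt (by decide), h, neg_neg]
  have hi (F : TetFlag {t : T // t ≠ X.tK}) :
      (((F.swapAt 2 3).swapAt 0 1).swapAt 2 3).swapAt 0 1 = F := by
    rw [← TetFlag.swapAt_comm, TetFlag.swapAt_swapAt, TetFlag.swapAt_swapAt]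
  have hD (F : TetFlag {t : T // t ≠ X.tK}) (D : X.EdgeEnd) (h : X.edgeEnd (X.lift F) = D) :
      X.edgeEnd (X.lift ((F.swapAt 2 3).swapAt 0 1)) = X.rev D := by
    rw [lift_swapAt, lift_swapAt, ← X.rev_edgeEnd, X.edgeEnd_swap, h]
  refine Finset.prod_nbij' (fun F => (F.swapAt 2 3).swapAt 0 1)
    (fun F => (F.swapAt 2 3).swapAt 0 1) ?_ ?_ (fun F _ => hi F) (fun F _ => hi F) ?_
  · intro F hF
    rw [OrientedTriangulation.mem_evenFlags] at hF ⊢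
    refine ⟨hs F hF.1, ?_⟩
    have := hD F _ hF.2
    rwa [X.rev_rev] at this
  · intro F hF
    rw [OrientedTriangulation.mem_evenFlags] at hF ⊢
    exact ⟨hs F hF.1, hD F _ hF.2⟩
  · intro F _
    rw [TetFlag.edge_swapAt_zero_one, TetFlag.edge_swapAt_two_three]

open Classical in
-- Jumps across `tK` only relate different directed edges if these belong to the distinguished face;
-- otherwise the flags at `D` outside `tK` are closed under the gluings of the collapsed
-- triangulation.
lemma outerProd_eq_one {z : {t : T // t ≠ X.tK} × TetEdge → A}
    (hz : ∀ E, ∏ i with X.collapse.edgeClass i = E, z i = 1) {D : X.EdgeEnd}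
    (h0 : D ≠ X.spoke 0) (h1 : D ≠ X.spoke 1) (h0' : D ≠ X.rev (X.spoke 0))
    (h1' : D ≠ X.rev (X.spoke 1)) : X.outerProd z D = 1 := by
  refine OrientedTriangulation.prod_evenFlags_eq_one hz
    (edgeClosed_preimage_lift (X.edgeClosed_edgeEnd D) fun σ h2 h3 h => ?_) ?_
  · change X.edgeEnd (X.tK, σ) = D at h
    rcases spoke_cases (X := X) h2 h3 with h4 | h4 | h4 | h4
    · exact absurd (h.symm.trans h4.1) h0
    · exact absurd (h.symm.trans h4.1) h1
    · exact absurd (h.symm.trans h4.1) h0'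
    · exact absurd (h.symm.trans h4.1) h1'
  · intro F (hF : X.edgeEnd (X.lift F) = D) (hF' : X.edgeEnd ((X.lift F).swapAt 0 1) = D)
    rw [← X.rev_edgeEnd, hF] at hF'
    exact X.rev_ne D hF'

open Classical in
-- The collapse merges the two edges of the distinguished face other than `K`, so the flags at both
-- together are closed under its gluings.
lemma outerProd_mul {z : {t : T // t ≠ X.tK} × TetEdge → A}
    (hz : ∀ E, ∏ i with X.collapse.edgeClass i = E, z i = 1) :
    X.outerProd z (X.spoke 0) * X.outerProd z (X.spoke 1) = 1 := by
  have hM : X.EdgeClosed {F | X.edgeEnd F = X.spoke 0 ∨ X.edgeEnd F = X.spoke 1} :=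
    ⟨fun F h => by simpa [X.edgeEnd_glue] using h, fun F h => by simpa [X.edgeEnd_swap] using h⟩
  have h1 := OrientedTriangulation.prod_evenFlags_eq_one hz
    (edgeClosed_preimage_lift hM fun σ h2 h3 h => ?_) ?_
  · rw [← h1, outerProd, outerProd, ← Finset.prod_union]
    · refine Finset.prod_congr ?_ fun _ _ => rfl
      ext F
      simp only [Finset.mem_union, OrientedTriangulation.mem_evenFlags, Set.mem_preimage,
        Set.mem_ofPred_eq]
      tauto
    · rw [Finset.disjoint_left]
      intro F h h'
      rw [OrientedTriangulation.mem_evenFlags] at h h'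
      exact X.spoke_ne (h.2.symm.trans h'.2)
  · rcases spoke_cases (X := X) h2 h3 with h4 | h4 | h4 | h4
    · exact .inr h4.2
    · exact .inl h4.2
    · rcases h with h | h
      · exact absurd (h4.1.symm.trans h) (X.rev_ne _)
      · exact absurd (h4.1.symm.trans h) X.rev_spoke_ne
    · rcases h with h | h
      · exact absurd (h.symm.trans h4.1) X.spoke_ne_rev
      · exact absurd (h4.1.symm.trans h) (X.rev_ne _)
  · intro F hF hF'
    change _ ∨ _ at hF hF'
    rw [lift_swapAt, ← X.rev_edgeEnd] at hF'
    rcases hF with hF | hF <;> rw [hF] at hF' <;> rcases hF' with h | h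
    · exact X.rev_ne _ h
    · exact X.rev_spoke_ne h
    · exact X.spoke_ne_rev h.symm
    · exact X.rev_ne _ h

end Lift

end ParticularHTriangulation

/-! ### Reflected vertex equations, and the product over the four faces of a tetrahedron. -/

namespace IsTriangleSystem

variable {B : Type*} [CommRing B] {w : Perm (Fin 4) → Bˣ} (hw : IsTriangleSystem w)

include hw

/-- The shape equations only concern even orderings of the vertices; this lemma and the next one
transfer the triangular relations to the odd ones. -/
lemma triangle_u_reflect (hu : w (perm4 2 1 0) * w (perm4 3 2 0) * w (perm4 1 3 0) = 1) :
    w (perm4 1 2 0) * w (perm4 3 1 0) * w (perm4 2 3 0) = 1 := by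
  obtain ⟨-, -, -, h4, h5, h6⟩ := hw.params
  rw [h4, h5, h6, ← mul_inv, ← mul_inv, inv_eq_one] at hu
  rw [← hu]
  ac_rfl

lemma triangle_v_reflect (hu : w (perm4 2 1 0) * w (perm4 3 2 0) * w (perm4 1 3 0) = 1)
    (hv : (w (perm4 2 1 0) * w (perm4 3 2 0) * w (perm4 0 3 1) +
      w (perm4 2 1 0) * w (perm4 0 2 3) + w (perm4 0 1 2) : B) = 0) :
    (w (perm4 1 2 0) * w (perm4 3 1 0) * w (perm4 0 3 2) + w (perm4 1 2 0) * w (perm4 0 1 3) +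
      w (perm4 0 2 1) : B) = 0 := by
  have hu' := congrArg Units.val (hw.triangle_u_reflect hu)
  obtain ⟨h1, h2, h3, h4, h5, h6⟩ := hw.params
  rw [h4, h5] at hv
  rw [h1, h2, h3]
  push_cast at hu' ⊢
  have i1 := (w (perm4 1 2 0)).mul_inv
  have i2 := (w (perm4 2 3 0)).mul_inv
  generalize (w (perm4 1 2 0) : B) = p at *
  generalize (w (perm4 2 3 0) : B) = q at *
  generalize (w (perm4 3 1 0) : B) = r at *
  generalize ((w (perm4 1 2 0))⁻¹ : Bˣ).val = p' at *
  generalize ((w (perm4 2 3 0))⁻¹ : Bˣ).val = q' at *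
  generalize (w (perm4 0 1 2) : B) = a at *
  generalize (w (perm4 0 2 3) : B) = b at *
  generalize (w (perm4 0 3 1) : B) = c at *
  linear_combination (-p) * hv + (q' * c + b) * i1 - (b + q' * c) * hu' + p * r * c * i2

end IsTriangleSystem

/-- Each edge lies on two faces, in opposite directions, so that only the change of `v` between them
survives. -/
lemma prod_faces {A : Type*} [CommGroup A] {v w : Perm (Fin 4) → A}
    (hr : ∀ σ, v (σ * Equiv.swap 0 1) = (v σ)⁻¹)
    (hw : ∀ σ, Perm.sign σ = 1 → v (σ * Equiv.swap 2 3) = w σ * v σ) :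
    v (perm4 2 1 3) * (v (perm4 3 1 2))⁻¹ * v (perm4 3 2 1) *
      (v (perm4 3 0 2) * (v (perm4 2 0 3))⁻¹ * v (perm4 2 3 0)) *
      (v (perm4 0 3 1) * (v (perm4 1 3 0))⁻¹ * v (perm4 1 0 3)) *
      (v (perm4 1 2 0) * (v (perm4 0 2 1))⁻¹ * v (perm4 0 1 2)) =
    (w (perm4 0 1 2) * w (perm4 0 2 3) * w (perm4 0 3 1) *
      (w (perm4 2 3 0) * w (perm4 1 2 0) * w (perm4 1 3 2)))⁻¹ := by
  have r {σ τ : Perm (Fin 4)} (h : τ = σ * Equiv.swap 0 1) : v τ = (v σ)⁻¹ := h ▸ hr σ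
  have s {σ τ : Perm (Fin 4)} (h : Perm.sign σ = 1) (h' : τ = σ * Equiv.swap 2 3) :
      v τ = w σ * v σ := h' ▸ hw σ h
  rw [r (σ := perm4 1 2 3) (τ := perm4 2 1 3) (by decide),
    r (σ := perm4 1 3 2) (τ := perm4 3 1 2) (by decide),
    r (σ := perm4 2 3 1) (τ := perm4 3 2 1) (by decide),
    r (σ := perm4 0 3 2) (τ := perm4 3 0 2) (by decide),
    r (σ := perm4 0 2 3) (τ := perm4 2 0 3) (by decide),
    r (σ := perm4 0 1 3) (τ := perm4 1 0 3) (by decide),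
    s (σ := perm4 0 1 2) (τ := perm4 0 1 3) (by decide) (by decide),
    s (σ := perm4 0 2 3) (τ := perm4 0 2 1) (by decide) (by decide),
    s (σ := perm4 0 3 1) (τ := perm4 0 3 2) (by decide) (by decide),
    s (σ := perm4 1 2 0) (τ := perm4 1 2 3) (by decide) (by decide),
    s (σ := perm4 1 3 2) (τ := perm4 1 3 0) (by decide) (by decide),
    s (σ := perm4 2 3 0) (τ := perm4 2 3 1) (by decide) (by decide)]
  apply mul_left_cancel (a := w (perm4 0 1 2) * w (perm4 0 2 3) * w (perm4 0 3 1) *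
      (w (perm4 2 3 0) * w (perm4 1 2 0) * w (perm4 1 3 2)))
  rw [mul_inv_cancel]
  simp only [mul_inv, inv_inv]
  generalize v (perm4 0 1 2) = a1
  generalize v (perm4 0 2 3) = a2
  generalize v (perm4 0 3 1) = a3
  generalize v (perm4 1 2 0) = a4
  generalize v (perm4 1 3 2) = a5
  generalize v (perm4 2 3 0) = a6
  generalize w (perm4 0 1 2) = b1
  generalize w (perm4 0 2 3) = b2
  generalize w (perm4 0 3 1) = b3
  generalize w (perm4 1 2 0) = b4
  generalize w (perm4 1 3 2) = b5
  generalize w (perm4 2 3 0) = b6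
  trans b1 * b1⁻¹ * (b2 * b2⁻¹) * (b3 * b3⁻¹) * (b4 * b4⁻¹) * (b5 * b5⁻¹) * (b6 * b6⁻¹) *
    (a1 * a1⁻¹) * (a2 * a2⁻¹) * (a3 * a3⁻¹) * (a4 * a4⁻¹) * (a5 * a5⁻¹) * (a6 * a6⁻¹)
  · ac_rfl
  · simp only [mul_inv_cancel, mul_one]

/-! ### Weights on the edges of the distinguished tetrahedron. -/

namespace ParticularHTriangulation

variable {T : Type*} (X : ParticularHTriangulation T)

section Weight

variable {A : Type*} [CommGroup A]

/-- The weights of the edges of the distinguished tetrahedron. -/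
def tetWeight (ζ : A) (σ : Perm (Fin 4)) : A :=
  -- In the application `ζ` is the outer product around the edge 02, and the one around 12 is `ζ⁻¹`.
  -- Each is compensated once; 03 and 13, which represent the same edges of `M`, get weight 1.
  if s(σ 0, σ 1) = s(0, 2) then ζ⁻¹ else if s(σ 0, σ 1) = s(1, 2) then ζ else 1

variable [Fintype T] [DecidableEq T]

/-- The shape parameters of the tetrahedra other than `tK`, extended to `tK` in such a way that the
products around all the edges of the H-triangulation are 1. -/
noncomputable def weight (z : {t : T // t ≠ X.tK} × TetEdge → A) (F : TetFlag T) : A :=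
  if h : F.1 ≠ X.tK then z (TetFlag.edge ((⟨F.1, h⟩ : {t : T // t ≠ X.tK}), F.2)) else
    tetWeight (X.outerProd z (X.spoke 0)) F.2

variable {X} {z : {t : T // t ≠ X.tK} × TetEdge → A}

lemma weight_lift (F : TetFlag {t : T // t ≠ X.tK}) : X.weight z (X.lift F) = z F.edge :=
  dif_pos F.1.2

lemma weight_tK (σ : Perm (Fin 4)) :
    X.weight z (X.tK, σ) = tetWeight (X.outerProd z (X.spoke 0)) σ :=
  dif_neg fun h => h rfl

lemma weight_opposite (F : TetFlag T) :
    X.weight z ((F.swapAt 2 3).swapAt 0 1) = X.weight z F := by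
  by_cases h : F.1 = X.tK
  · obtain ⟨t, σ⟩ := F
    obtain rfl : t = X.tK := h
    have h0 : Equiv.swap (2 : Fin 4) 3 0 = 0 := by decide
    have h1 : Equiv.swap (2 : Fin 4) 3 1 = 1 := by decide
    simp only [TetFlag.swapAt, weight_tK, tetWeight, Perm.coe_mul, Function.comp_apply,
      Equiv.swap_apply_left, Equiv.swap_apply_right, h0, h1, Sym2.eq_swap (a := σ 1)]
  · obtain ⟨F, rfl⟩ := exists_lift h
    rw [← lift_swapAt, ← lift_swapAt, weight_lift, weight_lift, TetFlag.edge_swapAt_zero_one,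
      TetFlag.edge_swapAt_two_three]

open Classical in
-- In `tK` only four even flags carry a nontrivial weight, one for each direction of 02 and 12. At
-- these directed edges they cancel the outer product, and at all others the outer product is
-- already 1.
lemma prod_weight (hz : ∀ E, ∏ i with X.collapse.edgeClass i = E, z i = 1) (D : X.EdgeEnd) :
    ∏ F ∈ OrientedTriangulation.evenFlags {F | X.edgeEnd F = D}, X.weight z F = 1 := by
  rw [prod_evenFlags_split]
  have e1 : ∏ F ∈ OrientedTriangulation.evenFlags (X.lift ⁻¹' {F | X.edgeEnd F = D}),
      X.weight z (X.lift F) = X.outerProd z D :=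
    Finset.prod_congr rfl fun F _ => weight_lift F
  have h1 : X.edgeEnd (X.tK, perm4 0 2 3) = X.spoke 0 := rfl
  have h2 : X.edgeEnd (X.tK, perm4 2 0 1) = X.rev (X.spoke 0) :=
    X.edgeEnd_eq_rev_spoke (.inl rfl) (by decide) (by decide)
  have h3 : X.edgeEnd (X.tK, perm4 1 2 0) = X.spoke 1 :=
    X.edgeEnd_eq_spoke (.inr rfl) (by decide) (by decide)
  have h4 : X.edgeEnd (X.tK, perm4 2 1 3) = X.rev (X.spoke 1) :=
    X.edgeEnd_eq_rev_spoke (.inr rfl) (by decide) (by decide)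
  set ζ := X.outerProd z (X.spoke 0) with hζ
  have hone {σ : Perm (Fin 4)} (h : s(σ 0, σ 1) ≠ s(0, 2)) (h' : s(σ 0, σ 1) ≠ s(1, 2)) :
      (if (X.tK, σ) ∈ {F | X.edgeEnd F = D} then X.weight z (X.tK, σ) else 1) = 1 := by
    rw [weight_tK, tetWeight, if_neg h, if_neg h', ite_self]
  have hneg {σ : Perm (Fin 4)} (h : s(σ 0, σ 1) = s(0, 2)) : X.weight z (X.tK, σ) = ζ⁻¹ := by
    rw [weight_tK, tetWeight, if_pos h]
  have hpos {σ : Perm (Fin 4)} (h : s(σ 0, σ 1) = s(1, 2)) : X.weight z (X.tK, σ) = ζ := by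
    rw [weight_tK, tetWeight, if_neg (by rw [h]; decide), if_pos h]
  rw [e1, filter_even]
  repeat rw [Finset.prod_insert (by decide)]
  rw [Finset.prod_singleton, hone (σ := perm4 2 3 0) (by decide) (by decide),
    hone (σ := perm4 3 2 1) (by decide) (by decide),
    hone (σ := perm4 0 1 2) (by decide) (by decide),
    hone (σ := perm4 1 0 3) (by decide) (by decide),
    hone (σ := perm4 0 3 1) (by decide) (by decide),
    hone (σ := perm4 1 3 2) (by decide) (by decide),
    hone (σ := perm4 3 0 2) (by decide) (by decide),
    hone (σ := perm4 3 1 0) (by decide) (by decide),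
    hneg (σ := perm4 0 2 3) (by decide), hneg (σ := perm4 2 0 1) (by decide),
    hpos (σ := perm4 1 2 0) (by decide), hpos (σ := perm4 2 1 3) (by decide)]
  simp only [Set.mem_ofPred_eq, h1, h2, h3, h4, one_mul, mul_one]
  have n1 := X.spoke_ne
  have n2 := X.spoke_ne_rev
  have n3 := X.rev_spoke_ne
  have n4 := X.rev_ne (X.spoke 0)
  have n5 := X.rev_ne (X.spoke 1)
  have n6 : X.rev (X.spoke 0) ≠ X.rev (X.spoke 1) := fun h => n1 (by
    rw [← X.rev_rev (X.spoke 0), h, X.rev_rev])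
  have hm : ζ * X.outerProd z (X.spoke 1) = 1 := outerProd_mul hz
  by_cases d1 : D = X.spoke 0
  · subst d1
    rw [if_pos rfl, if_neg n4, if_neg n1.symm, if_neg n2.symm, ← hζ, mul_one, mul_one, mul_one,
      mul_inv_cancel]
  by_cases d2 : D = X.rev (X.spoke 0)
  · subst d2
    rw [if_neg n4.symm, if_pos rfl, if_neg n3.symm, if_neg n6.symm, outerProd_rev, ← hζ, mul_one,
      one_mul, one_mul, mul_inv_cancel]
  by_cases d3 : D = X.spoke 1
  · subst d3
    rw [if_neg n1, if_neg n3, if_pos rfl, if_neg n5, one_mul, one_mul, mul_one, mul_comm, hm]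
  by_cases d4 : D = X.rev (X.spoke 1)
  · subst d4
    rw [if_neg n2, if_neg n6, if_neg n5.symm, if_pos rfl, outerProd_rev, one_mul, one_mul, one_mul,
      mul_comm, hm]
  rw [if_neg (Ne.symm d1), if_neg (Ne.symm d2), if_neg (Ne.symm d3), if_neg (Ne.symm d4),
    outerProd_eq_one hz d1 d3 d2 d4]
  simp

end Weight

end ParticularHTriangulation

/-! ### From shape parameters to face systems. -/

namespace ParticularHTriangulation

variable {T : Type*} {X : ParticularHTriangulation T}

open Classical in
variable (X) in
/-- The negative of the coboundary of a 1-cochain, restricted to the triangles without `K`. -/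
noncomputable def defect {A : Type*} [CommGroup A] [HasDistribNeg A] (V : TetFlag T → A)
    (F : TetFlag T) : A :=
  if X.AvoidsK F then -(V ((F.swapAt 0 1).swapAt 1 2) * (V (F.swapAt 1 2))⁻¹ * V F) else 1

section Defect

variable {A : Type*} [CommGroup A] [HasDistribNeg A] {V : TetFlag T → A}

lemma defect_of_avoidsK {F : TetFlag T} (h : X.AvoidsK F) :
    X.defect V F = -(V ((F.swapAt 0 1).swapAt 1 2) * (V (F.swapAt 1 2))⁻¹ * V F) := if_pos h

lemma defect_of_not_avoidsK {F : TetFlag T} (h : ¬ X.AvoidsK F) : X.defect V F = 1 := if_neg h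

lemma defect_glue (hglue : ∀ F, V (X.glue F) = V F) (F : TetFlag T) :
    X.defect V (X.glue F) = X.defect V F := by
  by_cases h : X.AvoidsK F
  · rw [defect_of_avoidsK h, defect_of_avoidsK h.glue, ← X.glue_swap F (by decide) (by decide),
      ← X.glue_swap _ (by decide) (by decide), ← X.glue_swap F (by decide) (by decide), hglue, hglue,
      hglue]
  · rw [defect_of_not_avoidsK h, defect_of_not_avoidsK (mt avoidsK_glue_iff.1 h)]

lemma defect_swap_zero_one (hr : ∀ F, V (F.swapAt 0 1) = (V F)⁻¹) (F : TetFlag T) :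
    X.defect V (F.swapAt 0 1) = (X.defect V F)⁻¹ := by
  by_cases h : X.AvoidsK F
  · rw [defect_of_avoidsK h, defect_of_avoidsK (h.swapAt (by decide) (by decide)),
      TetFlag.swapAt_swapAt, hr, inv_neg, mul_inv, mul_inv, inv_inv,
      mul_comm (V (F.swapAt 1 2))]
  · rw [defect_of_not_avoidsK h, defect_of_not_avoidsK (not_avoidsK_swapAt h (by decide) (by decide)),
      inv_one]

lemma defect_swap_one_two (hr : ∀ F, V (F.swapAt 0 1) = (V F)⁻¹) (F : TetFlag T) :
    X.defect V (F.swapAt 1 2) = (X.defect V F)⁻¹ := by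
  by_cases h : X.AvoidsK F
  · have e : ((F.swapAt 1 2).swapAt 0 1).swapAt 1 2 = ((F.swapAt 0 1).swapAt 1 2).swapAt 0 1 := by
      simp only [TetFlag.swapAt, mul_assoc]
      congr 2
      decide
    rw [defect_of_avoidsK h, defect_of_avoidsK (h.swapAt (by decide) (by decide)),
      TetFlag.swapAt_swapAt, e, hr, inv_neg, mul_inv, mul_inv, inv_inv, mul_right_comm]
  · rw [defect_of_not_avoidsK h, defect_of_not_avoidsK (not_avoidsK_swapAt h (by decide) (by decide)),
      inv_one]

lemma defect_eq {t : T} {σ ρ τ : Perm (Fin 4)} (h : X.AvoidsK (t, σ))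
    (hρ : ρ = σ * Equiv.swap 0 1 * Equiv.swap 1 2) (hτ : τ = σ * Equiv.swap 1 2) :
    X.defect V (t, σ) = -(V (t, ρ) * (V (t, τ))⁻¹ * V (t, σ)) := by
  subst hρ hτ
  exact defect_of_avoidsK h

end Defect

variable [Fintype T] [DecidableEq T] {B : Type*} [CommRing B] {z : {t : T // t ≠ X.tK} × TetEdge → Bˣ}
  (hz : X.collapse.IsShapeSystem z)

section Closed

variable {V : TetFlag T → Bˣ}
  (hglue : ∀ F, V (X.glue F) = V F) (hr : ∀ F, V (F.swapAt 0 1) = (V F)⁻¹)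
  (hw : ∀ F, Perm.sign F.2 = 1 → V (F.swapAt 2 3) = X.weight z F * V F)

include hr hw

include hz in
-- By `prod_faces` this is the inverse of the product of six shape parameters: three at a vertex,
-- with product `-1`, and the three at the opposite edges, which are equal to them. The four signs
-- in the defects cancel.
lemma prod_defect_of_ne {t : T} (ht : t ≠ X.tK) :
    ∏ i, X.defect V (t, OrientedTriangulation.faceFlag i) = 1 := by
  have ha (π : Perm (Fin 4)) : X.AvoidsK (t, π) := avoidsK_of_ne ht
  have h := prod_faces (v := fun π => V (t, π))
    (w := fun π => X.weight z (t, π)) (fun π => hr (t, π)) fun π => hw (t, π)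
  have hwt (π : Perm (Fin 4)) : X.weight z (t, π) =
      z (TetFlag.edge ((⟨t, ht⟩ : {t : T // t ≠ X.tK}), π)) :=
    weight_lift (X := X) (⟨t, ht⟩, π)
  have hm := hz.mul ((⟨t, ht⟩ : {t : T // t ≠ X.tK}), perm4 0 1 2) (show Perm.sign (perm4 0 1 2) = 1 by decide)
  have e1 : z (TetFlag.edge (TetFlag.swapAt 1 2
      ((⟨t, ht⟩ : {t : T // t ≠ X.tK}), perm4 0 1 2))) =
      z (TetFlag.edge ((⟨t, ht⟩ : {t : T // t ≠ X.tK}), perm4 0 2 3)) := by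
    rw [← TetFlag.edge_swapAt_two_three]
    simp only [TetFlag.swapAt]
    congr 3
    decide
  have e2 : z (TetFlag.edge (TetFlag.swapAt 1 3
      ((⟨t, ht⟩ : {t : T // t ≠ X.tK}), perm4 0 1 2))) =
      z (TetFlag.edge ((⟨t, ht⟩ : {t : T // t ≠ X.tK}), perm4 0 3 1)) := by
    rw [← TetFlag.edge_swapAt_two_three]
    simp only [TetFlag.swapAt]
    congr 3
    decide
  have o1 := hz.opposite ⟨t, ht⟩ (σ := perm4 0 1 2) (τ := perm4 2 3 0)
    (by decide) (by decide)
  have o2 := hz.opposite ⟨t, ht⟩ (σ := perm4 1 2 0) (τ := perm4 0 3 1)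
    (by decide) (by decide)
  have o3 := hz.opposite ⟨t, ht⟩ (σ := perm4 0 2 3) (τ := perm4 3 1 0)
    (by decide) (by decide)
  have o3' : z (TetFlag.edge ((⟨t, ht⟩ : {t : T // t ≠ X.tK}), perm4 1 3 2)) =
      z (TetFlag.edge ((⟨t, ht⟩ : {t : T // t ≠ X.tK}), perm4 3 1 0)) := by
    rw [← TetFlag.edge_swapAt_two_three, ← TetFlag.edge_swapAt_zero_one]
    simp only [TetFlag.swapAt]
    congr 3
    decide
  simp only [hwt] at h
  rw [e1, e2] at hm
  rw [hm, o3', o3, o1, ← o2, mul_right_comm (z _), hm, neg_mul_neg, one_mul,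
    inv_one] at h
  rw [Fin.prod_univ_four, ← h,
    defect_eq (ha _) (ρ := perm4 2 1 3) (τ := perm4 3 1 2) (by decide) (by decide),
    defect_eq (ha _) (ρ := perm4 3 0 2) (τ := perm4 2 0 3) (by decide) (by decide),
    defect_eq (ha _) (ρ := perm4 0 3 1) (τ := perm4 1 3 0) (by decide) (by decide),
    defect_eq (ha _) (ρ := perm4 1 2 0) (τ := perm4 0 2 1) (by decide) (by decide),
    show OrientedTriangulation.faceFlag 0 = perm4 3 2 1 by decide,
    show OrientedTriangulation.faceFlag 1 = perm4 2 3 0 by decide,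
    show OrientedTriangulation.faceFlag 2 = perm4 1 0 3 by decide,
    show OrientedTriangulation.faceFlag 3 = perm4 0 1 2 by decide]
  simp only [neg_mul, mul_neg, neg_neg]

include hglue

/-- Only the faces 023 and 123 count. By the weights and the gluing of the distinguished face, the
value on `a → 3` divided by that on `a → 2` is `ζ⁻¹` in both faces, `a = 0, 1`. The values on 2 → 3
agree, and the faces enter with opposite orientations. -/
lemma prod_defect_tK : ∏ i, X.defect V (X.tK, OrientedTriangulation.faceFlag i) = 1 := by
  have r {σ τ : Perm (Fin 4)} (h : τ = σ * Equiv.swap 0 1) : V (X.tK, τ) = (V (X.tK, σ))⁻¹ :=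
    h ▸ hr (X.tK, σ)
  have s {σ τ : Perm (Fin 4)} (h : Perm.sign σ = 1) (h' : τ = σ * Equiv.swap 2 3) :
      V (X.tK, τ) = tetWeight (X.outerProd z (X.spoke 0)) σ * V (X.tK, σ) := by
    rw [h', ← weight_tK]
    exact hw (X.tK, σ) h
  have g {σ τ : Perm (Fin 4)} (h : σ 3 = 2 ∨ σ 3 = 3) (h' : τ = Equiv.swap 2 3 * σ) :
      V (X.tK, τ) = V (X.tK, σ) := by rw [h', ← X.glue_tK h, hglue]
  generalize X.outerProd z (X.spoke 0) = ζ at s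
  have one {σ : Perm (Fin 4)} (h : s(σ 0, σ 1) ≠ s(0, 2)) (h' : s(σ 0, σ 1) ≠ s(1, 2)) :
      tetWeight ζ σ = 1 := by rw [tetWeight, if_neg h, if_neg h']
  have s23 := s (σ := perm4 2 3 0) (τ := perm4 2 3 1) (by decide) (by decide)
  have s02 := s (σ := perm4 0 2 3) (τ := perm4 0 2 1) (by decide) (by decide)
  have s03 := s (σ := perm4 0 3 1) (τ := perm4 0 3 2) (by decide) (by decide)
  have s12 := s (σ := perm4 1 2 0) (τ := perm4 1 2 3) (by decide) (by decide)
  have s13 := s (σ := perm4 1 3 2) (τ := perm4 1 3 0) (by decide) (by decide)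
  have g0 := g (σ := perm4 0 2 1) (τ := perm4 0 3 1) (by decide) (by decide)
  have g1 := g (σ := perm4 1 2 0) (τ := perm4 1 3 0) (by decide) (by decide)
  rw [one (by decide) (by decide), one_mul] at s23 s03 s13
  rw [tetWeight, if_pos (by decide)] at s02
  rw [tetWeight, if_neg (by decide), if_pos (by decide), ← g1, s13] at s12
  rw [g0, s02] at s03
  rw [Fin.prod_univ_four,
    defect_eq (avoidsK_tK (by decide)) (ρ := perm4 2 1 3) (τ := perm4 3 1 2) (by decide) (by decide),
    defect_eq (avoidsK_tK (by decide)) (ρ := perm4 3 0 2) (τ := perm4 2 0 3) (by decide) (by decide),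
    defect_of_not_avoidsK (not_avoidsK_tK (by decide)),
    defect_of_not_avoidsK (not_avoidsK_tK (by decide)),
    show OrientedTriangulation.faceFlag 0 = perm4 3 2 1 by decide,
    show OrientedTriangulation.faceFlag 1 = perm4 2 3 0 by decide,
    r (σ := perm4 1 2 3) (τ := perm4 2 1 3) (by decide),
    r (σ := perm4 1 3 2) (τ := perm4 3 1 2) (by decide),
    r (σ := perm4 2 3 1) (τ := perm4 3 2 1) (by decide),
    r (σ := perm4 0 3 2) (τ := perm4 3 0 2) (by decide),
    r (σ := perm4 0 2 3) (τ := perm4 2 0 3) (by decide), s23, s12, s03]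
  generalize V (X.tK, perm4 0 2 3) = a
  generalize V (X.tK, perm4 1 3 2) = b
  generalize V (X.tK, perm4 2 3 0) = c
  simp only [neg_mul, mul_neg, neg_neg, mul_one, mul_inv, inv_inv]
  trans ζ * ζ⁻¹ * (a * a⁻¹) * (b * b⁻¹) * (c * c⁻¹)
  · ac_rfl
  · simp only [mul_inv_cancel, mul_one]

end Closed

include hz in
/-- If the first homology vanishes, then the shape parameters come from a face system. -/
lemma exists_isFaceSystem (h : Subsingleton X.H₁) :
    ∃ V : TetFlag T → Bˣ, X.IsFaceSystem V ∧
      ∀ F : TetFlag {t : T // t ≠ X.tK}, Perm.sign F.2 = 1 →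
        V (X.lift (F.swapAt 2 3)) = z F.edge * V (X.lift F) := by
  classical
  -- `V₀` has the right changes around the edges but need not satisfy the face equation. Dividing by
  -- a 1-cochain `C` whose coboundary is the defect repairs this, and keeps the changes since `C`
  -- only depends on the directed edge.
  obtain ⟨V₀, hg, hr, hw⟩ := OrientedTriangulation.exists_potential
    (weight_opposite (X := X) (z := z)) (prod_weight hz.prod)
  obtain ⟨C, cg, cs, cr, cδ⟩ := X.isOneVertexManifold.exists_cochain h (defect_glue hg)
    (defect_swap_zero_one (X := X) hr) (defect_swap_one_two hr) (fun t => by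
      by_cases ht : t = X.tK
      · rw [ht]
        exact prod_defect_tK hg hr hw
      · exact prod_defect_of_ne hz hr hw ht)
  let V : TetFlag T → Bˣ :=
    fun F => if X.AvoidsK F then V₀ F * (C F)⁻¹ else -1
  have hV {F : TetFlag T} (h : X.AvoidsK F) : V F = V₀ F * (C F)⁻¹ := if_pos h
  have hV' {F : TetFlag T} (h : ¬ X.AvoidsK F) : V F = -1 := if_neg h
  have reverse (F : TetFlag T) : V (F.swapAt 0 1) = (V F)⁻¹ := by
    by_cases ha : X.AvoidsK F
    · rw [hV ha, hV (ha.swapAt (by decide) (by decide)), hr, cr, mul_inv]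
    · rw [hV' ha, hV' (not_avoidsK_swapAt ha (by decide) (by decide)), inv_neg, inv_one]
  have face (F : TetFlag T) :
      V ((F.swapAt 0 1).swapAt 1 2) * (V (F.swapAt 1 2))⁻¹ * V F = -1 := by
    by_cases ha : X.AvoidsK F
    · have h1 := cδ F
      rw [defect_of_avoidsK ha] at h1
      have ha1 : X.AvoidsK (F.swapAt 0 1) := ha.swapAt (by decide) (by decide)
      rw [hV ha, hV (ha.swapAt (by decide) (by decide)), hV (ha1.swapAt (by decide) (by decide))]
      trans V₀ ((F.swapAt 0 1).swapAt 1 2) * (V₀ (F.swapAt 1 2))⁻¹ * V₀ F *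
        (C ((F.swapAt 0 1).swapAt 1 2) * (C (F.swapAt 1 2))⁻¹ * C F)⁻¹
      · simp only [mul_inv, inv_inv]
        generalize C F = a
        generalize C (F.swapAt 1 2) = b
        generalize C ((F.swapAt 0 1).swapAt 1 2) = c
        generalize (V₀ (F.swapAt 1 2))⁻¹ = d
        ac_rfl
      · rw [h1, inv_neg, mul_neg, mul_inv_cancel]
    · have ha1 := not_avoidsK_swapAt ha (show (0 : Fin 4) ≠ 3 by decide) (show (1 : Fin 4) ≠ 3 by decide)
      rw [hV' ha, hV' (not_avoidsK_swapAt ha (by decide) (by decide)),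
        hV' (not_avoidsK_swapAt ha1 (by decide) (by decide)), inv_neg, inv_one, neg_mul_neg, one_mul,
        one_mul]
  have shape (F : TetFlag {t : T // t ≠ X.tK}) (hF : Perm.sign F.2 = 1) :
      V (X.lift (F.swapAt 2 3)) = z F.edge * V (X.lift F) := by
    rw [hV (avoidsK_of_ne (F := X.lift F) F.1.2),
      hV (avoidsK_of_ne (F := X.lift (F.swapAt 2 3)) F.1.2), lift_swapAt, cs, hw _ hF,
      weight_lift, mul_assoc]
  have tri (t : T) (ht : t ≠ X.tK) (σ : Perm (Fin 4)) (hσ : Perm.sign σ = 1) :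
      V (t, σ * perm4 2 1 0) * V (t, σ * perm4 3 2 0) * V (t, σ * perm4 1 3 0) = 1 ∧
      (V (t, σ * perm4 2 1 0) * V (t, σ * perm4 3 2 0) * V (t, σ * perm4 0 3 1) +
        V (t, σ * perm4 2 1 0) * V (t, σ * perm4 0 2 3) + V (t, σ * perm4 0 1 2) :
        B) = 0 := by
    have hs := IsTriangleSystem.of_flags reverse face t σ
    have q {π ρ : Perm (Fin 4)} (hπ : Perm.sign π = 1) (hρ : ρ = π * Equiv.swap 2 3) :
        V (t, σ * ρ) / V (t, σ * π) =
          z (TetFlag.edge ((⟨t, ht⟩ : {t : T // t ≠ X.tK}), σ * π)) := by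
      have := shape ((⟨t, ht⟩ : {t : T // t ≠ X.tK}), σ * π)
        (by rw [Perm.sign_mul, hσ, hπ, one_mul])
      rw [div_eq_iff_eq_mul, hρ, ← mul_assoc]
      exact this
    have e1 : TetFlag.edge ((⟨t, ht⟩ : {t : T // t ≠ X.tK}), σ * perm4 0 2 3) =
        (TetFlag.swapAt 1 2 ((⟨t, ht⟩ : {t : T // t ≠ X.tK}), σ * perm4 0 1 2)).edge := by
      rw [← TetFlag.edge_swapAt_two_three]
      simp only [TetFlag.swapAt, mul_assoc]
      congr 3
      decide
    have e2 : TetFlag.edge ((⟨t, ht⟩ : {t : T // t ≠ X.tK}), σ * perm4 0 3 1) =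
        (TetFlag.swapAt 1 3 ((⟨t, ht⟩ : {t : T // t ≠ X.tK}), σ * perm4 0 1 2)).edge := by
      rw [← TetFlag.edge_swapAt_two_three]
      simp only [TetFlag.swapAt, mul_assoc]
      congr 3
      decide
    have h0 : Perm.sign (σ * perm4 0 1 2) = 1 := by
      rw [Perm.sign_mul, hσ]
      decide
    have hu := hs.triangle_u_iff.2 (by
      rw [q (π := perm4 0 1 2) (ρ := perm4 0 1 3) (by decide) (by decide),
        q (π := perm4 0 2 3) (ρ := perm4 0 2 1) (by decide) (by decide),
        q (π := perm4 0 3 1) (ρ := perm4 0 3 2) (by decide) (by decide), e1, e2]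
      exact hz.mul _ h0)
    refine ⟨hu, (hs.triangle_v_iff hu).2 ?_⟩
    rw [q (π := perm4 0 1 2) (ρ := perm4 0 1 3) (by decide) (by decide),
      q (π := perm4 0 2 3) (ρ := perm4 0 2 1) (by decide) (by decide), e1]
    exact hz.sub _ h0
  have tri' (t : T) (ht : t ≠ X.tK) (σ : Perm (Fin 4)) :
      V (t, σ * perm4 2 1 0) * V (t, σ * perm4 3 2 0) * V (t, σ * perm4 1 3 0) = 1 ∧
      (V (t, σ * perm4 2 1 0) * V (t, σ * perm4 3 2 0) * V (t, σ * perm4 0 3 1) +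
        V (t, σ * perm4 2 1 0) * V (t, σ * perm4 0 2 3) + V (t, σ * perm4 0 1 2) :
        B) = 0 := by
    by_cases hσ : Perm.sign σ = 1
    · exact tri t ht σ hσ
    · obtain ⟨τ, rfl⟩ : ∃ τ, σ = τ * Equiv.swap 1 2 := ⟨σ * Equiv.swap 1 2, by simp [mul_assoc]⟩
      have hτ : Perm.sign τ = 1 := by
        have := (Int.units_eq_one_or _).resolve_left hσ
        simpa using this
      obtain ⟨hu, hv⟩ := tri t ht τ hτ
      have hs := IsTriangleSystem.of_flags reverse face t τ
      have hu' := hs.triangle_u_reflect hu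
      have hv' := hs.triangle_v_reflect hu hv
      simp only [mul_assoc τ, show Equiv.swap 1 2 * perm4 2 1 0 = perm4 1 2 0 by decide,
        show Equiv.swap 1 2 * perm4 3 2 0 = perm4 3 1 0 by decide,
        show Equiv.swap 1 2 * perm4 1 3 0 = perm4 2 3 0 by decide,
        show Equiv.swap 1 2 * perm4 0 3 1 = perm4 0 3 2 by decide,
        show Equiv.swap 1 2 * perm4 0 2 3 = perm4 0 1 3 by decide,
        show Equiv.swap 1 2 * perm4 0 1 2 = perm4 0 2 1 by decide]
      exact ⟨hu', hv'⟩
  refine ⟨V, ⟨fun F => ?_, reverse, face, fun t ht σ => (tri' t ht σ).1,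
    fun t ht σ => (tri' t ht σ).2, fun σ h2 h3 => ?_⟩, shape⟩
  · by_cases ha : X.AvoidsK F
    · rw [hV ha, hV ha.glue, hg, cg]
    · rw [hV' ha, hV' (mt avoidsK_glue_iff.1 ha)]
  -- The fold equation holds because the edge 23 of `tK` has weight 1.
  · have key : ∀ σ : Perm (Fin 4), (σ 2 = 0 ∨ σ 2 = 1) → (σ 3 = 0 ∨ σ 3 = 1) →
        s(σ 0, σ 1) ≠ s(0, 2) ∧ s(σ 0, σ 1) ≠ s(1, 2) ∧ (σ * Equiv.swap 2 3 : Perm (Fin 4)) 3 = σ 2 ∧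
          (σ * Equiv.swap 2 3 : Perm (Fin 4)) 2 = σ 3 := by decide
    have even (σ : Perm (Fin 4)) (h2 : σ 2 = 0 ∨ σ 2 = 1) (h3 : σ 3 = 0 ∨ σ 3 = 1)
        (hσ : Perm.sign σ = 1) : V₀ (X.tK, σ * Equiv.swap 2 3) = V₀ (X.tK, σ) := by
      have h1 := hw (X.tK, σ) hσ
      rw [weight_tK, tetWeight, if_neg (key σ h2 h3).1, if_neg (key σ h2 h3).2.1, one_mul] at h1
      exact h1
    have hC : C (X.tK, σ * Equiv.swap 2 3) = C (X.tK, σ) := cs (X.tK, σ)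
    obtain ⟨-, -, k3, k2⟩ := key σ h2 h3
    rw [hV (avoidsK_tK (by rwa [k3])), hV (avoidsK_tK h3), hC]
    congr 1
    by_cases hσ : Perm.sign σ = 1
    · exact even σ h2 h3 hσ
    · have := even (σ * Equiv.swap 2 3) (by rwa [k2]) (by rwa [k3])
        (by simp [(Int.units_eq_one_or _).resolve_left hσ])
      rw [mul_assoc, Equiv.swap_mul_self, mul_one] at this
      exact this.symm

end ParticularHTriangulation

/-! ### Uniqueness of face systems, and the isomorphism. -/

namespace ParticularHTriangulation

variable {T : Type*} {X : ParticularHTriangulation T} [Fintype T]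

/-- If the first homology vanishes, then a 1-cocycle on the triangles that do not contain `K` is
trivial. -/
lemma eq_one_of_cocycle (h : Subsingleton X.H₁) {A : Type*} [CommGroup A] {C : TetFlag T → A}
    (hglue : ∀ F, X.AvoidsK F → C (X.glue F) = C F)
    (h23 : ∀ F, F.1 ≠ X.tK → C (F.swapAt 2 3) = C F)
    (hfold : ∀ σ : Perm (Fin 4), (σ 2 = 0 ∨ σ 2 = 1) → (σ 3 = 0 ∨ σ 3 = 1) →
      C (X.tK, σ * Equiv.swap 2 3) = C (X.tK, σ))
    (h01 : ∀ F, X.AvoidsK F → C (F.swapAt 0 1) = (C F)⁻¹)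
    (hδ : ∀ F, X.AvoidsK F →
      C ((F.swapAt 0 1).swapAt 1 2) * (C (F.swapAt 1 2))⁻¹ * C F = 1)
    {F : TetFlag T} (hF : X.AvoidsK F) : C F = 1 := by
  classical
  -- On the faces 023 and 123 of `tK`, `C` is the coboundary of a function `φ` on the vertices,
  -- normalized to 1 at 2 and 3. This defines an extension over all of `tK`, including the edge `K`.
  let φ : Fin 4 → A := fun i => if i = 0 ∨ i = 1 then C (X.tK, perm4 i 2 3) else 1
  have φ2 : φ 2 = 1 := if_neg (by decide)
  have φ3 : φ 3 = 1 := if_neg (by decide)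
  have φ_swap (i : Fin 4) : φ (Equiv.swap 2 3 i) = φ i := by
    have key : ∀ i : Fin 4, Equiv.swap 2 3 i = i ∨ i = 2 ∨ i = 3 := by decide
    rcases key i with h | rfl | rfl
    · rw [h]
    · rw [Equiv.swap_apply_left, φ2, φ3]
    · rw [Equiv.swap_apply_right, φ2, φ3]
  have hφ (σ : Perm (Fin 4)) (h3 : σ 3 = 0 ∨ σ 3 = 1) :
      C (X.tK, σ) = φ (σ 0) * (φ (σ 1))⁻¹ := by
    have key : ∀ σ : Perm (Fin 4), (σ 3 = 0 ∨ σ 3 = 1) → ∃ a : Fin 4, (a = 0 ∨ a = 1) ∧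
        (σ = perm4 a 2 3 ∨ σ = perm4 a 3 2 ∨ σ = perm4 2 a 3 ∨ σ = perm4 3 a 2 ∨
          σ = perm4 2 3 a ∨ σ = perm4 3 2 a) := by decide
    have val : ∀ a : Fin 4, (a = 0 ∨ a = 1) →
        ((perm4 a 2 3 0 = a ∧ perm4 a 2 3 1 = 2) ∧ (perm4 a 3 2 0 = a ∧ perm4 a 3 2 1 = 3) ∧
        (perm4 2 a 3 0 = 2 ∧ perm4 2 a 3 1 = a) ∧ (perm4 3 a 2 0 = 3 ∧ perm4 3 a 2 1 = a) ∧
        (perm4 2 3 a 0 = 2 ∧ perm4 2 3 a 1 = 3) ∧ (perm4 3 2 a 0 = 3 ∧ perm4 3 2 a 1 = 2)) ∧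
        (perm4 a 2 3 2 = 3 ∧ (perm4 a 2 3 3 = 0 ∨ perm4 a 2 3 3 = 1) ∧
          (perm4 a 3 2 3 = 0 ∨ perm4 a 3 2 3 = 1) ∧ (perm4 2 3 a 3 = 0 ∨ perm4 2 3 a 3 = 1)) := by
      decide
    have eqs : ∀ a : Fin 4, (a = 0 ∨ a = 1) → perm4 a 3 2 = Equiv.swap 2 3 * perm4 a 2 3 ∧
        perm4 2 a 3 = perm4 a 2 3 * Equiv.swap 0 1 ∧ perm4 3 a 2 = perm4 a 3 2 * Equiv.swap 0 1 ∧
        perm4 3 2 a = perm4 2 3 a * Equiv.swap 0 1 ∧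
        perm4 2 3 a = perm4 a 2 3 * Equiv.swap 0 1 * Equiv.swap 1 2 ∧
        perm4 a 3 2 = perm4 a 2 3 * Equiv.swap 1 2 := by decide
    obtain ⟨a, ha, hσ⟩ := key σ h3
    obtain ⟨⟨v1, v2, v3, v4, v5, v6⟩, w1, w2, w3, w4⟩ := val a ha
    obtain ⟨e1, e2, e3, e4, e5, e6⟩ := eqs a ha
    have c1 : C (X.tK, perm4 a 2 3) = φ a := (if_pos ha).symm
    have c2 : C (X.tK, perm4 a 3 2) = φ a := by
      rw [e1, X.apply_fold hglue h23 hfold (.inr w1) w2, c1]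
    have c3 : C (X.tK, perm4 2 a 3) = (φ a)⁻¹ := by
      rw [e2, ← c1]
      exact h01 _ (avoidsK_tK w2)
    have c4 : C (X.tK, perm4 3 a 2) = (φ a)⁻¹ := by
      rw [e3, ← c2]
      exact h01 _ (avoidsK_tK w3)
    have c5 : C (X.tK, perm4 2 3 a) = 1 := by
      have := hδ (X.tK, perm4 a 2 3) (avoidsK_tK w2)
      simp only [TetFlag.swapAt, ← e5, ← e6, c1, c2] at this
      simpa using this
    have c6 : C (X.tK, perm4 3 2 a) = 1 := by
      rw [e4, ← inv_one, ← c5]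
      exact h01 _ (avoidsK_tK w4)
    rcases hσ with rfl | rfl | rfl | rfl | rfl | rfl
    · rw [c1, v1.1, v1.2, φ2, inv_one, mul_one]
    · rw [c2, v2.1, v2.2, φ3, inv_one, mul_one]
    · rw [c3, v3.1, v3.2, φ2, one_mul]
    · rw [c4, v4.1, v4.2, φ3, one_mul]
    · rw [c5, v5.1, v5.2, φ2, φ3, inv_one, mul_one]
    · rw [c6, v6.1, v6.2, φ2, φ3, inv_one, mul_one]
  -- `D` respects the gluing of the distinguished face because `φ` takes the same value at 2 and 3;
  -- so it is a 1-cocycle on all of `M`.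
  let D : TetFlag T → A := fun F => if F.1 = X.tK then φ (F.2 0) * (φ (F.2 1))⁻¹ else C F
  have D_tK {F : TetFlag T} (h : F.1 = X.tK) : D F = φ (F.2 0) * (φ (F.2 1))⁻¹ := if_pos h
  have D_ne {F : TetFlag T} (h : F.1 ≠ X.tK) : D F = C F := if_neg h
  have D_eq {F : TetFlag T} (h : X.AvoidsK F) : D F = C F := by
    by_cases ht : F.1 = X.tK
    · rw [D_tK ht, ← hφ F.2 (h ht), ← ht]
    · exact D_ne ht
  rw [← D_eq hF]
  refine X.isOneVertexManifold.eq_one_of_cocycle h (fun F => ?_) (fun F => ?_) (fun F => ?_)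
    (fun F => ?_) F
  · by_cases ha : X.AvoidsK F
    · rw [D_eq ha, D_eq ha.glue, hglue F ha]
    · obtain ⟨t, σ⟩ := F
      obtain ⟨rfl, h3⟩ := Classical.not_imp.1 ha
      have key : ∀ a : Fin 4, ¬ (a = 0 ∨ a = 1) → a = 2 ∨ a = 3 := by decide
      rw [X.glue_tK (key _ h3), D_tK rfl, D_tK rfl]
      simp only [Perm.coe_mul, Function.comp_apply, φ_swap]
  · by_cases ht : F.1 = X.tK
    · rw [D_tK ht, D_tK (F := F.swapAt 2 3) ht]
      rfl
    · rw [D_ne ht, D_ne (F := F.swapAt 2 3) ht, h23 F ht]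
  · by_cases ht : F.1 = X.tK
    · rw [D_tK ht, D_tK (F := F.swapAt 0 1) ht, mul_inv_rev, inv_inv]
      rfl
    · rw [D_ne ht, D_ne (F := F.swapAt 0 1) ht, h01 F (avoidsK_of_ne ht)]
  · by_cases ht : F.1 = X.tK
    · rw [D_tK ht, D_tK (F := F.swapAt 1 2) ht, D_tK (F := (F.swapAt 0 1).swapAt 1 2) ht]
      have e0 : ((F.swapAt 0 1).swapAt 1 2).2 0 = F.2 1 := rfl
      have e1 : ((F.swapAt 0 1).swapAt 1 2).2 1 = F.2 2 := rfl
      have e2 : (F.swapAt 1 2).2 0 = F.2 0 := rfl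
      have e3 : (F.swapAt 1 2).2 1 = F.2 2 := rfl
      rw [e0, e1, e2, e3]
      group
    · rw [D_ne ht, D_ne (F := F.swapAt 1 2) ht, D_ne (F := (F.swapAt 0 1).swapAt 1 2) ht,
        hδ F (avoidsK_of_ne ht)]

namespace IsFaceSystem

omit [Fintype T] in
lemma map {B B' : Type*} [CommRing B] [CommRing B'] (f : B →+* B') {V : TetFlag T → Bˣ}
    (hV : X.IsFaceSystem V) : X.IsFaceSystem fun F => Units.map (f : B →* B') (V F) where
  glue F := by rw [hV.glue]
  reverse F := by rw [hV.reverse, map_inv]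
  face F := by
    rw [← map_inv, ← map_mul, ← map_mul, hV.face]
    ext
    simp
  triangle_u t ht σ := by rw [← map_mul, ← map_mul, hV.triangle_u t ht, map_one]
  triangle_v t ht σ := by
    have := congrArg f (hV.triangle_v t ht σ)
    rw [map_add, map_add, map_mul, map_mul, map_mul, map_zero] at this
    exact this
  fold σ h2 h3 := by rw [hV.fold σ h2 h3]

/-- If the first homology vanishes, then a face system is determined by its shape parameters. -/
lemma eq_of_shape (h : Subsingleton X.H₁) {B : Type*} [CommRing B] {U V : TetFlag T → Bˣ}
    (hU : X.IsFaceSystem U) (hV : X.IsFaceSystem V)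
    (hs : ∀ F : TetFlag {t : T // t ≠ X.tK}, Perm.sign F.2 = 1 →
      U (X.lift (F.swapAt 2 3)) / U (X.lift F) = V (X.lift (F.swapAt 2 3)) / V (X.lift F))
    {F : TetFlag T} (hF : X.AvoidsK F) : U F = V F := by
  have even (F : TetFlag T) (ht : F.1 ≠ X.tK) (hF : Perm.sign F.2 = 1) :
      U (F.swapAt 2 3) / V (F.swapAt 2 3) = U F / V F := by
    obtain ⟨F, rfl⟩ := exists_lift ht
    exact div_eq_div_iff_div_eq_div.1 (hs F hF)
  -- Equal shape parameters mean that `U / V` depends only on the directed edge outside `tK`, and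
  -- the signs in the two face equations cancel, so the quotient is a cocycle.
  refine div_eq_one.1 (eq_one_of_cocycle h (C := fun F => U F / V F) (fun F _ => ?_) (fun F ht => ?_)
    (fun σ h2 h3 => ?_) (fun F _ => ?_) (fun F _ => ?_) hF)
  · rw [hU.glue, hV.glue]
  · by_cases h1 : Perm.sign F.2 = 1
    · exact even F ht h1
    · have := even (F.swapAt 2 3) ht (by
        rw [TetFlag.sign_swapAt (by decide), TetFlag.sign_ne_one h1, neg_neg])
      rw [TetFlag.swapAt_swapAt] at this
      exact this.symm
  · rw [hU.fold σ h2 h3, hV.fold σ h2 h3]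
  · rw [hU.reverse, hV.reverse, inv_div_inv, inv_div]
  · have h1 := hU.face F
    rw [← hV.face F] at h1
    rw [inv_div]
    trans (U ((F.swapAt 0 1).swapAt 1 2) * (U (F.swapAt 1 2))⁻¹ * U F) /
      (V ((F.swapAt 0 1).swapAt 1 2) * (V (F.swapAt 1 2))⁻¹ * V F)
    · simp only [div_eq_mul_inv, mul_inv, inv_inv]
      generalize (U (F.swapAt 1 2))⁻¹ = a
      generalize (V F)⁻¹ = b
      generalize (V ((F.swapAt 0 1).swapAt 1 2))⁻¹ = c
      ac_rfl
    · rw [h1, div_self']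

end IsFaceSystem

section Range

variable (k : Type*) [CommRing k]

omit [Fintype T] in
/-- Kashaev's ring is generated by the `v` of the short edges in the hexagons that do not contain
`K`, and their inverses. -/
lemma eq_top_of_vUnit_mem {S : Subalgebra k (X.KashaevRingAb k)}
    (hS : ∀ F, X.AvoidsK F → (X.vUnit k F : X.KashaevRingAb k) ∈ S) : S = ⊤ := by
  have hu {F : TetFlag T} (h : X.AvoidsK F) : X.uGen k ⟨F, h.not_meetsK⟩ ∈ S := by
    have : X.uGen k ⟨F, h.not_meetsK⟩ = X.vUnit k (F.swapAt 0 2) :=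
      congrArg Units.val (uUnit_eq k h)
    exact this ▸ hS _ h.swap02
  have hv {F : TetFlag T} (h : X.AvoidsK F) : X.vGen k ⟨F, h.not_meetsK⟩ ∈ S :=
    coe_vUnit k h ▸ hS F h
  -- For the short edge opposite to `K`, the triangular relations express `u` and `v` through the
  -- other generators.
  have hopp {σ : Perm (Fin 4)} (h2 : σ 2 = 0 ∨ σ 2 = 1) (h3 : σ 3 = 0 ∨ σ 3 = 1)
      (h : ¬ X.MeetsK (X.tK, σ * perm4 0 2 3)) :
      X.uGen k ⟨_, h⟩ ∈ S ∧ X.vGen k ⟨_, h⟩ ∈ S := by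
    have a2 : X.AvoidsK (X.tK, σ * perm4 0 3 1) := avoidsK_tK h2
    have a3 : X.AvoidsK (X.tK, σ * perm4 0 1 2) := avoidsK_tK h3
    have hw := IsTriangleSystem.of_flags (vUnit_reverse (X := X) k) (vUnit_face k) X.tK σ
    have h1 := uUnit_opposite k h2 h3 h
    rw [mul_assoc, mul_eq_one_iff_eq_inv, mul_inv,
      ← hw.reverse_eq (σ := perm4 1 3 0) (τ := perm4 3 1 0) (by decide),
      ← hw.reverse_eq (σ := perm4 2 1 0) (τ := perm4 1 2 0) (by decide)] at h1
    have b2 : X.AvoidsK (X.tK, σ * perm4 3 1 0) := avoidsK_tK h2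
    have b3 : X.AvoidsK (X.tK, σ * perm4 1 2 0) := avoidsK_tK h3
    have hu1 : X.uGen k ⟨_, h⟩ ∈ S := by
      have h4 := congrArg Units.val h1
      rw [Units.val_mul] at h4
      change X.uGen k ⟨_, h⟩ = _ at h4
      rw [h4]
      exact S.mul_mem (hS _ b2) (hS _ b3)
    refine ⟨hu1, ?_⟩
    have h4 := vGen_triangle k ⟨_, h⟩ ⟨_, a2.not_meetsK⟩ ⟨_, a3.not_meetsK⟩
      (by
        simp only [TetFlag.swapAt, mul_assoc]
        congr 2
        decide)
      (by
        simp only [TetFlag.swapAt, mul_assoc]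
        congr 2
        decide)
    rw [add_eq_zero_iff_neg_eq] at h4
    rw [← h4]
    exact S.neg_mem (S.add_mem (S.mul_mem (S.mul_mem hu1 (hu a2)) (hv a3))
      (S.mul_mem hu1 (hv a2)))
  have all (e : X.ShortEdge) : X.uGen k e ∈ S ∧ X.vGen k e ∈ S := by
    obtain ⟨F, h⟩ := e
    by_cases ha : X.AvoidsK F
    · exact ⟨hu ha, hv ha⟩
    · obtain ⟨σ, -, h2, h3, rfl⟩ := IsFaceSystem.exists_opposite h ha
      exact hopp h2 h3 h
  rw [eq_top_iff]
  rintro x -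
  obtain ⟨y, rfl⟩ := X.proj_surjective k x
  induction y using FreeAlgebra.induction with
  | grade0 r =>
    rw [AlgHom.commutes]
    exact S.algebraMap_mem r
  | grade1 g =>
    cases g with
    | u e => exact (all e).1
    | v e => exact (all e).2
  | mul a b ha hb =>
    rw [map_mul]
    exact S.mul_mem ha hb
  | add a b ha hb =>
    rw [map_add]
    exact S.add_mem ha hb

end Range

section Inverse

variable [DecidableEq T] (k : Type*) [CommRing k]

/-- The homomorphism from the coordinate ring of the deformation variety to Kashaev's ring. -/
noncomputable abbrev comparison : X.collapse.DeformationRing k →ₐ[k] X.KashaevRingAb k :=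
  (X.isFaceSystem_vUnit k).shapeHom k

lemma comparison_shape {F : TetFlag {t : T // t ≠ X.tK}} (hF : Perm.sign F.2 = 1) :
    comparison k (X.collapse.shape k F) =
      ((X.vUnit k (X.lift (F.swapAt 2 3)) / X.vUnit k (X.lift F) : (X.KashaevRingAb k)ˣ) :
        X.KashaevRingAb k) :=
  (X.isFaceSystem_vUnit k).shapeHom_shape k hF

variable {k} {V : TetFlag T → (X.collapse.DeformationRing k)ˣ} (hV : X.IsFaceSystem V)
  (hs : ∀ F : TetFlag {t : T // t ≠ X.tK}, Perm.sign F.2 = 1 →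
    V (X.lift (F.swapAt 2 3)) = X.collapse.zUnit k F.edge * V (X.lift F))

include hs

/-- It suffices to compare shape parameters: `kashaevHom` sends the universal face system to `V`,
whose shape parameters are the tautological ones. -/
lemma kashaevHom_comparison (x : X.collapse.DeformationRing k) :
    hV.kashaevHom k (comparison k x) = x := by
  suffices h : (hV.kashaevHom k).comp (comparison k) = AlgHom.id k _ from DFunLike.congr_fun h x
  refine Ideal.Quotient.algHom_ext _ (MvPolynomial.algHom_ext fun i => ?_)
  obtain ⟨F, hF, rfl⟩ := TetFlag.exists_even_edge i
  change hV.kashaevHom k (comparison k (X.collapse.shape k F)) = X.collapse.shape k F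
  rw [comparison_shape k hF]
  have hg {G : TetFlag T} (hG : X.AvoidsK G) :
      Units.map (hV.kashaevHom k : X.KashaevRingAb k →* X.collapse.DeformationRing k)
        (X.vUnit k G) = V G := by
    ext
    rw [Units.coe_map, coe_vUnit k hG]
    exact hV.kashaevHom_vGen k hG _
  have h1 := congrArg Units.val (map_div
    (Units.map (hV.kashaevHom k : X.KashaevRingAb k →* X.collapse.DeformationRing k))
    (X.vUnit k (X.lift (F.swapAt 2 3))) (X.vUnit k (X.lift F)))
  rw [hg (avoidsK_of_ne (F := X.lift F) F.1.2),
    hg (avoidsK_of_ne (F := X.lift (F.swapAt 2 3)) F.1.2), hs F hF, mul_div_cancel_right,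
    OrientedTriangulation.coe_zUnit] at h1
  exact h1

include hV in
-- The image of `V` under the comparison map has the same shape parameters as the universal face
-- system, so the two agree by `eq_of_shape`. Hence the range contains a generating set.
lemma comparison_surjective (h : Subsingleton X.H₁) :
    Function.Surjective (comparison (X := X) k) := by
  rw [← AlgHom.range_eq_top]
  refine eq_top_of_vUnit_mem k fun F hF => ?_
  rw [IsFaceSystem.eq_of_shape h (X.isFaceSystem_vUnit k)
    (hV.map (comparison (X := X) k : X.collapse.DeformationRing k →+* X.KashaevRingAb k))
    (fun G hG => ?_) hF]
  · exact ⟨_, rfl⟩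
  · rw [← map_div, hs G hG, mul_div_cancel_right]
    ext
    rw [← comparison_shape k hG, Units.coe_map, OrientedTriangulation.coe_zUnit]
    rfl

end Inverse

end ParticularHTriangulation

theorem mainTheorem1 (k : Type*) [CommRing k] {T : Type*} [Fintype T] [DecidableEq T]
    (X : ParticularHTriangulation T) :
    ∃ f : X.collapse.DeformationRing k →ₐ[k] X.KashaevRingAb k,
      (∀ F : TetFlag {t : T // t ≠ X.tK}, Perm.sign F.2 = 1 →
        ∃ w : (X.KashaevRingAb k)ˣ,
          (w : X.KashaevRingAb k) = X.vGen k (X.shortEdge F) ∧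
          f (X.collapse.shape k F) =
            X.vGen k (X.shortEdge (F.swapAt 2 3)) * ((w⁻¹ : (X.KashaevRingAb k)ˣ) : X.KashaevRingAb k)) ∧
      (Subsingleton X.H₁ → Function.Bijective f) := by
  refine ⟨ParticularHTriangulation.comparison k, fun F hF => ?_, fun h => ?_⟩
  · have h1 := ParticularHTriangulation.avoidsK_of_ne (X := X) (F := X.lift F) F.1.2
    have h2 := ParticularHTriangulation.avoidsK_of_ne (X := X) (F := X.lift (F.swapAt 2 3)) F.1.2
    refine ⟨X.vUnit k (X.lift F), ParticularHTriangulation.coe_vUnit k h1, ?_⟩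
    rw [ParticularHTriangulation.comparison_shape k hF, div_eq_mul_inv, Units.val_mul,
      ParticularHTriangulation.coe_vUnit k h2]
    rfl
  · obtain ⟨V, hV, hs⟩ :=
      ParticularHTriangulation.exists_isFaceSystem (X.collapse.isShapeSystem_zUnit k) h
    exact ⟨fun x y hxy => by
      rw [← ParticularHTriangulation.kashaevHom_comparison hV hs x, hxy,
        ParticularHTriangulation.kashaevHom_comparison hV hs y],
      ParticularHTriangulation.comparison_surjective hV hs h⟩
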